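/- Conventions. $\Omega$ is the category of finite rooted trees $T$ (with designated leaves; vertices without inputs are allowed), whose arrows $S\to T$ are the maps $\Omega(S)\to\Omega(T)$ of symmetric coloured operads, where $\Omega(T)$ is the operad with the edges of $T$ as colours that is generated by the vertices of $T$. A dendroidal set is a functor $X:\Omega^{op}\to Set$, $\Omega[T]$ is the representable one, and the nerve of a symmetric coloured operad $\mathcal P$ is $N_d(\mathcal P)_T=\mathrm{Hom}(\Omega(T),\mathcal P)$. For an inner edge $e$ of $T$ (neither the root nor a leaf), $\Lambda^e[T]\subseteq\Omega[T]$ is the union of all faces of $T$ (contractions of an inner edge; deletions of a vertex with exactly one inner edge attached to it, together with the outer edges attached to it; the edges, if $T$ has exactly one vertex) except the contraction $\partial_e:T/e\to T$ of $e$. $X$ is an inner Kan complex if for all $T$ and $e$ the restriction $\mathrm{Hom}(\Omega[T],X)\to\mathrm{Hom}(\Lambda^e[T],X)$ is surjective, and a strict inner Kan complex if it is always bijective. Let $\eta$ be the tree with one edge and no vertex, and $C_n$ ($n\ge 0$) the corolla with one vertex, input edges $1,\dots,n$ and output edge $0$; for $0\le i\le n$ let $i:\eta\to C_n$ be the arrow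 with value the edge $i$. For $x_1,\dots,x_n,x\in X_\eta$ let $X(x_1,\dots,x_n;x)$ be the set of $f\in X_{C_n}$ with $i^*f=x_i$ for $1\le i\le n$ and $0^*f=x$. For $f,g\in X_{C_n}$ write $f\sim_i g$ with $1\le i\le n$ (resp. $f\sim_0 g$) if there is a dendrex $H$ whose shape is $C_n$ with a unary vertex grafted onto the input $i$ (resp. below the output $0$), whose outer face at $C_n$ is $f$, whose inner face is $g$, and whose outer face at the unary vertex is degenerate, namely the pullback of $i^*f$ along $C_1\to\eta$. Write $f\sim g$ if $f\sim_i g$ for some $0\le i\le n$; if $X$ is an inner Kan complex, this is an equivalence relation. Let $Ho(X)$ be the coloured collection with set of colours $X_\eta$ and $$Ho(X)(x_1,\dots,x_n;x)=X(x_1,\dots,x_n;x)/\!\sim .$$ Given an operad structure on the collection $Ho(X)$, a map of dendroidal sets $q:X\to N_d(Ho(X))$ is said to extend the quotient map $Sk_1(X)\to Ho(X)$ if it sends each $x\in X_\eta$ to the colour $x$, and each $f\in X(x_1,\dots,x_n;x)$ to its class $[f]\in Ho(X)(x_1,\dots,x_n;x)$. **Proposition 6.6.** Let $X$ be an inner Kan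 complex. There is a unique structure of a symmetric coloured operad on the collection $Ho(X)$ for which the quotient map $Sk_1(X)\to Ho(X)$ extends to a map of dendroidal sets $q:X\to N_d(Ho(X))$. If $X$ is a strict inner Kan complex, then (any such) $q$ is an isomorphism. -/

import Mathlib

open CategoryTheory Opposite

set_option linter.checkUnivs false

universe u v u' v' u'' v''

namespace Dendroidal

/-! ## Coloured operads -/

/-- The list of all inputs of a composite `f ∘ (g₁, …, gₙ)`, where `gᵢ` has the list of
inputs `b i`: the concatenation of the lists `b 0, …, b (n - 1)`. -/
abbrev concat {C : Type u} {n : ℕ} {k : Fin n → ℕ} (b : ∀ i, Fin (k i) → C) :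
    Fin (∑ i, k i) → C :=
  fun a => b (finSigmaFinEquiv.symm a).1 (finSigmaFinEquiv.symm a).2

lemma concat_apply {C : Type u} {n : ℕ} {k : Fin n → ℕ} (b : ∀ i, Fin (k i) → C)
    (p : Σ i, Fin (k i)) : concat b (finSigmaFinEquiv p) = b p.1 p.2 := by
  simp only [concat]
  exact congrArg (fun q : (Σ i, Fin (k i)) => b q.1 q.2) (finSigmaFinEquiv.symm_apply_apply p)

/-- The canonical identification of the inputs of `1 ∘ (f)` with those of `f`. -/
def oneCompEquiv (n : ℕ) : Fin (∑ _ : Fin 1, n) ≃ Fin n :=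
  finSigmaFinEquiv.symm.trans
    { toFun := fun p => p.2
      invFun := fun j => ⟨0, j⟩
      left_inv := fun ⟨i, j⟩ => by rw [Subsingleton.elim i 0]
      right_inv := fun _ => rfl }

/-- The canonical identification of the inputs of `f ∘ (1, …, 1)` with those of `f`. -/
def compOneEquiv (n : ℕ) : Fin (∑ _ : Fin n, 1) ≃ Fin n :=
  finSigmaFinEquiv.symm.trans (Equiv.sigmaUnique (Fin n) fun _ => Fin 1)

/-- The relabelling bijection of the inputs of a composite `f ∘ (g₁, …, gₙ)` induced by a
bijection `σ` of the inputs of `f` (a block permutation). -/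
def blockEquiv {m n : ℕ} (σ : Fin m ≃ Fin n) (k : Fin n → ℕ) :
    Fin (∑ i, k (σ i)) ≃ Fin (∑ i, k i) :=
  finSigmaFinEquiv.symm.trans
    ((Equiv.sigmaCongrLeft (β := fun i => Fin (k i)) σ).trans finSigmaFinEquiv)

/-- The relabelling bijection of the inputs of a composite `f ∘ (g₁, …, gₙ)` induced by
bijections `τ i` of the inputs of the `gᵢ` (a direct sum of permutations). -/
def sumEquiv {n : ℕ} {k l : Fin n → ℕ} (τ : ∀ i, Fin (k i) ≃ Fin (l i)) :
    Fin (∑ i, k i) ≃ Fin (∑ i, l i) :=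
  finSigmaFinEquiv.symm.trans ((Equiv.sigmaCongrRight τ).trans finSigmaFinEquiv)

/-- The canonical (order preserving) identification of the inputs of `(f ∘ (gᵢ)) ∘ (hᵢⱼ)` with
those of `f ∘ (gᵢ ∘ (hᵢⱼ)ⱼ)`. -/
def assocEquiv {n : ℕ} {k : Fin n → ℕ} (l : ∀ i, Fin (k i) → ℕ) :
    Fin (∑ a, concat l a) ≃ Fin (∑ i, ∑ j, l i j) :=
  finSigmaFinEquiv.symm.trans
    ((Equiv.sigmaCongrLeft (β := fun p : (Σ i, Fin (k i)) => Fin (l p.1 p.2))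
        finSigmaFinEquiv.symm).trans
      ((Equiv.sigmaAssoc fun i j => Fin (l i j)).trans
        ((Equiv.sigmaCongrRight fun _ => finSigmaFinEquiv).trans finSigmaFinEquiv)))

lemma concat_blockEquiv {C : Type u} {m n : ℕ} (σ : Fin m ≃ Fin n) {k : Fin n → ℕ}
    (b : ∀ i, Fin (k i) → C) (x : Fin (∑ i, k (σ i))) :
    concat (fun i => b (σ i)) x = concat b (blockEquiv σ k x) :=
  (concat_apply b (Equiv.sigmaCongrLeft (β := fun i => Fin (k i)) σ
    (finSigmaFinEquiv.symm x))).symm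

lemma concat_sumEquiv {C : Type u} {n : ℕ} {k l : Fin n → ℕ} (τ : ∀ i, Fin (k i) ≃ Fin (l i))
    {b : ∀ i, Fin (l i) → C} {b' : ∀ i, Fin (k i) → C} (hb : ∀ i j, b' i j = b i (τ i j))
    (x : Fin (∑ i, k i)) : concat b' x = concat b (sumEquiv τ x) :=
  (hb _ _).trans
    (concat_apply b (Equiv.sigmaCongrRight τ (finSigmaFinEquiv.symm x))).symm

lemma concat_assocEquiv {C : Type u} {n : ℕ} {k : Fin n → ℕ} {l : ∀ i, Fin (k i) → ℕ}
    (a : ∀ i j, Fin (l i j) → C) (x : Fin (∑ y, concat l y)) :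
    concat (k := concat l)
        (fun y => a (finSigmaFinEquiv.symm y).1 (finSigmaFinEquiv.symm y).2) x =
      concat (fun i => concat (a i)) (assocEquiv l x) :=
  ((concat_apply (fun i => concat (a i)) _).trans (concat_apply (a _) _)).symm

/-- The structure of a symmetric coloured operad (in sets) on a coloured collection `P`, where
`P n c d` is the set of operations with list of inputs `c 0, …, c (n - 1)` and output `d`.

The symmetric group actions are written as an action of all bijections `Fin m ≃ Fin n`: these
exist only for `m = n`, so this is an action of the groups `Σₙ`, in which `σ` sends
`P(c₁, …, cₙ; d)` to `P(c_{σ(1)}, …, c_{σ(n)}; d)`.  The list of inputs `c'` of the result is only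
required to be equal to `c ∘ σ`; this avoids casts. -/
@[ext]
structure OperadStr (C : Type u) (P : ∀ n : ℕ, (Fin n → C) → C → Type v) where
  /-- the unit operations -/
  one : ∀ d : C, P 1 (fun _ => d) d
  /-- the symmetries -/
  act : ∀ {m n : ℕ} (σ : Fin m ≃ Fin n) {c : Fin n → C} {c' : Fin m → C} {d : C},
    (∀ i, c' i = c (σ i)) → P n c d → P m c' d
  /-- the composition `f ∘ (g₁, …, gₙ)` -/
  comp : ∀ {n : ℕ} {c : Fin n → C} {d : C} {k : Fin n → ℕ} {b : ∀ i, Fin (k i) → C},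
    P n c d → (∀ i, P (k i) (b i) (c i)) → P (∑ i, k i) (concat b) d
  act_refl : ∀ {n : ℕ} {c : Fin n → C} {d : C} (f : P n c d),
    act (Equiv.refl _) (fun _ => rfl) f = f
  act_trans : ∀ {l m n : ℕ} (τ : Fin l ≃ Fin m) (σ : Fin m ≃ Fin n) {c : Fin n → C}
    {c' : Fin m → C} {c'' : Fin l → C} {d : C} (h' : ∀ i, c'' i = c' (τ i))
    (h : ∀ i, c' i = c (σ i)) (f : P n c d),
    act τ h' (act σ h f) = act (τ.trans σ) (fun i => (h' i).trans (h (τ i))) f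
  one_comp : ∀ {n : ℕ} {c : Fin n → C} {d : C} (f : P n c d),
    comp (one d) (fun _ => f) = act (oneCompEquiv n) (fun _ => rfl) f
  comp_one : ∀ {n : ℕ} {c : Fin n → C} {d : C} (f : P n c d),
    comp f (fun i => one (c i)) = act (compOneEquiv n) (fun _ => rfl) f
  assoc : ∀ {n : ℕ} {c : Fin n → C} {d : C} {k : Fin n → ℕ} {b : ∀ i, Fin (k i) → C}
    {l : ∀ i, Fin (k i) → ℕ} {a : ∀ i j, Fin (l i j) → C}
    (f : P n c d) (g : ∀ i, P (k i) (b i) (c i)) (h : ∀ i j, P (l i j) (a i j) (b i j)),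
    comp (k := concat l) (comp f g)
        (fun x => h (finSigmaFinEquiv.symm x).1 (finSigmaFinEquiv.symm x).2) =
      act (assocEquiv l) (concat_assocEquiv a) (comp f fun i => comp (g i) (h i))
  act_comp : ∀ {m n : ℕ} (σ : Fin m ≃ Fin n) {c : Fin n → C} {d : C} {k : Fin n → ℕ}
    {b : ∀ i, Fin (k i) → C} (f : P n c d) (g : ∀ i, P (k i) (b i) (c i)),
    comp (act σ (c' := fun i => c (σ i)) (fun _ => rfl) f) (fun i => g (σ i)) =
      act (blockEquiv σ k) (concat_blockEquiv σ b) (comp f g)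
  comp_act : ∀ {n : ℕ} {c : Fin n → C} {d : C} {k l : Fin n → ℕ} {b : ∀ i, Fin (l i) → C}
    {b' : ∀ i, Fin (k i) → C} (τ : ∀ i, Fin (k i) ≃ Fin (l i))
    (hb : ∀ i j, b' i j = b i (τ i j)) (f : P n c d) (g : ∀ i, P (l i) (b i) (c i)),
    comp f (fun i => act (τ i) (hb i) (g i)) =
      act (sumEquiv τ) (concat_sumEquiv τ hb) (comp f g)

/-- A symmetric coloured operad in sets. -/
structure Operad where
  Colour : Type u
  Op : ∀ n : ℕ, (Fin n → Colour) → Colour → Type v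
  str : OperadStr Colour Op

/-- Maps of coloured operads. -/
@[ext]
structure OperadHom (P : Operad.{u, v}) (Q : Operad.{u', v'}) where
  col : P.Colour → Q.Colour
  op : ∀ {n : ℕ} {c : Fin n → P.Colour} {d : P.Colour},
    P.Op n c d → Q.Op n (fun i => col (c i)) (col d)
  op_one : ∀ d : P.Colour, op (P.str.one d) = Q.str.one (col d)
  op_act : ∀ {m n : ℕ} (σ : Fin m ≃ Fin n) {c : Fin n → P.Colour} {c' : Fin m → P.Colour}
    {d : P.Colour} (h : ∀ i, c' i = c (σ i)) (f : P.Op n c d),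
    op (P.str.act σ h f) = Q.str.act σ (fun i => congrArg col (h i)) (op f)
  op_comp : ∀ {n : ℕ} {c : Fin n → P.Colour} {d : P.Colour} {k : Fin n → ℕ}
    {b : ∀ i, Fin (k i) → P.Colour} (f : P.Op n c d) (g : ∀ i, P.Op (k i) (b i) (c i)),
    op (P.str.comp f g) = Q.str.comp (op f) (fun i => op (g i))

/-- The identity map of an operad. -/
def OperadHom.id (P : Operad.{u, v}) : OperadHom P P where
  col := fun c => c
  op := fun f => f
  op_one _ := rfl
  op_act _ _ _ _ _ _ := rfl
  op_comp _ _ := rfl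

/-- Composition of operad maps (first `φ`, then `ψ`). -/
def OperadHom.comp {P : Operad.{u, v}} {Q : Operad.{u', v'}} {R : Operad.{u'', v''}}
    (φ : OperadHom P Q) (ψ : OperadHom Q R) : OperadHom P R where
  col := fun c => ψ.col (φ.col c)
  op := fun f => ψ.op (φ.op f)
  op_one d := by rw [φ.op_one, ψ.op_one]
  op_act σ _ _ _ h f := by rw [φ.op_act, ψ.op_act]
  op_comp f g := by rw [φ.op_comp, ψ.op_comp]

/-! ## Trees -/

/-- A finite rooted tree.  The edges are those left after deleting the designated
output and input vertices; `In x y` says that `y` is the output edge of a vertex of which `x` is an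
input edge, and `Leaf` singles out the input edges of the tree.  Every edge that is not a leaf is
the output edge of exactly one vertex, so a vertex is the same thing as an edge that is not a
leaf; it may have no inputs at all. -/
structure Tree where
  Edge : Type
  [finite : Finite Edge]
  root : Edge
  In : Edge → Edge → Prop
  Leaf : Edge → Prop
  in_unique : ∀ {x y z}, In x y → In x z → y = z
  not_in_root : ∀ {y}, ¬ In root y
  not_in_leaf : ∀ {x y}, In x y → ¬ Leaf y
  reach : ∀ x, Relation.ReflTransGen In x root

namespace Tree

variable (T : Tree)

/-- The edge `y` lies on the path from the edge `x` to the root. -/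
def Above (x y : T.Edge) : Prop := Relation.ReflTransGen T.In x y

/-- An inner edge: neither the root nor a leaf. -/
def Inner (e : T.Edge) : Prop := e ≠ T.root ∧ ¬ T.Leaf e

/-- `T.IsOp S e` says that the edges in `S` are the leaves of a subtree of `T` with root `e`;
equivalently, that the vertices of `T` generate (using units, composition and permutations)
an operation with output `e` whose inputs are the elements of `S`, each occurring once. -/
inductive IsOp : Set T.Edge → T.Edge → Prop
  | unit (e : T.Edge) : IsOp {e} e
  | graft (d : T.Edge) (hd : ¬ T.Leaf d) (S : T.Edge → Set T.Edge)
      (h : ∀ x, T.In x d → IsOp (S x) x) : IsOp {y | ∃ x, T.In x d ∧ y ∈ S x} d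

variable {T}

lemma acyclic {x : T.Edge} : ¬ Relation.TransGen T.In x x := by
  induction T.reach x using Relation.ReflTransGen.head_induction_on with
  | refl =>
    intro h
    obtain ⟨y, hy, -⟩ := Relation.TransGen.head'_iff.1 h
    exact T.not_in_root hy
  | head hxy _ ih =>
    intro h
    obtain ⟨z, hz, hzx⟩ := Relation.TransGen.head'_iff.1 h
    obtain rfl := T.in_unique hxy hz
    exact ih (Relation.TransGen.tail' hzx hxy)

lemma Above.total {x y z : T.Edge} (h : T.Above x y) (h' : T.Above x z) :
    T.Above y z ∨ T.Above z y := by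
  induction h using Relation.ReflTransGen.head_induction_on with
  | refl => exact Or.inl h'
  | head hab hbc ih =>
    rcases Relation.ReflTransGen.cases_head h' with rfl | ⟨w, hw, hwz⟩
    · exact Or.inr (Relation.ReflTransGen.head hab hbc)
    · obtain rfl := T.in_unique hab hw
      exact ih hwz

lemma eq_of_in_of_above {x y d : T.Edge} (hx : T.In x d) (hy : T.In y d) (h : T.Above x y) :
    x = y := by
  rcases Relation.ReflTransGen.cases_head h with rfl | ⟨w, hw, hwy⟩
  · rfl
  · obtain rfl := T.in_unique hx hw
    exact (acyclic (Relation.TransGen.tail' hwy hy)).elim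

/-- Two inputs of the same vertex with a common edge above them agree. -/
lemma eq_of_in {x y d z : T.Edge} (hx : T.In x d) (hy : T.In y d) (h : T.Above z x)
    (h' : T.Above z y) : x = y := by
  rcases h.total h' with h | h
  · exact eq_of_in_of_above hx hy h
  · exact (eq_of_in_of_above hy hx h).symm

lemma IsOp.above {S : Set T.Edge} {e : T.Edge} (h : T.IsOp S e) : ∀ s ∈ S, T.Above s e := by
  induction h with
  | unit e => rintro s rfl; exact Relation.ReflTransGen.refl
  | graft d hd S h ih =>
    rintro s ⟨x, hx, hs⟩
    exact Relation.ReflTransGen.tail (ih x hx s hs) hx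

/-- Distinct inputs of an operation have no common edge above them. -/
lemma IsOp.disjoint {S : Set T.Edge} {e : T.Edge} (h : T.IsOp S e) :
    ∀ s ∈ S, ∀ t ∈ S, ∀ z, T.Above z s → T.Above z t → s = t := by
  induction h with
  | unit e => rintro s rfl t rfl _ _ _; rfl
  | graft d hd S h ih =>
    rintro s ⟨x, hx, hs⟩ t ⟨y, hy, ht⟩ z hzs hzt
    obtain rfl : x = y := eq_of_in hx hy
      (hzs.trans ((h x hx).above s hs)) (hzt.trans ((h y hy).above t ht))
    exact ih x hx s hs t ht z hzs hzt

lemma IsOp.comp {S : Set T.Edge} {e : T.Edge} (h : T.IsOp S e) (R : T.Edge → Set T.Edge)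
    (hR : ∀ s ∈ S, T.IsOp (R s) s) : T.IsOp {y | ∃ s ∈ S, y ∈ R s} e := by
  induction h with
  | unit e => simpa using hR e rfl
  | graft d hd S h ih =>
    have := IsOp.graft d hd _ fun x hx => ih x hx fun s hs => hR s ⟨x, hx, hs⟩
    convert this using 1
    ext y
    constructor
    · rintro ⟨s, ⟨x, hx, hs⟩, hy⟩
      exact ⟨x, hx, s, hs, hy⟩
    · rintro ⟨x, hx, s, hs, hy⟩
      exact ⟨s, ⟨x, hx, hs⟩, hy⟩

/-- Each vertex is an operation. -/
lemma IsOp.vertex {d : T.Edge} (hd : ¬ T.Leaf d) : T.IsOp {x | T.In x d} d := by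
  have := IsOp.graft (T := T) d hd (fun x => {x}) fun x _ => IsOp.unit x
  convert this using 1
  ext y
  constructor
  · intro hy
    exact ⟨y, hy, rfl⟩
  · rintro ⟨x, hx, rfl⟩
    exact hx

variable (T)

/-- The operad `Ω(T)` generated by a tree: its colours are the edges, and there is exactly one
operation with inputs `c` and output `e` if the `c i` are distinct and are the leaves of a
subtree with root `e`, and none otherwise. -/
abbrev operad : Operad.{0, 0} where
  Colour := T.Edge
  Op n c e := PLift (Function.Injective c ∧ T.IsOp (Set.range c) e)
  str :=
    { one := fun d => ⟨Function.injective_of_subsingleton _, by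
        simpa [Set.range_const] using IsOp.unit d⟩
      act := fun {m n} σ {c c' d} h f => ⟨by
        obtain rfl : c' = c ∘ σ := funext h
        exact ⟨f.down.1.comp σ.injective, by rw [σ.surjective.range_comp]; exact f.down.2⟩⟩
      comp := fun {n c d k b} f g => ⟨by
        constructor
        · intro x y hxy
          obtain ⟨⟨i, j⟩, rfl⟩ := finSigmaFinEquiv.surjective x
          obtain ⟨⟨i', j'⟩, rfl⟩ := finSigmaFinEquiv.surjective y
          rw [concat_apply, concat_apply] at hxy
          dsimp only at hxy
          obtain rfl : i = i' := f.down.1 (f.down.2.disjoint _ ⟨i, rfl⟩ _ ⟨i', rfl⟩ (b i j)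
            ((g i).down.2.above _ ⟨j, rfl⟩)
            (hxy ▸ (g i').down.2.above _ ⟨j', rfl⟩))
          rw [(g i).down.1 hxy]
        · have := f.down.2.comp (fun s => {y | ∃ i, c i = s ∧ y ∈ Set.range (b i)}) (by
            rintro _ ⟨i, rfl⟩
            convert (g i).down.2 using 1
            ext y
            constructor
            · rintro ⟨i', hi', hy⟩
              obtain rfl := f.down.1 hi'
              exact hy
            · intro hy
              exact ⟨i, rfl, hy⟩)
          convert this using 1
          ext y
          constructor
          · rintro ⟨x, rfl⟩
            exact ⟨_, ⟨(finSigmaFinEquiv.symm x).1, rfl⟩, _, rfl, _, rfl⟩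
          · rintro ⟨_, ⟨i, rfl⟩, i', hi', j, rfl⟩
            exact ⟨finSigmaFinEquiv ⟨i', j⟩, concat_apply _ _⟩⟩
      act_refl := fun _ => Subsingleton.elim _ _
      act_trans := fun _ _ _ _ _ _ _ _ _ => Subsingleton.elim _ _
      one_comp := fun _ => Subsingleton.elim _ _
      comp_one := fun _ => Subsingleton.elim _ _
      assoc := fun _ _ _ => Subsingleton.elim _ _
      act_comp := by intros; exact Subsingleton.elim _ _
      comp_act := fun _ _ _ _ => Subsingleton.elim _ _ }

end Tree

/-- The category `Ω` of trees: the arrows `S ⟶ T` are the operad maps `Ω(S) → Ω(T)`. -/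
instance : Category Tree where
  Hom S T := OperadHom S.operad T.operad
  id T := OperadHom.id T.operad
  comp φ ψ := OperadHom.comp φ ψ

/-- A dendroidal set is a presheaf of sets on the category of trees. -/
abbrev DendroidalSet := Treeᵒᵖ ⥤ Type u

/-- The restriction `φ^* : X_T → X_S` along an arrow `φ : S ⟶ T` of trees. -/
abbrev DendroidalSet.pull (X : DendroidalSet.{u}) {S T : Tree} (φ : S ⟶ T) :
    X.obj (op T) → X.obj (op S) :=
  fun x => X.map φ.op x

/-- The dendroidal nerve `N_d(P)`, with `N_d(P)_T = Hom(Ω(T), P)`. -/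
def nerve (P : Operad.{u, v}) : DendroidalSet.{max u v} where
  obj T := OperadHom T.unop.operad P
  map φ := TypeCat.ofHom fun x => OperadHom.comp φ.unop x

namespace Tree

/-- An arrow of trees may be given by a map on edges which sends each vertex to an operation. -/
def homOfVertices {S T : Tree} (f : S.Edge → T.Edge)
    (h : ∀ d, ¬ S.Leaf d →
      Set.InjOn f {x | S.In x d} ∧ T.IsOp (f '' {x | S.In x d}) (f d)) : S ⟶ T :=
  have key : ∀ {R : Set S.Edge} {e : S.Edge}, S.IsOp R e →
      Set.InjOn f R ∧ T.IsOp (f '' R) (f e) := by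
    intro R e hR
    induction hR with
    | unit e => exact ⟨Set.injOn_singleton _ _, by simpa using IsOp.unit (f e)⟩
    | graft d hd R hR ih =>
      obtain ⟨h1, h2⟩ := h d hd
      constructor
      · rintro y ⟨x, hx, hy⟩ y' ⟨x', hx', hy'⟩ hyy
        obtain rfl : x = x' := h1 hx hx' (h2.disjoint _ ⟨x, hx, rfl⟩ _ ⟨x', hx', rfl⟩ (f y)
          ((ih x hx).2.above _ ⟨y, hy, rfl⟩)
          (hyy ▸ (ih x' hx').2.above _ ⟨y', hy', rfl⟩))
        exact (ih x hx).1 hy hy' hyy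
      · have := h2.comp (fun s => {y | ∃ x, S.In x d ∧ f x = s ∧ y ∈ f '' R x}) (by
          rintro _ ⟨x, hx, rfl⟩
          convert (ih x hx).2 using 1
          ext y
          constructor
          · rintro ⟨x', hx', hxx, hy⟩
            obtain rfl := h1 hx' hx hxx
            exact hy
          · intro hy
            exact ⟨x, hx, rfl, hy⟩)
        convert this using 1
        ext y
        constructor
        · rintro ⟨y, ⟨x, hx, hy⟩, rfl⟩
          exact ⟨_, ⟨x, hx, rfl⟩, x, hx, rfl, y, hy, rfl⟩
        · rintro ⟨_, ⟨x, hx, rfl⟩, x', hx', -, y, hy, rfl⟩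
          exact ⟨y, ⟨x', hx', hy⟩, rfl⟩
  { col := f
    op := fun {n c d} g => ⟨by
      obtain ⟨h1, h2⟩ := key g.down.2
      refine ⟨fun i j hij => g.down.1 (h1 ⟨i, rfl⟩ ⟨j, rfl⟩ hij), ?_⟩
      rw [← Set.range_comp] at h2
      exact h2⟩
    op_one := fun _ => Subsingleton.elim (α := PLift _) _ _
    op_act := fun _ _ _ _ _ _ => Subsingleton.elim (α := PLift _) _ _
    op_comp := fun _ _ => Subsingleton.elim (α := PLift _) _ _ }

/-! ### Some trees -/

/-- The tree `η` with one edge and no vertex. -/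
abbrev eta : Tree where
  Edge := Unit
  root := ()
  In _ _ := False
  Leaf _ := True
  in_unique h := h.elim
  not_in_root h := h
  not_in_leaf h := h.elim
  reach _ := Relation.ReflTransGen.refl

/-- The arrow `η ⟶ T` sending the edge of `η` to `x`. -/
def edgeMap (T : Tree) (x : T.Edge) : eta ⟶ T :=
  homOfVertices (fun _ => x) fun _ hd => (hd trivial).elim

/-- The corolla `Cₙ`: one vertex, the output edge `none` and the input edges
`some 0, …, some (n - 1)`. -/
abbrev corolla (n : ℕ) : Tree where
  Edge := Option (Fin n)
  root := none
  In x y := x ≠ none ∧ y = none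
  Leaf x := x ≠ none
  in_unique h h' := h.2.trans h'.2.symm
  not_in_root h := h.1 rfl
  not_in_leaf h h' := h' h.2
  reach x := by
    by_cases hx : x = none
    · rw [hx]
    · exact Relation.ReflTransGen.single ⟨hx, rfl⟩

lemma corolla_in (n : ℕ) : {x | (corolla n).In x none} = Set.range some := by
  ext x
  cases x with
  | none => exact ⟨fun h => (h.1 rfl).elim, fun ⟨_, h⟩ => nomatch h⟩
  | some i => exact ⟨fun _ => ⟨i, rfl⟩, fun _ => ⟨Option.some_ne_none i, rfl⟩⟩

/-- The vertex of the corolla, as an operation in `Ω(Cₙ)`. -/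
def corollaOp (n : ℕ) : (corolla n).operad.Op n some none :=
  ⟨Option.some_injective _, by
    have := IsOp.vertex (T := corolla n) (d := none) (fun h => h rfl)
    rwa [corolla_in] at this⟩

/-- The arrow `Cₙ ⟶ T` sending the vertex of `Cₙ` to the operation of `Ω(T)` with inputs `c` and
output `e`. -/
def opMap (T : Tree) {n : ℕ} (c : Fin n → T.Edge) (e : T.Edge)
    (h : Function.Injective c ∧ T.IsOp (Set.range c) e) : corolla n ⟶ T :=
  homOfVertices (S := corolla n) (fun x => x.elim e c) fun d hd => by
    obtain rfl : d = none := not_not.1 hd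
    rw [corolla_in]
    constructor
    · rintro _ ⟨i, rfl⟩ _ ⟨j, rfl⟩ hij
      exact congrArg some (h.1 hij)
    · rw [← Set.range_comp]
      exact h.2

/-- The degeneracy `C₁ ⟶ η`. -/
def sigma : corolla 1 ⟶ eta :=
  opMap eta (fun _ => ()) () ⟨Function.injective_of_subsingleton _, by
    rw [Set.range_const]; exact IsOp.unit (T := eta) ()⟩

/-! ### Faces -/

/-- The tree `T/e` obtained by contracting the inner edge `e`. -/
def contract (T : Tree) (e : T.Edge) (he : T.Inner e) : Tree where
  Edge := {x : T.Edge // x ≠ e}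
  finite := @Subtype.finite _ T.finite _
  root := ⟨T.root, he.1.symm⟩
  In x y := T.In x y ∨ (T.In x e ∧ T.In e y)
  Leaf x := T.Leaf x
  in_unique := by
    rintro ⟨x, hx⟩ ⟨y, hy⟩ ⟨z, hz⟩ (h | ⟨h, h'⟩) (k | ⟨k, k'⟩)
    · exact Subtype.ext (T.in_unique h k)
    · exact (hy (T.in_unique h k)).elim
    · exact (hz (T.in_unique k h)).elim
    · exact Subtype.ext (T.in_unique h' k')
  not_in_root := by
    rintro y (h | ⟨h, -⟩) <;> exact T.not_in_root h
  not_in_leaf := by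
    rintro x y (h | ⟨-, h⟩) <;> exact T.not_in_leaf h
  reach := by
    suffices H : ∀ x : T.Edge,
        (∀ hx : x ≠ e, Relation.ReflTransGen
          (fun x y : {x : T.Edge // x ≠ e} => T.In x y ∨ (T.In x e ∧ T.In e y))
          ⟨x, hx⟩ ⟨T.root, he.1.symm⟩) ∧
        (x = e → ∃ (z : T.Edge) (hz : z ≠ e), T.In e z ∧ Relation.ReflTransGen
          (fun x y : {x : T.Edge // x ≠ e} => T.In x y ∨ (T.In x e ∧ T.In e y))
          ⟨z, hz⟩ ⟨T.root, he.1.symm⟩) from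
      fun x => (H x).1 x.2
    intro x
    induction T.reach x using Relation.ReflTransGen.head_induction_on with
    | refl => exact ⟨fun _ => Relation.ReflTransGen.refl, fun h => (he.1 h.symm).elim⟩
    | @head x y hxy _ ih =>
      constructor
      · intro hx
        by_cases hy : y = e
        · obtain ⟨z, hz, hez, hzr⟩ := ih.2 hy
          subst hy
          exact Relation.ReflTransGen.head (Or.inr ⟨hxy, hez⟩) hzr
        · exact Relation.ReflTransGen.head (Or.inl hxy) (ih.1 hy)
      · rintro rfl
        have hy : y ≠ x := by
          rintro rfl
          exact acyclic (Relation.TransGen.single hxy)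
        exact ⟨y, hy, hxy, ih.1 hy⟩

/-- The inner face `∂_e : T/e ⟶ T`. -/
def contractMap (T : Tree) (e : T.Edge) (he : T.Inner e) : T.contract e he ⟶ T :=
  homOfVertices (S := T.contract e he) (fun x => x.1) (by
    rintro ⟨d, hde⟩ hd
    refine ⟨Subtype.val_injective.injOn, ?_⟩
    change ¬ T.Leaf d at hd
    classical
    by_cases hed : T.In e d
    · have := (IsOp.vertex hd).comp (fun s => if s = e then {x | T.In x e} else {s}) (by
        intro s _
        by_cases hs : s = e
        · subst hs
          simpa using IsOp.vertex he.2
        · simpa [hs] using IsOp.unit s)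
      convert this using 1
      ext y
      constructor
      · rintro ⟨⟨x, hx⟩, h | ⟨h, -⟩, rfl⟩
        · exact ⟨x, h, by rw [if_neg hx]; rfl⟩
        · exact ⟨e, hed, by rw [if_pos rfl]; exact h⟩
      · rintro ⟨s, hs, hy⟩
        by_cases hse : s = e
        · rw [if_pos hse] at hy
          have hye : y ≠ e := by
            rintro rfl
            exact acyclic (Relation.TransGen.single hy)
          exact ⟨⟨y, hye⟩, Or.inr ⟨hy, hed⟩, rfl⟩
        · rw [if_neg hse] at hy
          obtain rfl : y = s := hy
          exact ⟨⟨y, hse⟩, Or.inl hs, rfl⟩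
    · convert IsOp.vertex hd using 1
      ext y
      constructor
      · rintro ⟨⟨x, hx⟩, h | ⟨-, h⟩, rfl⟩
        · exact h
        · exact (hed h).elim
      · intro hy
        have hye : y ≠ e := by
          rintro rfl
          exact hed hy
        exact ⟨⟨y, hye⟩, Or.inl hy, rfl⟩)

/-- The vertex with output edge `v` is a top vertex with exactly one inner edge attached
to it: `v` itself is inner, and all the input edges are leaves. -/
def TopVertex (T : Tree) (v : T.Edge) : Prop := T.Inner v ∧ ∀ x, T.In x v → T.Leaf x

/-- The tree `T/v` obtained by deleting a top vertex and its input edges. -/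
def prune (T : Tree) (v : T.Edge) (hv : T.TopVertex v) : Tree where
  Edge := {x : T.Edge // ¬ T.In x v}
  finite := @Subtype.finite _ T.finite _
  root := ⟨T.root, T.not_in_root⟩
  In x y := T.In x y
  Leaf x := T.Leaf x ∨ x = v
  in_unique h h' := Subtype.ext (T.in_unique h h')
  not_in_root h := T.not_in_root h
  not_in_leaf := by
    rintro ⟨x, hx⟩ ⟨y, hy⟩ h (h' | h')
    · exact T.not_in_leaf h h'
    · exact hx (h' ▸ h)
  reach := by
    suffices H : ∀ (x : T.Edge) (hx : ¬ T.In x v), Relation.ReflTransGen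
        (fun x y : {x : T.Edge // ¬ T.In x v} => T.In x y) ⟨x, hx⟩ ⟨T.root, T.not_in_root⟩ from
      fun x => H x.1 x.2
    intro x
    induction T.reach x using Relation.ReflTransGen.head_induction_on with
    | refl => exact fun _ => Relation.ReflTransGen.refl
    | @head x y hxy _ ih =>
      intro hx
      have hy : ¬ T.In y v := fun h => T.not_in_leaf hxy (hv.2 y h)
      exact Relation.ReflTransGen.head (b := ⟨y, hy⟩) hxy (ih hy)

/-- The outer face `∂_v : T/v ⟶ T` for a top vertex. -/
def pruneMap (T : Tree) (v : T.Edge) (hv : T.TopVertex v) : T.prune v hv ⟶ T :=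
  homOfVertices (S := T.prune v hv) (fun x => x.1) (by
    rintro ⟨d, hdv⟩ hd
    have hd' : ¬ T.Leaf d ∧ d ≠ v := not_or.1 hd
    refine ⟨Subtype.val_injective.injOn, ?_⟩
    convert IsOp.vertex hd'.1 using 1
    ext y
    constructor
    · rintro ⟨⟨x, hx⟩, h, rfl⟩
      exact h
    · intro hy
      exact ⟨⟨y, fun h => hd'.2 (T.in_unique hy h)⟩, hy, rfl⟩)

/-- The vertex at the root has exactly one inner edge attached to it, namely its
input edge `d`; all its other input edges are leaves. -/
def BottomEdge (T : Tree) (d : T.Edge) : Prop :=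
  T.In d T.root ∧ ¬ T.Leaf d ∧ ∀ x, T.In x T.root → x ≠ d → T.Leaf x

/-- The part of `T` above the edge `d`, with root `d`.  If `BottomEdge d` holds, this is the tree
`T/v` obtained by deleting the root vertex `v` and the outer edges attached to it. -/
def upper (T : Tree) (d : T.Edge) : Tree where
  Edge := {x : T.Edge // T.Above x d}
  finite := @Subtype.finite _ T.finite _
  root := ⟨d, Relation.ReflTransGen.refl⟩
  In x y := T.In x y
  Leaf x := T.Leaf x
  in_unique h h' := Subtype.ext (T.in_unique h h')
  not_in_root := fun {y} h => acyclic (Relation.TransGen.head' h y.2)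
  not_in_leaf h := T.not_in_leaf h
  reach := by
    rintro ⟨x, hx⟩
    induction hx using Relation.ReflTransGen.head_induction_on with
    | refl => exact Relation.ReflTransGen.refl
    | @head x y hxy hyd ih => exact Relation.ReflTransGen.head (b := ⟨y, hyd⟩) hxy ih

/-- The inclusion of the part of `T` above `d`. -/
def upperMap (T : Tree) (d : T.Edge) : T.upper d ⟶ T :=
  homOfVertices (S := T.upper d) (fun x => x.1) (by
    rintro ⟨c, hc⟩ hl
    refine ⟨Subtype.val_injective.injOn, ?_⟩
    convert IsOp.vertex (T := T) (d := c) hl using 1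
    ext y
    constructor
    · rintro ⟨⟨x, hx⟩, h, rfl⟩
      exact h
    · intro hy
      exact ⟨⟨y, Relation.ReflTransGen.head hy hc⟩, hy, rfl⟩)

/-- The faces of a tree: the inner faces, obtained by contracting an inner edge, and the outer
faces, obtained by deleting a (top or bottom) vertex with exactly one inner edge attached to it or,
if the tree has exactly one vertex, given by one of its edges. -/
inductive Face (T : Tree) : Type
  | inner (e : T.Edge) (he : T.Inner e)
  | top (v : T.Edge) (hv : T.TopVertex v)
  | bottom (d : T.Edge) (hd : T.BottomEdge d)
  | edge (hT : ∃! v : T.Edge, ¬ T.Leaf v) (x : T.Edge)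

/-- The domain of a face map. -/
def Face.dom {T : Tree} : T.Face → Tree
  | .inner e he => T.contract e he
  | .top v hv => T.prune v hv
  | .bottom d _ => T.upper d
  | .edge _ _ => eta

/-- The face map. -/
def Face.map {T : Tree} : (F : T.Face) → (F.dom ⟶ T)
  | .inner e he => T.contractMap e he
  | .top v hv => T.pruneMap v hv
  | .bottom d _ => T.upperMap d
  | .edge _ x => T.edgeMap x

/-! ### The trees used to define homotopies -/

/-- The tree obtained from the corolla `Cₙ` by grafting a unary vertex onto the input edge `i`.
Its edges are the root `some none`, the inputs `some (some k)` of the bottom vertex, and the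
additional leaf `none` (called `i'`), which is the input of the unary vertex with output
`some (some i)`. -/
abbrev extLeaf (n : ℕ) (i : Fin n) : Tree where
  Edge := Option (Option (Fin n))
  root := some none
  In x y := ((∃ k, x = some (some k)) ∧ y = some none) ∨ (x = none ∧ y = some (some i))
  Leaf x := x = none ∨ ∃ k, k ≠ i ∧ x = some (some k)
  in_unique := by
    rintro x y z (⟨⟨k, rfl⟩, rfl⟩ | ⟨rfl, rfl⟩) (⟨⟨l, h⟩, rfl⟩ | ⟨h, rfl⟩) <;> simp_all
  not_in_root := by
    rintro y (⟨⟨k, h⟩, -⟩ | ⟨h, -⟩) <;> simp at h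
  not_in_leaf := by
    rintro x y (⟨-, rfl⟩ | ⟨-, rfl⟩) <;> simp
  reach := by
    have h : ∀ k : Fin n, Relation.ReflTransGen (fun x y : Option (Option (Fin n)) =>
        ((∃ k, x = some (some k)) ∧ y = some none) ∨ (x = none ∧ y = some (some i)))
        (some (some k)) (some none) :=
      fun k => Relation.ReflTransGen.single (Or.inl ⟨⟨k, rfl⟩, rfl⟩)
    rintro (_ | _ | k)
    · exact Relation.ReflTransGen.head (Or.inr ⟨rfl, rfl⟩) (h i)
    · exact Relation.ReflTransGen.refl
    · exact h k

/-- The tree obtained from the corolla `Cₙ` by grafting it onto a unary vertex.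
Its edges are the new root `none` (called `0'`), the output edge `some none` of `Cₙ`, which is the
input of the unary vertex, and the leaves `some (some k)`. -/
abbrev extRoot (n : ℕ) : Tree where
  Edge := Option (Option (Fin n))
  root := none
  In x y := ((∃ k, x = some (some k)) ∧ y = some none) ∨ (x = some none ∧ y = none)
  Leaf x := ∃ k, x = some (some k)
  in_unique := by
    rintro x y z (⟨⟨k, rfl⟩, rfl⟩ | ⟨rfl, rfl⟩) (⟨⟨l, h⟩, rfl⟩ | ⟨h, rfl⟩) <;> simp_all
  not_in_root := by
    rintro y (⟨⟨k, h⟩, -⟩ | ⟨h, -⟩) <;> simp at h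
  not_in_leaf := by
    rintro x y (⟨-, rfl⟩ | ⟨-, rfl⟩) <;> simp
  reach := by
    have h : Relation.ReflTransGen (fun x y : Option (Option (Fin n)) =>
        ((∃ k, x = some (some k)) ∧ y = some none) ∨ (x = some none ∧ y = none))
        (some none) none :=
      Relation.ReflTransGen.single (Or.inr ⟨rfl, rfl⟩)
    rintro (_ | _ | k)
    · exact Relation.ReflTransGen.refl
    · exact h
    · exact Relation.ReflTransGen.head (Or.inl ⟨⟨k, rfl⟩, rfl⟩) h

lemma extLeaf_bottom (n : ℕ) (i : Fin n) :
    (extLeaf n i).IsOp (Set.range fun k => some (some k)) (some none) := by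
  convert IsOp.vertex (T := extLeaf n i) (d := some none) (by simp) using 1
  ext x
  simp [eq_comm]

lemma extLeaf_top (n : ℕ) (i : Fin n) :
    (extLeaf n i).IsOp (Set.range fun _ : Fin 1 => none) (some (some i)) := by
  convert IsOp.vertex (T := extLeaf n i) (d := some (some i)) (by simp) using 1
  ext x
  simp

/-- The names of the inputs after contracting the inner edge `i` of `extLeaf n i`: the `i`-th
input is `i'`, and the `k`-th input is `k` for `k ≠ i`. -/
def extLeafInputs (n : ℕ) (i k : Fin n) : Option (Option (Fin n)) :=
  if k = i then none else some (some k)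

lemma extLeafInputs_injective (n : ℕ) (i : Fin n) : Function.Injective (extLeafInputs n i) := by
  intro k l h
  unfold extLeafInputs at h
  split_ifs at h <;> simp_all

lemma extLeaf_inner (n : ℕ) (i : Fin n) :
    (extLeaf n i).IsOp (Set.range (extLeafInputs n i)) (some none) := by
  convert (extLeaf_bottom n i).comp
    (fun s => if s = some (some i) then Set.range fun _ : Fin 1 => none else {s}) (by
      rintro _ ⟨k, rfl⟩
      by_cases hk : k = i
      · subst hk
        simpa using extLeaf_top n k
      · simpa [hk] using IsOp.unit (T := extLeaf n i) (some (some k))) using 1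
  ext x
  constructor
  · rintro ⟨k, rfl⟩
    refine ⟨some (some k), ⟨k, rfl⟩, ?_⟩
    by_cases hk : k = i <;> simp [extLeafInputs, hk]
  · rintro ⟨_, ⟨k, rfl⟩, h⟩
    refine ⟨k, ?_⟩
    by_cases hk : k = i <;> simp_all [extLeafInputs]

lemma extRoot_top (n : ℕ) :
    (extRoot n).IsOp (Set.range fun k => some (some k)) (some none) := by
  convert IsOp.vertex (T := extRoot n) (d := some none) (by simp) using 1
  ext x
  simp [eq_comm]

lemma extRoot_bottom (n : ℕ) :
    (extRoot n).IsOp (Set.range fun _ : Fin 1 => some none) none := by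
  convert IsOp.vertex (T := extRoot n) (d := none) (by simp) using 1
  ext x
  simp

lemma extRoot_inner (n : ℕ) :
    (extRoot n).IsOp (Set.range fun k => some (some k)) none := by
  convert (extRoot_bottom n).comp (fun _ => Set.range fun k => some (some k)) (by
    rintro _ ⟨k, rfl⟩
    exact extRoot_top n) using 1
  ext x
  simp

lemma someSome_injective (n : ℕ) :
    Function.Injective fun k : Fin n => (some (some k) : Option (Option (Fin n))) :=
  fun _ _ h => Option.some_injective _ (Option.some_injective _ h)

end Tree

/-! ## Inner Kan complexes -/

/-- The representable dendroidal set `Ω[T]`. -/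
abbrev rep (T : Tree) : DendroidalSet.{u} := uliftYoneda.{u}.obj T

/-- The inner horn `Λ^e[T] ⊆ Ω[T]`: the union of (the images of) all the faces of `T` except
`∂_e`. -/
def horn (T : Tree) (e : T.Edge) (he : T.Inner e) : Subfunctor (rep.{u} T) where
  obj S := {φ | ∃ F : T.Face, F ≠ Tree.Face.inner e he ∧
    ∃ ψ : S.unop ⟶ F.dom, ψ ≫ F.map = ULift.down φ}
  map := by
    rintro S S' α φ ⟨F, hF, ψ, hψ⟩
    refine ⟨F, hF, α.unop ≫ ψ, ?_⟩
    rw [Category.assoc, hψ]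
    rfl

/-- Restriction of a map `Ω[T] ⟶ X` to the inner horn `Λ^e[T]`. -/
def restrictHorn (X : DendroidalSet.{u}) (T : Tree) (e : T.Edge) (he : T.Inner e) :
    (rep T ⟶ X) → ((horn.{u} T e he).toFunctor ⟶ X) :=
  fun x => (horn T e he).ι ≫ x

/-- Inner Kan complexes. -/
def IsInnerKan (X : DendroidalSet.{u}) : Prop :=
  ∀ (T : Tree) (e : T.Edge) (he : T.Inner e), Function.Surjective (restrictHorn X T e he)

/-- Strict inner Kan complexes. -/
def IsStrictInnerKan (X : DendroidalSet.{u}) : Prop :=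
  ∀ (T : Tree) (e : T.Edge) (he : T.Inner e), Function.Bijective (restrictHorn X T e he)

/-! ## Homotopy of dendrices, and the collection `Ho(X)` -/

section Ho

open Dendroidal.Tree

variable (X : DendroidalSet.{u})

/-- The vertices `X_η`. -/
abbrev Vert : Type u := X.obj (op eta)

/-- The dendrices of shape the corolla `Cₙ`. -/
abbrev Cor (n : ℕ) : Type u := X.obj (op (corolla n))

variable {X}

/-- The `i`-th input colour `i^* f` of a dendrex of shape `Cₙ`. -/
def Cor.input {n : ℕ} (f : Cor X n) (i : Fin n) : Vert X :=
  X.pull ((corolla n).edgeMap (some i)) f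

/-- The output colour `0^* f` of a dendrex of shape `Cₙ`. -/
def Cor.output {n : ℕ} (f : Cor X n) : Vert X :=
  X.pull ((corolla n).edgeMap none) f

/-- The degenerate dendrex `id_x = σ^* x` of shape `C₁`. -/
def idCor (x : Vert X) : Cor X 1 := X.pull sigma x

/-- `f` is homotopic to `g` along the input edge `i`. -/
def HomotopicLeaf {n : ℕ} (i : Fin n) (f g : Cor X n) : Prop :=
  ∃ H : X.obj (op (extLeaf n i)),
    X.pull (opMap (extLeaf n i) (fun k => some (some k)) (some none)
      ⟨someSome_injective n, extLeaf_bottom n i⟩) H = f ∧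
    X.pull (opMap (extLeaf n i) (extLeafInputs n i) (some none)
      ⟨extLeafInputs_injective n i, extLeaf_inner n i⟩) H = g ∧
    X.pull (opMap (extLeaf n i) (fun _ : Fin 1 => none) (some (some i))
      ⟨Function.injective_of_subsingleton _, extLeaf_top n i⟩) H = idCor (f.input i)

/-- `f` is homotopic to `g` along the output edge. -/
def HomotopicRoot {n : ℕ} (f g : Cor X n) : Prop :=
  ∃ H : X.obj (op (extRoot n)),
    X.pull (opMap (extRoot n) (fun k => some (some k)) (some none)
      ⟨someSome_injective n, extRoot_top n⟩) H = f ∧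
    X.pull (opMap (extRoot n) (fun k => some (some k)) none
      ⟨someSome_injective n, extRoot_inner n⟩) H = g ∧
    X.pull (opMap (extRoot n) (fun _ : Fin 1 => some none) none
      ⟨Function.injective_of_subsingleton _, extRoot_bottom n⟩) H = idCor f.output

/-- `f` is homotopic to `g` (along some edge). -/
def Homotopic {n : ℕ} (f g : Cor X n) : Prop :=
  HomotopicRoot f g ∨ ∃ i, HomotopicLeaf i f g

variable (X)

/-- The set `X(c₁, …, cₙ; d)` of dendrices of shape `Cₙ` with inputs `c` and output `d`. -/
def CorOver (n : ℕ) (c : Fin n → Vert X) (d : Vert X) : Type u :=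
  {f : Cor X n // (∀ i, f.input i = c i) ∧ f.output = d}

/-- The coloured collection `Ho(X)`: the quotient of `X(c₁, …, cₙ; d)` by homotopy.
(If `X` is an inner Kan complex, then homotopy along any one edge is an equivalence relation, and
it is the same for all edges; `Quot` divides by the equivalence relation generated.) -/
def HoOp (n : ℕ) (c : Fin n → Vert X) (d : Vert X) : Type u :=
  Quot fun f g : CorOver X n c d => Homotopic f.1 g.1

variable {X}

/-- The class of a dendrex of shape `Cₙ` in `Ho(X)`. -/
def hoClass {n : ℕ} (f : Cor X n) : HoOp X n f.input f.output :=
  Quot.mk _ ⟨f, fun _ => rfl, rfl⟩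

variable (X)

/-- The collection `Ho(X)` with a given operad structure. -/
abbrev HoOperad (S : OperadStr (Vert X) (HoOp X)) : Operad.{u, u} where
  Colour := Vert X
  Op := HoOp X
  str := S

variable {X}

/-- The colour of a vertex of `N_d(P)`. -/
def nerveColour {P : Operad.{u, v}} (x : Vert (nerve P)) : P.Colour :=
  OperadHom.col (P := eta.operad) x ()

/-- The operation of `P`, with its inputs and output, underlying a dendrex of shape `Cₙ` of
`N_d(P)`: the image of the vertex of `Cₙ`. -/
def nerveOp {P : Operad.{u, v}} {n : ℕ} (x : Cor (nerve P) n) :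
    Σ (c : Fin n → P.Colour) (d : P.Colour), P.Op n c d :=
  ⟨_, _, OperadHom.op (P := (corolla n).operad) x (corollaOp n)⟩

/-- The map `q : X ⟶ N_d(Ho(X))` extends the quotient map of collections
`Sk₁(X) → Ho(X)`, i.e. it is the identity on vertices, and sends each dendrex `f` of shape `Cₙ`
to its class `[f]` in `Ho(X)(c₁, …, cₙ; d)`, where the `cᵢ` and `d` are the inputs and the output
of `f`. -/
def ExtendsQuotient {S : OperadStr (Vert X) (HoOp X)} (q : X ⟶ nerve (HoOperad X S)) : Prop :=
  (∀ x : Vert X, nerveColour (q.app (op eta) x) = x) ∧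
  ∀ (n : ℕ) (f : Cor X n),
    nerveOp (q.app (op (corolla n)) f) = ⟨f.input, f.output, hoClass f⟩

end Ho

end Dendroidal

/-! The engine is a filling principle for general unions of faces, of which inner horns are only the
basic case. A subobject of `Ω[T]` is treated as a sieve `B` on `T`. An arrow `χ` into `T` is
recorded by the edges in its image and by the set `verts χ` of vertices of the subtree it spans; by
`factors` these data decide whether `χ` factors through an injective arrow. Suppose that the faces
outside `B` are matched in pairs, the smaller member arising from the larger one by contracting an
inner edge that depends only on the set of vertices (`Pairing`). Then in an inner Kan complex every
compatible family on `B` extends to `T` (`extendable_of_pairing`): missing faces of `T` are adjoined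
one at a time, each along a sieve on a smaller tree which is again paired, until exactly an inner
horn remains.

Two fillings are used. By `exists_graft`, dendrices on trees whose roots match the inputs of a given
corolla extend to the grafted tree, so composable operations have composites. By `exists_stem`, two
composites with equal top vertices and homotopic bottom vertices are faces of one dendrex, hence are
homotopic (`homotopicRoot_of_bot`). From the second filling it follows that homotopy along a leaf
implies homotopy along the root and that root homotopy is an equivalence relation; both fillings
together make it compatible with composition (`homotopicRoot_leafMap`).

A dendrex `x` of shape `T` sends each operation of `Ω(T)` to a class `cls x o`, and the units,
symmetries and composites of these classes in `Ho(X)` are those computed in `Ω(T)` (`one_eq_cls`,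
`hoAct_cls`, `hoComp_cls`). Any operations occurring in an operad axiom can be realised by a single
dendrex, so the axiom is inherited from `Ω(T)`, where it is trivial because there is at most one
operation with given inputs and output. The same formulas make `o ↦ cls x o` an operad map, which is
`q`. Conversely, naturality forces any `q` extending the quotient map to be given by these classes.
As its values are operad maps, the operad structure is then forced on all classes `cls x o`, and
this covers everything.

In the strict case homotopic dendrices are equal, and a dendrex is determined by its edges and
operations; this gives injectivity of `q`. Surjectivity is by induction on the number of vertices:
the restrictions of an operad map to the faces in an inner horn come from unique dendrices, these
glue, and the filler induces the given map because every edge and every vertex of `T` lies in the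
horn. -/

namespace Dendroidal

namespace Tree

variable {S T U D : Tree}

/-! ## Edges and vertices in the image of an arrow of trees -/

/-- The map on edges underlying an arrow of trees. -/
def emap (χ : S ⟶ T) : S.Edge → T.Edge := OperadHom.col (P := S.operad) (Q := T.operad) χ

@[simp] lemma emap_comp (χ : S ⟶ T) (ψ : T ⟶ U) (x : S.Edge) :
    emap (χ ≫ ψ) x = emap ψ (emap χ x) := rfl

@[simp] lemma emap_id (x : T.Edge) : emap (𝟙 T) x = x := rfl

@[simp] lemma emap_opMap_some {n : ℕ} (c : Fin n → T.Edge) (e : T.Edge) (h) (i : Fin n) :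
    emap (opMap T c e h) (some i) = c i := rfl

-- `Ω(T)` has at most one operation with given inputs and output, so an operad map into it carries
-- no information beyond its effect on colours.
@[ext]
lemma hom_ext {χ ψ : S ⟶ T} (h : ∀ x, emap χ x = emap ψ x) : χ = ψ := by
  have key : ∀ φ φ' : OperadHom S.operad T.operad, φ.col = φ'.col → φ = φ' := by
    rintro ⟨c, o, _, _, _⟩ ⟨c', o', _, _, _⟩ h
    obtain rfl : c = c' := h
    congr
    funext n c d f
    exact Subsingleton.elim (α := PLift _) _ _
  exact key χ ψ (funext h)

lemma exists_enum (R : Set T.Edge) :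
    ∃ (n : ℕ) (c : Fin n → T.Edge), Function.Injective c ∧ Set.range c = R := by
  have := T.finite
  obtain ⟨n, ⟨e⟩⟩ := Finite.exists_equiv_fin R
  refine ⟨n, fun i => (e.symm i).1, Subtype.val_injective.comp e.symm.injective, ?_⟩
  ext x
  constructor
  · rintro ⟨i, rfl⟩
    exact (e.symm i).2
  · intro hx
    exact ⟨e ⟨x, hx⟩, by simp⟩

lemma hom_op (χ : S ⟶ T) {n : ℕ} {c : Fin n → S.Edge} {e : S.Edge}
    (h : Function.Injective c ∧ S.IsOp (Set.range c) e) :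
    Function.Injective (fun i => emap χ (c i)) ∧
      T.IsOp (Set.range fun i => emap χ (c i)) (emap χ e) :=
  (OperadHom.op (P := S.operad) (Q := T.operad) χ (n := n) (c := c) (d := e) ⟨h⟩).down

lemma hom_isOp (χ : S ⟶ T) {R : Set S.Edge} {e : S.Edge} (h : S.IsOp R e) :
    Set.InjOn (emap χ) R ∧ T.IsOp (emap χ '' R) (emap χ e) := by
  obtain ⟨n, c, hc, rfl⟩ := exists_enum R
  obtain ⟨h1, h2⟩ := hom_op χ ⟨hc, h⟩
  rw [← Set.range_comp]
  refine ⟨?_, h2⟩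
  rintro _ ⟨i, rfl⟩ _ ⟨j, rfl⟩ hij
  rw [h1 hij]

lemma hom_vertex (χ : S ⟶ T) {d : S.Edge} (hd : ¬ S.Leaf d) :
    Set.InjOn (emap χ) {x | S.In x d} ∧ T.IsOp (emap χ '' {x | S.In x d}) (emap χ d) :=
  hom_isOp χ (IsOp.vertex hd)

lemma Above.refl (x : T.Edge) : T.Above x x := Relation.ReflTransGen.refl

lemma Above.trans' {x y z : T.Edge} (h : T.Above x y) (h' : T.Above y z) : T.Above x z :=
  Relation.ReflTransGen.trans h h'

lemma Above.of_in {x y : T.Edge} (h : T.In x y) : T.Above x y := Relation.ReflTransGen.single h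

lemma Above.antisymm {x y : T.Edge} (h : T.Above x y) (h' : T.Above y x) : x = y := by
  rcases Relation.ReflTransGen.cases_head h with rfl | ⟨w, hw, hwy⟩
  · rfl
  · exact (acyclic (Relation.TransGen.head' hw (hwy.trans h'))).elim

lemma Above.exists_in {x y : T.Edge} (h : T.Above x y) (hne : x ≠ y) :
    ∃ z, T.In z y ∧ T.Above x z := by
  rcases Relation.ReflTransGen.cases_tail h with h | ⟨w, hw, hwy⟩
  · exact (hne h.symm).elim
  · exact ⟨w, hwy, hw⟩

lemma Above.exists_out {x y : T.Edge} (h : T.Above x y) (hne : x ≠ y) :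
    ∃ z, T.In x z ∧ T.Above z y := by
  rcases Relation.ReflTransGen.cases_head h with h | ⟨w, hw, hwy⟩
  · exact (hne h).elim
  · exact ⟨w, hw, hwy⟩

lemma not_leaf_of_in {x y : T.Edge} (h : T.In x y) : ¬ T.Leaf y := T.not_in_leaf h

lemma Above.eq_of_leaf {x y : T.Edge} (h : T.Above x y) (hy : T.Leaf y) : x = y := by
  by_contra hne
  obtain ⟨z, hz, -⟩ := h.exists_in hne
  exact not_leaf_of_in hz hy

lemma above_root (x : T.Edge) : T.Above x T.root := T.reach x

lemma eq_root_of_above {x : T.Edge} (h : T.Above T.root x) : x = T.root :=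
  (above_root x).antisymm h

lemma not_above_of_in {x y : T.Edge} (h : T.In x y) : ¬ T.Above y x := fun h' =>
  acyclic (Relation.TransGen.head' h h')

lemma in_ne {x y : T.Edge} (h : T.In x y) : x ≠ y := by
  rintro rfl
  exact not_above_of_in h (Above.refl _)

/-- Finiteness and acyclicity make `In` well-founded: one may induct from the inputs of a vertex to
its output. -/
lemma up_induction {P : T.Edge → Prop} (h : ∀ d, (∀ x, T.In x d → P x) → P d) (d : T.Edge) :
    P d := by
  have := T.finite
  have wf : WellFounded (Relation.TransGen T.In) :=
    @Finite.wellFounded_of_trans_of_irrefl _ _ _ ⟨fun _ _ _ => Relation.TransGen.trans⟩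
      ⟨fun _ => acyclic⟩
  induction d using wf.induction with
  | _ d ih => exact h d fun x hx => ih x (Relation.TransGen.single hx)

lemma leaves_isOp_above (e : T.Edge) : T.IsOp {l | T.Leaf l ∧ T.Above l e} e := by
  induction e using up_induction with
  | _ d ih =>
    by_cases hd : T.Leaf d
    · convert IsOp.unit d using 1
      ext l
      constructor
      · rintro ⟨-, h⟩
        exact h.eq_of_leaf hd
      · rintro rfl
        exact ⟨hd, Above.refl _⟩
    · convert IsOp.graft d hd _ ih using 1
      ext l
      constructor
      · rintro ⟨hl, h⟩
        obtain ⟨z, hz, hlz⟩ := h.exists_in (by rintro rfl; exact hd hl)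
        exact ⟨z, hz, hl, hlz⟩
      · rintro ⟨z, hz, hl, hlz⟩
        exact ⟨hl, hlz.trans' (Above.of_in hz)⟩

lemma leaves_isOp : T.IsOp {l | T.Leaf l} T.root := by
  convert leaves_isOp_above T.root using 1
  ext l
  exact ⟨fun h => ⟨h, above_root l⟩, fun h => h.1⟩

lemma IsOp.exists_of_leaf {R : Set T.Edge} {e l : T.Edge} (h : T.IsOp R e) (hl : T.Leaf l)
    (hle : T.Above l e) : ∃ s ∈ R, T.Above l s := by
  induction h with
  | unit e => exact ⟨e, rfl, hle⟩
  | graft d hd R h ih =>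
    obtain ⟨z, hz, hlz⟩ := hle.exists_in (by rintro rfl; exact hd hl)
    obtain ⟨s, hs, hls⟩ := ih z hz hlz
    exact ⟨s, ⟨z, hz, hs⟩, hls⟩

lemma IsOp.eq_singleton {R : Set T.Edge} {e : T.Edge} (h : T.IsOp R e) (he : e ∈ R) :
    R = {e} := by
  ext s
  constructor
  · intro hs
    exact h.disjoint s hs e he s (Above.refl _) (h.above s hs)
  · rintro rfl
    exact he

lemma IsOp.mem_of_leaf {R : Set T.Edge} {e : T.Edge} (h : T.IsOp R e) (he : T.Leaf e) :
    e ∈ R := by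
  cases h with
  | unit => rfl
  | graft _ hd => exact (hd he).elim

lemma above_map (χ : S ⟶ T) {x y : S.Edge} (h : S.Above x y) :
    T.Above (emap χ x) (emap χ y) := by
  induction h with
  | refl => exact Above.refl _
  | tail _ hbc ih =>
    exact Above.trans' ih ((hom_vertex χ (not_leaf_of_in hbc)).2.above _ ⟨_, hbc, rfl⟩)

/-- Follow the path from `s` down to the root. When it first meets an edge with `t` above it, `t`
enters there either through the same input as `s` or through another one, which is a fork. -/
lemma comparable_or_fork (s t : T.Edge) : T.Above s t ∨ T.Above t s ∨
    ∃ d x y, x ≠ y ∧ T.In x d ∧ T.In y d ∧ T.Above s x ∧ T.Above t y := by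
  induction T.reach s using Relation.ReflTransGen.head_induction_on with
  | refl => exact Or.inr (Or.inl (above_root t))
  | @head s s' hss _ ih =>
    rcases ih with h | h | ⟨d, x, y, hxy, hx, hy, hsx, hty⟩
    · exact Or.inl ((Above.of_in hss).trans' h)
    · by_cases hts : t = s'
      · exact Or.inl (hts ▸ Above.of_in hss)
      · obtain ⟨x, hx, htx⟩ := h.exists_in hts
        by_cases hxs : x = s
        · exact Or.inr (Or.inl (hxs ▸ htx))
        · exact Or.inr (Or.inr ⟨s', s, x, Ne.symm hxs, hss, hx, Above.refl _, htx⟩)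
    · exact Or.inr (Or.inr ⟨d, x, y, hxy, hx, hy, (Above.of_in hss).trans' hsx, hty⟩)

/-- A fork in `S` remains a fork in `T`: two inputs of a vertex are sent to distinct inputs of one
operation, and no edge lies above both. Hence arrows reflect comparability. -/
lemma comparable_of_common {χ : S ⟶ T} {s t : S.Edge} {z : T.Edge}
    (h : T.Above z (emap χ s)) (h' : T.Above z (emap χ t)) : S.Above s t ∨ S.Above t s := by
  rcases comparable_or_fork s t with h1 | h1 | ⟨d, x, y, hxy, hx, hy, hsx, hty⟩
  · exact Or.inl h1
  · exact Or.inr h1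
  · obtain ⟨hi, ho⟩ := hom_vertex χ (not_leaf_of_in hx)
    exact (hxy (hi hx hy (ho.disjoint _ ⟨x, hx, rfl⟩ _ ⟨y, hy, rfl⟩ z
      (h.trans' (above_map χ hsx)) (h'.trans' (above_map χ hty))))).elim

lemma comparable_of_map {χ : S ⟶ T} {s t : S.Edge} (h : T.Above (emap χ s) (emap χ t)) :
    S.Above s t ∨ S.Above t s :=
  comparable_of_common (Above.refl _) h

lemma above_of_map {χ : S ⟶ T} (hχ : Function.Injective (emap χ)) {s t : S.Edge}
    (h : T.Above (emap χ s) (emap χ t)) : S.Above s t := by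
  rcases comparable_of_map h with h1 | h1
  · exact h1
  · rw [hχ (h.antisymm (above_map χ h1))]
    exact Above.refl _

/-- The vertices (named by their output edges) of the subtree with root `e` and leaves `R`. -/
def used (T : Tree) (R : Set T.Edge) (e : T.Edge) : Set T.Edge :=
  {w | ¬ T.Leaf w ∧ T.Above w e ∧ ∀ s ∈ R, ¬ T.Above w s}

/-- The vertices of the subtree spanned by the image of an arrow of trees. -/
def verts (χ : S ⟶ T) : Set T.Edge := T.used (emap χ '' {l | S.Leaf l}) (emap χ S.root)

lemma mem_verts {χ : S ⟶ T} {w : T.Edge} : w ∈ verts χ ↔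
    ¬ T.Leaf w ∧ T.Above w (emap χ S.root) ∧ ∀ l, S.Leaf l → ¬ T.Above w (emap χ l) := by
  simp [verts, used]

lemma verts_id : verts (𝟙 T) = {w | ¬ T.Leaf w} := by
  ext w
  rw [mem_verts]
  constructor
  · exact fun h => h.1
  · intro h
    refine ⟨h, above_root w, fun l hl hw => h ?_⟩
    rw [hw.eq_of_leaf hl]
    exact hl

/-- The subtree spanned by a composite arises by substituting, for each vertex `u` of the subtree
spanned by `χ`, the subtree of `T` that `φ` assigns to `u`. -/
lemma mem_verts_comp {χ : S ⟶ D} {φ : D ⟶ T} {w : T.Edge} : w ∈ verts (χ ≫ φ) ↔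
    ∃ u ∈ verts χ, w ∈ T.used (emap φ '' {x | D.In x u}) (emap φ u) := by
  constructor
  · intro hw
    obtain ⟨h1, h2, h3⟩ := mem_verts.1 hw
    -- Climb in `D` from the root of the subtree as long as `w` stays above the image of some input;
    -- the edge where this stops is the vertex `u`.
    have key : ∀ u : D.Edge, D.Above u (emap χ S.root) → T.Above w (emap φ u) →
        ∃ u' ∈ verts χ, w ∈ T.used (emap φ '' {x | D.In x u'}) (emap φ u') := by
      intro u
      induction u using up_induction with
      | _ u ih =>
        intro hu hwu
        by_cases hx : ∃ x, D.In x u ∧ T.Above w (emap φ x)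
        · obtain ⟨x, hx, hwx⟩ := hx
          exact ih x hx ((Above.of_in hx).trans' hu) hwx
        · push Not at hx
          have hul : ¬ D.Leaf u := by
            intro hul
            obtain ⟨_, ⟨l, hl, rfl⟩, hs⟩ := (hom_isOp χ leaves_isOp).2.exists_of_leaf hul hu
            exact h3 l hl (hwu.trans' (above_map φ hs))
          refine ⟨u, mem_verts.2 ⟨hul, hu, fun l hl hul => ?_⟩, h1, hwu, ?_⟩
          · exact h3 l hl (hwu.trans' (above_map φ hul))
          · rintro _ ⟨x, hx', rfl⟩
            exact hx x hx'
    exact key _ (Above.refl _) h2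
  · rintro ⟨u, hu, h1, h2, h3⟩
    obtain ⟨k1, k2, k3⟩ := mem_verts.1 hu
    refine mem_verts.2 ⟨h1, h2.trans' (above_map φ k2), fun l hl hw => ?_⟩
    rw [emap_comp] at hw
    rcases comparable_of_common h2 hw with h | h
    · exact k3 l hl h
    · obtain ⟨x, hx, hlx⟩ := h.exists_in (by
        intro h'
        exact k3 l hl (h' ▸ Above.refl _))
      exact h3 _ ⟨x, hx, rfl⟩ (hw.trans' (above_map φ hlx))

lemma verts_comp_subset (χ : S ⟶ D) (φ : D ⟶ T) : verts (χ ≫ φ) ⊆ verts φ := by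
  intro w hw
  obtain ⟨u, hu, hw⟩ := mem_verts_comp.1 hw
  rw [← Category.id_comp φ]
  exact mem_verts_comp.2 ⟨u, by rw [verts_id]; exact (mem_verts.1 hu).1, hw⟩

lemma verts_comp_congr {S' : Tree} {χ : S ⟶ D} {χ' : S' ⟶ D} (h : verts χ' = verts χ)
    (φ : D ⟶ T) : verts (χ' ≫ φ) = verts (χ ≫ φ) := by
  ext w
  rw [mem_verts_comp, mem_verts_comp, h]

lemma mem_verts_of_comp {χ : S ⟶ D} {φ : D ⟶ T} (hφ : Function.Injective (emap φ)) {m : D.Edge}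
    (h : emap φ m ∈ verts (χ ≫ φ)) : m ∈ verts χ := by
  obtain ⟨u, hu, -, h2, h3⟩ := mem_verts_comp.1 h
  have h4 := above_of_map hφ h2
  by_cases hmu : m = u
  · rwa [hmu]
  · obtain ⟨x, hx, hmx⟩ := h4.exists_in hmu
    exact (h3 _ ⟨x, hx, rfl⟩ (above_map φ hmx)).elim

/-- The hypothesis `hR` says that `q` is not strictly above a leaf of the subtree, i.e. that `q` is
one of its edges; the subtree can then be cut at `q`. -/
lemma IsOp.restrict {R : Set T.Edge} {e q : T.Edge} (h : T.IsOp R e) (hq : T.Above q e)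
    (hR : ∀ s ∈ R, T.Above q s → s = q) : T.IsOp {s | s ∈ R ∧ T.Above s q} q := by
  induction h with
  | unit e =>
    obtain rfl := hR e rfl hq
    convert IsOp.unit e using 1
    ext s
    constructor
    · exact fun h => h.1
    · rintro rfl
      exact ⟨rfl, Above.refl _⟩
  | graft d hd R h ih =>
    by_cases hqd : q = d
    · subst hqd
      convert IsOp.graft q hd R h using 1
      ext s
      constructor
      · exact fun h => h.1
      · rintro ⟨x, hx, hs⟩
        exact ⟨⟨x, hx, hs⟩, ((h x hx).above s hs).trans' (Above.of_in hx)⟩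
    · obtain ⟨x, hx, hqx⟩ := hq.exists_in hqd
      convert ih x hx hqx (fun s hs => hR s ⟨x, hx, hs⟩) using 1
      ext s
      constructor
      · rintro ⟨⟨y, hy, hs⟩, hsq⟩
        obtain rfl := eq_of_in hx hy (hsq.trans' hqx) ((h y hy).above s hs)
        exact ⟨hs, hsq⟩
      · rintro ⟨hs, hsq⟩
        exact ⟨⟨x, hx, hs⟩, hsq⟩

/-- A subtree of `T` whose leaves are edges of `D` and whose vertices are vertices of the subtree
spanned by `φ` comes from a subtree of `D`. Working upwards from `e`, either the subtree is trivial
or `e` is a vertex of `D` and the subtree splits at the images of its inputs. -/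
lemma isOp_preimage {φ : D ⟶ T} (hφ : Function.Injective (emap φ)) (e : D.Edge) :
    ∀ {R : Set T.Edge}, T.IsOp R (emap φ e) → R ⊆ Set.range (emap φ) →
      T.used R (emap φ e) ⊆ verts φ → D.IsOp (emap φ ⁻¹' R) e := by
  induction e using up_induction with
  | _ e ih =>
    intro R hR hRφ hV
    by_cases he : emap φ e ∈ R
    · rw [hR.eq_singleton he]
      convert IsOp.unit e using 1
      ext x
      exact hφ.eq_iff
    · have hev : emap φ e ∈ verts φ := hV ⟨fun h => he (hR.mem_of_leaf h), Above.refl _,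
        fun s hs hs' => he ((hR.above s hs).antisymm hs' ▸ hs)⟩
      have hel : ¬ D.Leaf e := fun h => (mem_verts.1 hev).2.2 e h (Above.refl _)
      -- Otherwise the element of `R` below `emap φ x` would be the image of an edge below `e`, and
      -- would have to equal `emap φ e`, which is not in `R`.
      have hcut : ∀ x, D.In x e → ∀ s ∈ R, T.Above (emap φ x) s → s = emap φ x := by
        intro x hx s hs hxs
        obtain ⟨s, rfl⟩ := hRφ hs
        by_cases hsx : s = x
        · rw [hsx]
        · obtain ⟨z, hz, hzs⟩ := (above_of_map hφ hxs).exists_out (Ne.symm hsx)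
          obtain rfl := D.in_unique hx hz
          have := (hR.above _ hs).antisymm (above_map φ hzs)
          exact (he (this ▸ hs)).elim
      have := IsOp.graft e hel (fun x => emap φ ⁻¹' {s | s ∈ R ∧ T.Above s (emap φ x)})
        (fun x hx => ih x hx (hR.restrict (above_map φ (Above.of_in hx)) (hcut x hx))
          (fun s hs => hRφ hs.1) (by
            rintro w ⟨h1, h2, h3⟩
            refine hV ⟨h1, h2.trans' (above_map φ (Above.of_in hx)), fun s hs hws => ?_⟩
            rcases h2.total hws with h | h
            · exact h3 s ⟨hs, by rw [hcut x hx s hs h]; exact Above.refl _⟩ hws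
            · exact h3 s ⟨hs, h⟩ hws))
      convert this using 1
      ext s
      constructor
      · intro hs
        have h1 := above_of_map hφ (hR.above _ hs)
        obtain ⟨x, hx, hsx⟩ := h1.exists_in (by rintro rfl; exact he hs)
        exact ⟨x, hx, hs, above_map φ hsx⟩
      · rintro ⟨x, hx, hs, -⟩
        exact hs

/-- An arrow `χ` factors through an injective arrow `φ` if its edges and vertices lie
in the image of `φ`. -/
lemma factors {φ : D ⟶ T} (hφ : Function.Injective (emap φ)) {χ : S ⟶ T}
    (hE : Set.range (emap χ) ⊆ Set.range (emap φ)) (hV : verts χ ⊆ verts φ) :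
    ∃ ψ : S ⟶ D, ψ ≫ φ = χ := by
  choose f hf using fun s => hE ⟨s, rfl⟩
  refine ⟨homOfVertices f fun d hd => ?_, hom_ext fun x => hf x⟩
  obtain ⟨h1, h2⟩ := hom_vertex χ hd
  constructor
  · intro x hx y hy hxy
    exact h1 hx hy (by rw [← hf x, ← hf y, hxy])
  -- The operation assigned by `χ` to the vertex `d` uses only vertices in `verts χ`, hence in
  -- `verts φ`, so it lifts to `D`.
  · have := isOp_preimage hφ (f d) (R := emap χ '' {x | S.In x d}) (by rwa [hf d]) (by
      rintro _ ⟨x, -, rfl⟩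
      exact ⟨f x, hf x⟩) (by
      rw [hf d]
      intro w hw
      refine hV ?_
      rw [← Category.id_comp χ]
      exact mem_verts_comp.2 ⟨d, by rw [verts_id]; exact hd, hw⟩)
    convert this using 1
    ext y
    constructor
    · rintro ⟨x, hx, rfl⟩
      exact ⟨x, hx, (hf x).symm⟩
    · rintro ⟨x, hx, h⟩
      exact ⟨x, hx, hφ ((hf x).trans h)⟩

lemma mono_of_injective {φ : D ⟶ T} (hφ : Function.Injective (emap φ)) {ψ ψ' : S ⟶ D}
    (h : ψ ≫ φ = ψ' ≫ φ) : ψ = ψ' :=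
  hom_ext fun x => hφ (by rw [← emap_comp, ← emap_comp, h])

lemma opMap_injective {n : ℕ} {c : Fin n → T.Edge} {e : T.Edge}
    (h : Function.Injective c ∧ T.IsOp (Set.range c) e) (he : e ∉ Set.range c) :
    Function.Injective (emap (opMap T c e h)) := by
  rintro (_ | i) (_ | j) hij
  · rfl
  · exact (he ⟨j, hij.symm⟩).elim
  · exact (he ⟨i, hij⟩).elim
  · exact congrArg some (h.1 hij)

lemma verts_opMap {n : ℕ} (c : Fin n → T.Edge) (e : T.Edge) (h) :
    verts (opMap T c e h) = T.used (Set.range c) e := by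
  ext w
  rw [mem_verts]
  constructor
  · rintro ⟨h1, h2, h3⟩
    refine ⟨h1, h2, ?_⟩
    rintro _ ⟨i, rfl⟩
    exact h3 (some i) (Option.some_ne_none i)
  · rintro ⟨h1, h2, h3⟩
    refine ⟨h1, h2, ?_⟩
    rintro (_ | i) hl
    · exact (hl rfl).elim
    · exact h3 _ ⟨i, rfl⟩

lemma range_opMap {n : ℕ} (c : Fin n → T.Edge) (e : T.Edge) (h) :
    Set.range (emap (opMap T c e h)) = insert e (Set.range c) := by
  ext x
  constructor
  · rintro ⟨_ | i, rfl⟩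
    · exact Or.inl rfl
    · exact Or.inr ⟨i, rfl⟩
  · rintro (rfl | ⟨i, rfl⟩)
    · exact ⟨none, rfl⟩
    · exact ⟨some i, rfl⟩

lemma used_vertex (d : T.Edge) (hd : ¬ T.Leaf d) : T.used {x | T.In x d} d = {d} := by
  ext w
  constructor
  · rintro ⟨-, h2, h3⟩
    by_contra hne
    obtain ⟨x, hx, hwx⟩ := h2.exists_in hne
    exact h3 x hx hwx
  · rintro rfl
    exact ⟨hd, Above.refl _, fun s hs => not_above_of_in hs⟩

end Tree

end Dendroidal

namespace Dendroidal

namespace Tree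

variable {S T U D : Tree}

/-! ## Faces -/

lemma emap_contractMap_injective (k : T.Edge) (hk : T.Inner k) :
    Function.Injective (emap (T.contractMap k hk)) := fun _ _ h => Subtype.ext h

lemma emap_pruneMap_injective (v : T.Edge) (hv : T.TopVertex v) :
    Function.Injective (emap (T.pruneMap v hv)) := fun _ _ h => Subtype.ext h

lemma emap_upperMap_injective (d : T.Edge) :
    Function.Injective (emap (T.upperMap d)) := fun _ _ h => Subtype.ext h

lemma range_contractMap (k : T.Edge) (hk : T.Inner k) :
    Set.range (emap (T.contractMap k hk)) = {x | x ≠ k} := by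
  ext x
  exact ⟨fun ⟨y, hy⟩ => hy ▸ y.2, fun hx => ⟨⟨x, hx⟩, rfl⟩⟩

lemma range_pruneMap (v : T.Edge) (hv : T.TopVertex v) :
    Set.range (emap (T.pruneMap v hv)) = {x | ¬ T.In x v} := by
  ext x
  exact ⟨fun ⟨y, hy⟩ => hy ▸ y.2, fun hx => ⟨⟨x, hx⟩, rfl⟩⟩

lemma range_upperMap (d : T.Edge) :
    Set.range (emap (T.upperMap d)) = {x | T.Above x d} := by
  ext x
  exact ⟨fun ⟨y, hy⟩ => hy ▸ y.2, fun hx => ⟨⟨x, hx⟩, rfl⟩⟩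

lemma not_above_leaf {w l : T.Edge} (hw : ¬ T.Leaf w) (hl : T.Leaf l) : ¬ T.Above w l :=
  fun h => hw (h.eq_of_leaf hl ▸ hl)

lemma verts_contractMap (k : T.Edge) (hk : T.Inner k) :
    verts (T.contractMap k hk) = {w | ¬ T.Leaf w} := by
  ext w
  rw [mem_verts]
  exact ⟨fun h => h.1, fun h => ⟨h, above_root w, fun l hl => not_above_leaf h hl⟩⟩

lemma verts_pruneMap (v : T.Edge) (hv : T.TopVertex v) :
    verts (T.pruneMap v hv) = {w | ¬ T.Leaf w ∧ w ≠ v} := by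
  ext w
  rw [mem_verts]
  constructor
  · rintro ⟨h1, -, h3⟩
    refine ⟨h1, ?_⟩
    rintro rfl
    exact h3 ⟨w, fun h => in_ne h rfl⟩ (Or.inr rfl) (Above.refl _)
  · rintro ⟨h1, h2⟩
    refine ⟨h1, above_root w, ?_⟩
    rintro ⟨l, hlv⟩ (hl | hl)
    · exact not_above_leaf h1 hl
    · intro h
      obtain ⟨x, hx, hwx⟩ := Above.exists_in (T := T) (y := v) (hl ▸ h) h2
      exact not_above_leaf h1 (hv.2 x hx) hwx

lemma verts_upperMap (d : T.Edge) :
    verts (T.upperMap d) = {w | ¬ T.Leaf w ∧ T.Above w d} := by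
  ext w
  rw [mem_verts]
  exact ⟨fun h => ⟨h.1, h.2.1⟩, fun h => ⟨h.1, h.2, fun l hl => not_above_leaf h.1 hl⟩⟩

/-- The number of vertices of a tree. -/
noncomputable def nverts (T : Tree) : ℕ := {x | ¬ T.Leaf x}.ncard

lemma nverts_lt {φ : D ⟶ T} (hφ : Function.Injective (emap φ))
    (h : ∀ x, ¬ D.Leaf x → ¬ T.Leaf (emap φ x)) {w : T.Edge} (hw : ¬ T.Leaf w)
    (hw' : ∀ x, ¬ D.Leaf x → emap φ x ≠ w) : D.nverts < T.nverts := by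
  have := T.finite
  rw [nverts, ← Set.ncard_image_of_injective _ hφ]
  refine Set.ncard_lt_ncard ⟨?_, fun hsub => ?_⟩ (Set.toFinite _)
  · rintro _ ⟨x, hx, rfl⟩
    exact h x hx
  · obtain ⟨x, hx, hxw⟩ := hsub hw
    exact hw' x hx hxw

lemma nverts_contract (k : T.Edge) (hk : T.Inner k) : (T.contract k hk).nverts < T.nverts :=
  nverts_lt (emap_contractMap_injective k hk) (fun _ hx => hx) hk.2 fun x _ => x.2

lemma nverts_prune (v : T.Edge) (hv : T.TopVertex v) : (T.prune v hv).nverts < T.nverts :=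
  nverts_lt (emap_pruneMap_injective v hv) (fun _ hx h => hx (Or.inl h)) hv.1.2
    fun _ hx h => hx (Or.inr h)

lemma nverts_upper (d : T.Edge) (hd : T.BottomEdge d) : (T.upper d).nverts < T.nverts :=
  nverts_lt (emap_upperMap_injective d) (fun _ hx => hx) (not_leaf_of_in hd.1)
    fun x _ h => not_above_of_in hd.1 (h ▸ x.2)

/-- Above each vertex there is a vertex all of whose inputs are leaves. -/
lemma exists_top (w : T.Edge) (hw : ¬ T.Leaf w) :
    ∃ v, ¬ T.Leaf v ∧ (∀ x, T.In x v → T.Leaf x) ∧ T.Above v w := by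
  induction w using up_induction with
  | _ d ih =>
    by_cases h : ∀ x, T.In x d → T.Leaf x
    · exact ⟨d, hw, h, Above.refl _⟩
    · push Not at h
      obtain ⟨x, hx, hxl⟩ := h
      obtain ⟨v, h1, h2, h3⟩ := ih x hx hxl
      exact ⟨v, h1, h2, h3.trans' (Above.of_in hx)⟩

lemma exists_topVertex (w : T.Edge) (hw : T.Inner w) : ∃ v, T.TopVertex v ∧ T.Above v w := by
  obtain ⟨v, h1, h2, h3⟩ := exists_top w hw.2
  refine ⟨v, ⟨⟨?_, h1⟩, h2⟩, h3⟩
  rintro rfl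
  exact hw.1 (eq_root_of_above h3)

/-- An input of `v` occurs in the image only together with the vertex `v`, unless it is the image of
the root; `hr` excludes the latter. -/
lemma factors_prune {χ : S ⟶ T} (v : T.Edge) (hv : T.TopVertex v) (h : v ∉ verts χ)
    (hr : ¬ T.In (emap χ S.root) v) : ∃ ψ : S ⟶ T.prune v hv, ψ ≫ T.pruneMap v hv = χ := by
  refine factors (emap_pruneMap_injective v hv) ?_ ?_
  · rw [range_pruneMap]
    rintro _ ⟨s, rfl⟩ hs
    have h1 : T.Above (emap χ s) (emap χ S.root) := above_map χ (above_root s)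
    have h2 : T.Above v (emap χ S.root) := by
      obtain ⟨z, hz, hzr⟩ := h1.exists_out (fun h' => hr (h' ▸ hs))
      rwa [T.in_unique hs hz]
    refine h (mem_verts.2 ⟨hv.1.2, h2, fun l hl hvl => ?_⟩)
    rcases comparable_of_map ((Above.of_in hs).trans' hvl) with h3 | h3
    · obtain rfl := h3.eq_of_leaf hl
      exact not_above_of_in hs hvl
    · exact not_above_of_in hs (hvl.trans' (above_map χ h3))
  · rw [verts_pruneMap]
    intro w hw
    refine ⟨(mem_verts.1 hw).1, ?_⟩
    rintro rfl
    exact h hw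

lemma factors_upper {χ : S ⟶ T} (d : T.Edge) (h : T.Above (emap χ S.root) d) :
    ∃ ψ : S ⟶ T.upper d, ψ ≫ T.upperMap d = χ := by
  refine factors (emap_upperMap_injective d) ?_ ?_
  · rw [range_upperMap]
    rintro _ ⟨s, rfl⟩
    exact (above_map χ (above_root s)).trans' h
  · rw [verts_upperMap]
    intro w hw
    exact ⟨(mem_verts.1 hw).1, (mem_verts.1 hw).2.1.trans' h⟩

lemma factors_contract {χ : S ⟶ T} (k : T.Edge) (hk : T.Inner k) (h : k ∉ Set.range (emap χ)) :
    ∃ ψ : S ⟶ T.contract k hk, ψ ≫ T.contractMap k hk = χ := by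
  refine factors (emap_contractMap_injective k hk) ?_ ?_
  · rw [range_contractMap]
    rintro x hx rfl
    exact h hx
  · rw [verts_contractMap]
    exact fun w hw => (mem_verts.1 hw).1

/-- If a tree has an inner edge, then an arrow which misses some vertex factors through an
outer face. -/
lemma exists_outer_factor (χ : S ⟶ T) {m w : T.Edge} (hm : T.Inner m) (hw : ¬ T.Leaf w)
    (hwχ : w ∉ verts χ) :
    (∃ (v : T.Edge) (hv : T.TopVertex v), ∃ ψ : S ⟶ T.prune v hv, ψ ≫ T.pruneMap v hv = χ) ∨
      ∃ (d : T.Edge) (_ : T.BottomEdge d), ∃ ψ : S ⟶ T.upper d, ψ ≫ T.upperMap d = χ := by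
  -- Pruning is possible at any missing top vertex unless the image of the root is one of its
  -- inputs. When it is never possible, the root vertex has to be removed instead.
  by_cases hA : ∃ v, T.TopVertex v ∧ v ∉ verts χ ∧ ¬ T.In (emap χ S.root) v
  · obtain ⟨v, hv, h1, h2⟩ := hA
    exact Or.inl ⟨v, hv, factors_prune v hv h1 h2⟩
  right
  push Not at hA
  by_cases hρ : emap χ S.root = T.root
  · exfalso
    -- If the root is hit, every top vertex is used. But the missing vertex `w` lies above the image
    -- of a leaf, hence so does a top vertex above `w`, or every top vertex if `w` is the root.
    have hall : ∀ v, T.TopVertex v → v ∈ verts χ := by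
      intro v hv
      by_contra h
      have := hA v hv h
      rw [hρ] at this
      exact T.not_in_root this
    have : ∃ l, S.Leaf l ∧ T.Above w (emap χ l) := by
      by_contra h
      push Not at h
      exact hwχ (mem_verts.2 ⟨hw, by rw [hρ]; exact above_root w, h⟩)
    obtain ⟨l, hl, hwl⟩ := this
    by_cases hwr : w = T.root
    · rw [hwr] at hwl
      have hl' := eq_root_of_above hwl
      obtain ⟨v, hv, -⟩ := exists_topVertex m hm
      exact (mem_verts.1 (hall v hv)).2.2 l hl (by rw [hl']; exact above_root v)
    · obtain ⟨v, hv, hvw⟩ := exists_topVertex w ⟨hwr, hw⟩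
      exact (mem_verts.1 (hall v hv)).2.2 l hl (hvw.trans' hwl)
  · obtain ⟨d, hd, hρd⟩ := (above_root (emap χ S.root)).exists_in hρ
    refine ⟨d, ⟨hd, fun hdl => ?_, fun x hx hxd => ?_⟩, factors_upper d hρd⟩
    · obtain ⟨v, hv, -⟩ := exists_topVertex m hm
      have hdρ := hρd.eq_of_leaf hdl
      have := hA v hv fun hv' => not_above_leaf hv.1.2 hdl (hdρ ▸ (mem_verts.1 hv').2.1)
      rw [hdρ] at this
      exact hv.1.1 (T.in_unique this hd)
    -- A second non-leaf input `x` of the root would have a top vertex `v` above it. Either `v` is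
    -- used, so it also lies above `d`, or the image of the root is an input of `v`; both give an
    -- edge above `x` and `d`.
    · by_contra hxl
      obtain ⟨v, hv, hvx⟩ := exists_topVertex x
        ⟨fun h => T.not_in_root (h ▸ hx), hxl⟩
      by_cases hvχ : v ∈ verts χ
      · exact hxd (eq_of_in hx hd hvx ((mem_verts.1 hvχ).2.1.trans' hρd))
      · exact hxd (eq_of_in hx hd ((Above.of_in (hA v hv hvχ)).trans' hvx) hρd)

instance : Finite T.Face := by
  have := T.finite
  refine Finite.of_injective (β := T.Edge ⊕ T.Edge ⊕ T.Edge ⊕ T.Edge)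
    (fun F => match F with
      | .inner e _ => Sum.inl e
      | .top v _ => Sum.inr (Sum.inl v)
      | .bottom d _ => Sum.inr (Sum.inr (Sum.inl d))
      | .edge _ x => Sum.inr (Sum.inr (Sum.inr x))) ?_
  rintro (_ | _ | _ | _) (_ | _ | _ | _) h <;> simp_all

end Tree

open Dendroidal.Tree

/-! ## Extension of families along sieves of trees -/

section Sieve

variable {T D : Tree} {X : DendroidalSet.{u}}

/-- Each compatible family on the sieve `B` is the restriction of a dendrex. -/
def Extendable (X : DendroidalSet.{u}) {T : Tree} (B : Sieve T) : Prop :=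
  ∀ x : Presieve.FamilyOfElements X B.arrows, x.Compatible → ∃ t, x.IsAmalgamation t

/-- The sieve obtained by adding an arrow `φ`. -/
def adjoin (B : Sieve T) (φ : D ⟶ T) : Sieve T where
  arrows _ χ := B χ ∨ ∃ ψ, ψ ≫ φ = χ
  downward_closed := by
    rintro Y Z f (h | ⟨ψ, rfl⟩) g
    · exact Or.inl (B.downward_closed h g)
    · exact Or.inr ⟨g ≫ ψ, Category.assoc _ _ _⟩

lemma pull_comp {R S T : Tree} (χ : R ⟶ S) (ψ : S ⟶ T) (x : X.obj (op T)) :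
    X.pull (χ ≫ ψ) x = X.pull χ (X.pull ψ x) := by
  simp [DendroidalSet.pull]

lemma pull_id (x : X.obj (op T)) : X.pull (𝟙 T) x = x := by
  simp [DendroidalSet.pull]

/-- The union of `B` and the face `φ` is the gluing of `B` with `Ω[D]` along `B.pullback φ`. So one
extends first over `D`, then from the union to `T`. -/
lemma extendable_of_adjoin {B : Sieve T} {φ : D ⟶ T} (hφ : Function.Injective (emap φ))
    (h1 : Extendable X (B.pullback φ)) (h2 : Extendable X (adjoin B φ)) : Extendable X B := by
  intro x hx
  rw [Presieve.compatible_iff_sieveCompatible] at hx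
  let z : Presieve.FamilyOfElements X (B.pullback φ).arrows := fun Y ψ hψ => x (ψ ≫ φ) hψ
  obtain ⟨y, hy⟩ := h1 z ((Presieve.compatible_iff_sieveCompatible _).2 (by
    intro Y Z f g hf
    have := hx (f ≫ φ) g hf
    simp only [z]
    exact this))
  -- Lifts along `φ` are unique, and `y` restricts to the given family on the overlap; so the two
  -- prescriptions define one value.
  have key : ∀ (Y : Tree) (χ : Y ⟶ T), adjoin B φ χ → ∃ v : X.obj (op Y),
      (∀ h : B χ, v = x χ h) ∧ ∀ ψ, ψ ≫ φ = χ → v = X.pull ψ y := by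
    intro Y χ hχ
    by_cases h : B χ
    · refine ⟨x χ h, fun _ => rfl, ?_⟩
      rintro ψ rfl
      exact (hy ψ h).symm
    · rcases hχ with h' | ⟨ψ, rfl⟩
      · exact (h h').elim
      · refine ⟨X.pull ψ y, fun h' => (h h').elim, fun ψ' h' => ?_⟩
        rw [mono_of_injective hφ h']
  choose x' hx1 hx2 using key
  let z' : Presieve.FamilyOfElements X (adjoin B φ).arrows := fun Y χ h => x' Y χ h
  obtain ⟨t, ht⟩ := h2 z' ((Presieve.compatible_iff_sieveCompatible _).2 (by
    intro Y Z f g hf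
    rcases id hf with h | ⟨ψ, hψ⟩
    · exact (hx1 Z (g ≫ f) _ (B.downward_closed h g)).trans
        ((hx f g h).trans (congrArg (X.pull g) (hx1 Y f hf h).symm))
    · exact (hx2 Z (g ≫ f) _ (g ≫ ψ) (by rw [Category.assoc, hψ])).trans
        ((pull_comp g ψ y).trans (congrArg (X.pull g) (hx2 Y f hf ψ hψ).symm))))
  exact ⟨t, fun Y f hf => (ht f (Or.inl hf)).trans (hx1 Y f _ hf)⟩

/-- The inner horn, as a sieve. -/
def hornSieve (T : Tree) (e : T.Edge) (he : T.Inner e) : Sieve T where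
  arrows _ χ := ∃ F : T.Face, F ≠ Face.inner e he ∧ ∃ ψ, ψ ≫ F.map = χ
  downward_closed := by
    rintro Y Z f ⟨F, hF, ψ, rfl⟩ g
    exact ⟨F, hF, g ≫ ψ, Category.assoc _ _ _⟩

lemma extendable_hornSieve (hX : IsInnerKan X) (T : Tree) (e : T.Edge) (he : T.Inner e) :
    Extendable X (hornSieve T e he) := by
  intro x hx
  rw [Presieve.compatible_iff_sieveCompatible] at hx
  obtain ⟨y, hy⟩ := hX T e he
    { app := fun S => TypeCat.ofHom fun φ => x (ULift.down φ.1) φ.2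
      naturality := by
        intro S S' α
        ext φ
        exact hx (ULift.down φ.1) α.unop φ.2 }
  refine ⟨uliftYonedaEquiv y, fun S χ hχ => ?_⟩
  have h1 := congrArg (fun z => z.app (op S) ⟨ULift.up χ, hχ⟩) hy
  refine Eq.trans ?_ h1
  refine (uliftYonedaEquiv_naturality y χ.op).trans ?_
  rw [uliftYonedaEquiv_comp, uliftYonedaEquiv_uliftYoneda_map]
  rfl

/-- The uniqueness half of strictness, tested on the faces that generate the horn. -/
lemma ext_of_horn (hX : IsStrictInnerKan X) {T : Tree} {e : T.Edge} (he : T.Inner e)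
    {x y : X.obj (op T)}
    (h : ∀ F : T.Face, F ≠ Face.inner e he → X.pull F.map x = X.pull F.map y) : x = y := by
  have := (hX T e he).1 (a₁ := uliftYonedaEquiv.symm x) (a₂ := uliftYonedaEquiv.symm y) (by
    ext S ⟨χ, F, hF, ψ, hψ⟩
    change X.pull (ULift.down χ) x = X.pull (ULift.down χ) y
    rw [← hψ, pull_comp, pull_comp, h F hF])
  exact uliftYonedaEquiv.symm.injective this

/-- The assignment `m` of edges pairs the faces of `T` which are not in `B`. -/
def Pairing (B : Sieve T) (m : Set T.Edge → T.Edge) : Prop :=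
  ∀ (S : Tree) (χ : S ⟶ T), ¬ B χ → m (verts χ) ∈ verts χ ∧ m (verts χ) ≠ emap χ S.root ∧
    ∀ (S' : Tree) (χ' : S' ⟶ T), verts χ' = verts χ →
      Set.range (emap χ) ⊆ insert (m (verts χ)) (Set.range (emap χ')) → ¬ B χ'

/-- By `h` no pair is split: if the member without the pairing edge factors through `φ`, so does the
member with it. -/
lemma Pairing.adjoin {B : Sieve T} {m : Set T.Edge → T.Edge} (hB : Pairing B m) {φ : D ⟶ T}
    (hφ : Function.Injective (emap φ))
    (h : ∀ (S : Tree) (χ : S ⟶ T), ¬ B χ → verts χ ⊆ verts φ →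
      m (verts χ) ∈ Set.range (emap φ)) : Pairing (adjoin B φ) m := by
  intro S χ hχ
  obtain ⟨hχ1, hχ2⟩ := not_or.1 hχ
  obtain ⟨h1, h2, h3⟩ := hB S χ hχ1
  refine ⟨h1, h2, ?_⟩
  rintro S' χ' hV hE (h' | ⟨ψ, rfl⟩)
  · exact h3 S' χ' hV hE h'
  · have hV' : verts χ ⊆ verts φ := hV ▸ verts_comp_subset ψ φ
    refine hχ2 (factors hφ (hE.trans (Set.insert_subset (h S χ hχ1 hV') ?_)) hV')
    rintro _ ⟨x, rfl⟩
    exact ⟨_, rfl⟩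

/-- The pairing edge of `χ ≫ φ` lies in the image of `φ` and can be lifted to `D`. By
`verts_comp_congr` the lift depends only on `verts χ`, as a pairing requires. -/
lemma Pairing.pullback {B : Sieve T} {m : Set T.Edge → T.Edge} (hB : Pairing B m) {φ : D ⟶ T}
    (hφ : Function.Injective (emap φ))
    (h : ∀ (S : Tree) (χ : S ⟶ T), ¬ B χ → verts χ ⊆ verts φ →
      m (verts χ) ∈ Set.range (emap φ)) : ∃ m', Pairing (B.pullback φ) m' := by
  have key : ∀ W : Set D.Edge, ∃ k : D.Edge, ∀ (S : Tree) (χ : S ⟶ D), ¬ B (χ ≫ φ) →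
      verts χ = W → emap φ k = m (verts (χ ≫ φ)) := by
    intro W
    by_cases hW : ∃ (S : Tree) (χ : S ⟶ D), ¬ B (χ ≫ φ) ∧ verts χ = W
    · obtain ⟨S, χ, hχ, rfl⟩ := hW
      obtain ⟨k, hk⟩ := h S _ hχ (verts_comp_subset χ φ)
      refine ⟨k, fun S' χ' _ hV => ?_⟩
      rw [hk, verts_comp_congr hV]
    · exact ⟨D.root, fun S χ h1 h2 => (hW ⟨S, χ, h1, h2⟩).elim⟩
  choose m' hm' using key
  refine ⟨m', fun S χ hχ => ?_⟩
  obtain ⟨h1, h2, h3⟩ := hB S _ hχ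
  have hk := hm' _ S χ hχ rfl
  rw [← hk] at h1 h2 h3
  refine ⟨mem_verts_of_comp hφ h1, fun h' => h2 (by rw [h']; rfl), fun S' χ' hV hE => ?_⟩
  refine h3 S' (χ' ≫ φ) (verts_comp_congr hV φ) ?_
  rintro _ ⟨x, rfl⟩
  rcases hE ⟨x, rfl⟩ with h' | ⟨y, hy⟩
  · exact Or.inl (congrArg (emap φ) h')
  · exact Or.inr ⟨y, congrArg (emap φ) hy⟩

lemma extendable_of_id {B : Sieve T} (h : B (𝟙 T)) : Extendable X B := by
  intro x hx
  rw [Presieve.compatible_iff_sieveCompatible] at hx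
  refine ⟨x (𝟙 T) h, fun S χ hχ => ?_⟩
  have := hx (𝟙 T) χ h
  simp only at this
  exact this.symm

/-- The inner edge `m` gives two vertices, `m` itself and the one into which it enters, so the faces
given by single edges do not occur. -/
lemma Face.inj_and_lt {T : Tree} (F : T.Face) {m : T.Edge} (hm : T.Inner m) :
    Function.Injective (emap F.map) ∧ F.dom.nverts < T.nverts := by
  cases F with
  | inner k hk => exact ⟨emap_contractMap_injective k hk, nverts_contract k hk⟩
  | top v hv => exact ⟨emap_pruneMap_injective v hv, nverts_prune v hv⟩
  | bottom d hd => exact ⟨emap_upperMap_injective d, nverts_upper d hd⟩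
  | edge hT x =>
    obtain ⟨v, -, hv⟩ := hT
    have h1 := hv m hm.2
    obtain ⟨z, hz, -⟩ := (above_root m).exists_in hm.1
    have h2 := hv _ (not_leaf_of_in hz)
    exact (hm.1 (h1.trans h2.symm)).elim

/-- An arrow in `B` missing a vertex lies in an outer face. One using all vertices must miss some
edge besides the pairing edge of the identity, since the pairing keeps both `𝟙 T` and the
contraction of that edge outside `B`; it then lies in another inner face. -/
lemma le_hornSieve {B : Sieve T} {m : Set T.Edge → T.Edge} (hB : Pairing B m)
    (hid : ¬ B (𝟙 T)) (hm : T.Inner (m (verts (𝟙 T)))) : B ≤ hornSieve T _ hm := by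
  intro S χ hχ
  obtain ⟨-, -, h3⟩ := hB T (𝟙 T) hid
  by_cases hV : verts χ = verts (𝟙 T)
  · have : ∃ k, k ≠ m (verts (𝟙 T)) ∧ k ∉ Set.range (emap χ) := by
      by_contra hcon
      push Not at hcon
      refine h3 S χ hV (fun k _ => ?_) hχ
      by_cases hk : k = m (verts (𝟙 T))
      · exact Or.inl hk
      · exact Or.inr (hcon k hk)
    obtain ⟨k, hkm, hk⟩ := this
    rw [verts_id] at hV
    have hroot : emap χ S.root = T.root := by
      obtain ⟨z, hz, -⟩ := (above_root _).exists_in hm.1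
      have : T.root ∈ verts χ := by
        rw [hV]
        exact not_leaf_of_in hz
      exact eq_root_of_above (mem_verts.1 this).2.1
    have hki : T.Inner k := by
      constructor
      · rintro rfl
        exact hk ⟨_, hroot⟩
      · intro hkl
        -- A leaf `k` outside the image lies strictly above the image of a leaf of `S`, so the
        -- vertex with input `k` is not used, although all vertices are.
        obtain ⟨_, ⟨l, hl, rfl⟩, hkl'⟩ := (hom_isOp χ leaves_isOp).2.exists_of_leaf hkl
          (by rw [hroot]; exact above_root k)
        obtain ⟨p, hp, hpl⟩ := hkl'.exists_out (fun h => hk ⟨l, h.symm⟩)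
        have : p ∈ verts χ := by
          rw [hV]
          exact not_leaf_of_in hp
        exact (mem_verts.1 this).2.2 l hl hpl
    exact ⟨Face.inner k hki, fun h => hkm (Face.inner.inj h), factors_contract k hki hk⟩
  · have : ∃ w, ¬ T.Leaf w ∧ w ∉ verts χ := by
      by_contra hcon
      push Not at hcon
      refine hV (Set.Subset.antisymm (fun w hw => ?_) fun w hw => ?_)
      · rw [verts_id]
        exact (mem_verts.1 hw).1
      · rw [verts_id] at hw
        exact hcon w hw
    obtain ⟨w, hw, hwχ⟩ := this
    rcases exists_outer_factor χ hm hw hwχ with ⟨v, hv, h⟩ | ⟨d, hd, h⟩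
    · exact ⟨Face.top v hv, nofun, h⟩
    · exact ⟨Face.bottom d hd, nofun, h⟩

/-- Double induction, on the number of vertices of `T` and on the number of faces of `T` missing
from `B`. Missing outer faces are adjoined first, then missing inner faces other than the
contraction of the pairing edge of `𝟙 T`. When none is left, `B` is an inner horn and the Kan
condition applies. -/
theorem extendable_of_pairing (hX : IsInnerKan X) {T : Tree} (B : Sieve T)
    (m : Set T.Edge → T.Edge) (hB : Pairing B m) : Extendable X B := by
  induction hN : T.nverts using Nat.strong_induction_on generalizing T with
  | _ N ihN =>
  induction hM : {F : T.Face | ¬ B F.map}.ncard using Nat.strong_induction_on generalizing B with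
  | _ M ihM =>
  subst hN hM
  by_cases hid : B (𝟙 T)
  · exact extendable_of_id hid
  obtain ⟨hm1, hm2, -⟩ := hB T (𝟙 T) hid
  have hm : T.Inner (m (verts (𝟙 T))) := ⟨hm2, (mem_verts.1 hm1).1⟩
  -- Adjoining `F` is allowed when each arrow outside `B` whose vertices belong to `F` has its
  -- pairing edge in `F`. The first induction then treats the overlap and the second one the
  -- enlarged sieve.
  have step : ∀ F : T.Face, ¬ B F.map → (∀ (S : Tree) (χ : S ⟶ T), ¬ B χ →
      verts χ ⊆ verts F.map → m (verts χ) ∈ Set.range (emap F.map)) → Extendable X B := by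
    intro F hF h
    obtain ⟨hi, hlt⟩ := Face.inj_and_lt F hm
    obtain ⟨m', hm'⟩ := hB.pullback hi h
    refine extendable_of_adjoin hi (ihN _ hlt _ m' hm' rfl)
      (ihM _ ?_ _ (hB.adjoin hi h) rfl)
    refine Set.ncard_lt_ncard ⟨fun G hG h' => hG (Or.inl h'), fun hsub => ?_⟩ (Set.toFinite _)
    exact hsub hF (Or.inr ⟨𝟙 _, Category.id_comp _⟩)
  by_cases htop : ∃ v hv, ¬ B (Face.top (T := T) v hv).map
  · obtain ⟨v, hv, hF⟩ := htop
    refine step _ hF fun S χ hχ hV => ?_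
    change _ ∈ Set.range (emap (T.pruneMap v hv))
    rw [range_pruneMap]
    -- The edges deleted by a top face are leaves, whereas the pairing edge is the output of a
    -- vertex.
    exact fun h => (mem_verts.1 (hB S χ hχ).1).1 (hv.2 _ h)
  by_cases hbot : ∃ d hd, ¬ B (Face.bottom (T := T) d hd).map
  · obtain ⟨d, hd, hF⟩ := hbot
    refine step _ hF fun S χ hχ hV => ?_
    change _ ∈ Set.range (emap (T.upperMap d))
    rw [range_upperMap]
    have := hV (hB S χ hχ).1
    change _ ∈ verts (T.upperMap d) at this
    rw [verts_upperMap] at this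
    exact this.2
  push Not at htop hbot
  by_cases hinn : ∃ k hk, k ≠ m (verts (𝟙 T)) ∧ ¬ B (Face.inner (T := T) k hk).map
  · obtain ⟨k, hk, hkm, hF⟩ := hinn
    refine step _ hF fun S χ hχ hV => ?_
    change _ ∈ Set.range (emap (T.contractMap k hk))
    rw [range_contractMap]
    -- All outer faces lie in `B` by now, so an arrow outside `B` uses every vertex and has the same
    -- pairing edge as `𝟙 T`; contracting `k` keeps that edge.
    have hVχ : verts χ = verts (𝟙 T) := by
      rw [verts_id]
      refine Set.Subset.antisymm (fun w hw => (mem_verts.1 hw).1) fun w hw => ?_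
      by_contra hwχ
      rcases exists_outer_factor χ hm hw hwχ with ⟨v, hv, ψ, rfl⟩ | ⟨d, hd, ψ, rfl⟩
      · exact hχ (B.downward_closed (htop v hv) ψ)
      · exact hχ (B.downward_closed (hbot d hd) ψ)
    rw [hVχ]
    exact Ne.symm hkm
  push Not at hinn
  have heq : B = hornSieve T _ hm := by
    refine le_antisymm (le_hornSieve hB hid hm) ?_
    rintro S _ ⟨F, hF, ψ, rfl⟩
    refine B.downward_closed ?_ ψ
    cases F with
    | inner k hk => exact hinn k hk (by rintro rfl; exact hF rfl)
    | top v hv => exact htop v hv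
    | bottom d hd => exact hbot d hd
    | edge hT x =>
      have := (Face.inj_and_lt (.edge hT x) hm).2
      obtain ⟨v, -, hv⟩ := hT
      obtain ⟨z, hz, -⟩ := (above_root _).exists_in hm.1
      exact (hm.1 ((hv _ hm.2).trans (hv _ (not_leaf_of_in hz)).symm)).elim
  rw [heq]
  exact extendable_hornSieve hX T _ hm

end Sieve

end Dendroidal

/-! ### Amalgamation of compatible dendrices, and fillers for grafted trees -/

namespace Dendroidal

open Dendroidal.Tree

variable {X : DendroidalSet.{u}}

/-- The filling principle for the union of the images of the `φ j`. The predicate `P` marks edges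
that can serve for pairing: an arrow outside the union has a marked vertex, and removing any marked
vertex from its edges, while keeping the set of vertices, never leads into the union. The pairing
chooses one marked vertex for each set of vertices. -/
theorem exists_amalgam (hX : IsInnerKan X) {T : Tree} {J : Type*} {D : J → Tree}
    (φ : ∀ j, D j ⟶ T) (y : ∀ j, X.obj (op (D j)))
    (hy : ∀ i j (S : Tree) (ψ : S ⟶ D i) (ψ' : S ⟶ D j), ψ ≫ φ i = ψ' ≫ φ j →
      X.pull ψ (y i) = X.pull ψ' (y j))
    (P : T.Edge → Prop)
    (hP : ∀ (S : Tree) (χ : S ⟶ T), (∀ j, ¬ ∃ ψ, ψ ≫ φ j = χ) → (∃ a ∈ verts χ, P a) ∧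
      ∀ a ∈ verts χ, P a → a ≠ emap χ S.root ∧ ∀ (S' : Tree) (χ' : S' ⟶ T),
        verts χ' = verts χ → Set.range (emap χ) ⊆ insert a (Set.range (emap χ')) →
          ∀ j, ¬ ∃ ψ, ψ ≫ φ j = χ') :
    ∃ x : X.obj (op T), ∀ j, X.pull (φ j) x = y j := by
  let B : Sieve T :=
    { arrows := fun S χ => ∃ j, ∃ ψ, ψ ≫ φ j = χ
      downward_closed := by
        rintro Y Z f ⟨j, ψ, rfl⟩ g
        exact ⟨j, g ≫ ψ, Category.assoc _ _ _⟩ }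
  have hm : ∀ W : Set T.Edge, ∃ a, (∃ a ∈ W, P a) → a ∈ W ∧ P a := by
    intro W
    by_cases h : ∃ a ∈ W, P a
    · exact ⟨h.choose, fun _ => h.choose_spec⟩
    · exact ⟨T.root, fun h' => (h h').elim⟩
  choose m hm using hm
  have hB : Pairing B m := by
    intro S χ hχ
    obtain ⟨h1, h2⟩ := hP S χ fun j hj => hχ ⟨j, hj⟩
    obtain ⟨h3, h4⟩ := hm _ h1
    obtain ⟨h5, h6⟩ := h2 _ h3 h4
    exact ⟨h3, h5, fun S' χ' hV hE ⟨j, hj⟩ => h6 S' χ' hV hE j hj⟩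
  have key : ∀ (S : Tree) (χ : S ⟶ T), B χ → ∃ v : X.obj (op S),
      ∀ j ψ, ψ ≫ φ j = χ → v = X.pull ψ (y j) := by
    rintro S χ ⟨i, ψ, rfl⟩
    exact ⟨X.pull ψ (y i), fun j ψ' h => hy i j S ψ ψ' h.symm⟩
  choose z hz using key
  let z' : Presieve.FamilyOfElements X B.arrows := fun S χ h => z S χ h
  obtain ⟨x, hx⟩ := extendable_of_pairing hX B m hB z'
    ((Presieve.compatible_iff_sieveCompatible _).2 (by
      intro S S' f g hf
      obtain ⟨j, ψ, hψ⟩ := id hf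
      exact (hz S' (g ≫ f) _ j (g ≫ ψ) (by rw [Category.assoc, hψ])).trans
        ((pull_comp g ψ _).trans (congrArg (X.pull g) (hz S f hf j ψ hψ).symm))))
  refine ⟨x, fun j => ?_⟩
  refine (hx (φ j) ⟨j, 𝟙 _, Category.id_comp _⟩).trans ?_
  exact (hz _ _ _ j (𝟙 _) (Category.id_comp _)).trans (pull_id _)

namespace Tree

variable {S T D : Tree}

/-- An arrow which sends each vertex to a vertex with the corresponding inputs. -/
def homOfIn (f : S.Edge → T.Edge) (hf : Function.Injective f)
    (h : ∀ d, ¬ S.Leaf d → ¬ T.Leaf (f d) ∧ ∀ y, T.In y (f d) ↔ ∃ x, S.In x d ∧ f x = y) :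
    S ⟶ T :=
  homOfVertices f fun d hd => ⟨hf.injOn, by
    have := IsOp.vertex (h d hd).1
    convert this using 1
    ext y
    exact ((h d hd).2 y).symm⟩

lemma IsOp.two {d : T.Edge} (hd : ¬ T.Leaf d) (h : ∀ x, T.In x d → ¬ T.Leaf x) :
    T.IsOp {y | ∃ x, T.In x d ∧ T.In y x} d :=
  IsOp.graft d hd (fun x => {y | T.In y x}) fun x hx => IsOp.vertex (h x hx)

lemma factors_edge {ψ : S ⟶ D} {e : D.Edge} (h : ∀ s, emap ψ s = e) (he : D.Leaf e) :
    ∃ π : S ⟶ eta, π ≫ D.edgeMap e = ψ := by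
  refine factors (fun _ _ _ => rfl) ?_ ?_
  · rintro _ ⟨s, rfl⟩
    exact ⟨(), (h s).symm⟩
  · intro w hw
    obtain ⟨h1, h2, -⟩ := mem_verts.1 hw
    rw [h] at h2
    exact (not_above_leaf h1 he h2).elim

/-! ## Grafting trees onto a corolla -/

/-- The tree obtained by grafting the trees `R i` onto the inputs of the corolla `Cₙ`. -/
abbrev graft (n : ℕ) (R : Fin n → Tree) : Tree where
  Edge := Option (Σ i, (R i).Edge)
  finite := by
    have := fun i => (R i).finite
    infer_instance
  root := none
  In x y := (∃ i, x = some ⟨i, (R i).root⟩ ∧ y = none) ∨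
    ∃ i a b, (R i).In a b ∧ x = some ⟨i, a⟩ ∧ y = some ⟨i, b⟩
  Leaf x := ∃ i a, (R i).Leaf a ∧ x = some ⟨i, a⟩
  in_unique := by
    rintro x y z (⟨i, rfl, rfl⟩ | ⟨i, a, b, h, rfl, rfl⟩) (⟨j, hj, rfl⟩ | ⟨j, a', b', h', hj, rfl⟩)
    · rfl
    · cases hj
      exact ((R i).not_in_root h').elim
    · cases hj
      exact ((R i).not_in_root h).elim
    · cases hj
      rw [(R i).in_unique h h']
  not_in_root := by
    rintro y (⟨i, h, -⟩ | ⟨i, a, b, -, h, -⟩) <;> cases h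
  not_in_leaf := by
    rintro x y (⟨i, rfl, rfl⟩ | ⟨i, a, b, h, rfl, rfl⟩) ⟨j, a', h', hj⟩
    · cases hj
    · cases hj
      exact (R i).not_in_leaf h h'
  reach := by
    rintro (_ | ⟨i, a⟩)
    · exact Relation.ReflTransGen.refl
    · refine Relation.ReflTransGen.tail (b := some ⟨i, (R i).root⟩) ?_ (Or.inl ⟨i, rfl, rfl⟩)
      exact Relation.ReflTransGen.lift (fun a => (some ⟨i, a⟩ : Option (Σ i, (R i).Edge)))
        (fun a b h => Or.inr ⟨i, a, b, h, rfl, rfl⟩) _ _ ((R i).reach a)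

variable {n : ℕ} {R : Fin n → Tree}

/-- The edges of the `i`-th tree grafted onto a corolla. -/
abbrev gr (i : Fin n) (a : (R i).Edge) : (graft n R).Edge := some ⟨i, a⟩

lemma graft_in_root {x : (graft n R).Edge} :
    (graft n R).In x none ↔ ∃ i, x = gr i (R i).root := by
  constructor
  · rintro (⟨i, rfl, -⟩ | ⟨i, a, b, -, -, h⟩)
    · exact ⟨i, rfl⟩
    · cases h
  · rintro ⟨i, rfl⟩
    exact Or.inl ⟨i, rfl, rfl⟩

lemma graft_in_gr {x : (graft n R).Edge} {i : Fin n} {b : (R i).Edge} :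
    (graft n R).In x (gr i b) ↔ ∃ a, (R i).In a b ∧ x = gr i a := by
  constructor
  · rintro (⟨i, rfl, h⟩ | ⟨i, a, b, h, rfl, hi⟩)
    · cases h
    · cases hi
      exact ⟨a, h, rfl⟩
  · rintro ⟨a, h, rfl⟩
    exact Or.inr ⟨i, a, b, h, rfl, rfl⟩

lemma graft_not_leaf_root : ¬ (graft n R).Leaf none := by
  rintro ⟨i, a, -, h⟩
  cases h

lemma graft_leaf_gr {i : Fin n} {a : (R i).Edge} : (graft n R).Leaf (gr i a) ↔ (R i).Leaf a := by
  constructor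
  · rintro ⟨j, b, h, hj⟩
    cases hj
    exact h
  · intro h
    exact ⟨i, a, h, rfl⟩

lemma gr_injective (i : Fin n) : Function.Injective (gr (R := R) i) := by
  intro a b h
  cases h
  rfl

/-- The inclusion of the `i`-th tree grafted onto a corolla. -/
def grIncl (R : Fin n → Tree) (i : Fin n) : R i ⟶ graft n R :=
  homOfIn (gr i) (gr_injective i) fun d hd => ⟨fun h => hd (graft_leaf_gr.1 h), fun y => by
    rw [graft_in_gr]
    exact ⟨fun ⟨a, h, h'⟩ => ⟨a, h, h'.symm⟩, fun ⟨a, h, h'⟩ => ⟨a, h, h'.symm⟩⟩⟩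

@[simp] lemma emap_grIncl (i : Fin n) (a : (R i).Edge) : emap (grIncl R i) a = gr i a := rfl

lemma emap_grIncl_injective (i : Fin n) : Function.Injective (emap (grIncl R i)) :=
  gr_injective i

lemma gr_root_injective : Function.Injective fun i => gr i (R i).root := by
  intro i j h
  cases h
  rfl

lemma graft_bot_isOp : (graft n R).IsOp (Set.range fun i => gr i (R i).root) none := by
  convert IsOp.vertex (graft_not_leaf_root (R := R)) using 1
  ext x
  rw [Set.mem_ofPred_eq, graft_in_root]
  exact ⟨fun ⟨i, h⟩ => ⟨i, h.symm⟩, fun ⟨i, h⟩ => ⟨i, h.symm⟩⟩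

/-- The corolla at the root of a grafted tree. -/
def grBot (R : Fin n → Tree) : corolla n ⟶ graft n R :=
  opMap (graft n R) (fun i => gr i (R i).root) none ⟨gr_root_injective, graft_bot_isOp⟩

@[simp] lemma emap_grBot_none : emap (grBot R) none = none := rfl

@[simp] lemma emap_grBot_some (i : Fin n) : emap (grBot R) (some i) = gr i (R i).root := rfl

lemma emap_grBot_injective : Function.Injective (emap (grBot R)) :=
  opMap_injective _ (by rintro ⟨i, h⟩; cases h)

lemma above_gr {x : (graft n R).Edge} {i : Fin n} {b : (R i).Edge}
    (h : (graft n R).Above x (gr i b)) : ∃ a, (R i).Above a b ∧ x = gr i a := by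
  induction h using Relation.ReflTransGen.head_induction_on with
  | refl => exact ⟨b, Above.refl _, rfl⟩
  | head hxy _ ih =>
    obtain ⟨a, ha, rfl⟩ := ih
    obtain ⟨a', ha', rfl⟩ := graft_in_gr.1 hxy
    exact ⟨a', (Above.of_in ha').trans' ha, rfl⟩

lemma gr_above_root (i : Fin n) (a : (R i).Edge) :
    (graft n R).Above (gr i a) (gr i (R i).root) :=
  above_map (grIncl R i) (above_root a)

lemma not_above_gr_none {i : Fin n} {b : (R i).Edge} : ¬ (graft n R).Above none (gr i b) := by
  intro h
  obtain ⟨a, -, ha⟩ := above_gr h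
  cases ha

lemma verts_grIncl (i : Fin n) : verts (grIncl R i) = gr i '' {a | ¬ (R i).Leaf a} := by
  ext w
  rw [mem_verts]
  constructor
  · rintro ⟨h1, h2, -⟩
    obtain ⟨a, ha, rfl⟩ := above_gr h2
    exact ⟨a, fun h => h1 (graft_leaf_gr.2 h), rfl⟩
  · rintro ⟨a, ha, rfl⟩
    refine ⟨fun h => ha (graft_leaf_gr.1 h), gr_above_root i a, fun l hl h => ?_⟩
    exact not_above_leaf ha hl (above_of_map (emap_grIncl_injective i) h)

lemma verts_grBot : verts (grBot R) = {none} := by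
  have h : (Set.range fun i => gr i (R i).root) = {x | (graft n R).In x none} := by
    ext x
    rw [Set.mem_ofPred_eq, graft_in_root]
    exact ⟨fun ⟨i, h⟩ => ⟨i, h.symm⟩, fun ⟨i, h⟩ => ⟨i, h.symm⟩⟩
  rw [grBot, verts_opMap, h]
  exact used_vertex (T := graft n R) none graft_not_leaf_root

lemma factors_grIncl {χ : S ⟶ graft n R} {i : Fin n} {a : (R i).Edge}
    (h : emap χ S.root = gr i a) : ∃ ψ, ψ ≫ grIncl R i = χ := by
  refine factors (emap_grIncl_injective i) ?_ ?_
  · rintro _ ⟨s, rfl⟩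
    have := above_map χ (above_root s)
    rw [h] at this
    obtain ⟨b, -, hb⟩ := above_gr this
    exact ⟨b, hb.symm⟩
  · intro w hw
    obtain ⟨h1, h2, -⟩ := mem_verts.1 hw
    rw [h] at h2
    obtain ⟨b, -, rfl⟩ := above_gr h2
    rw [verts_grIncl]
    exact ⟨b, fun h => h1 (graft_leaf_gr.2 h), rfl⟩

/-- If an edge in the image of an arrow is strictly above `c`, and `c` is above the image of the
root, then `c` is a vertex of the image or an edge in the image. -/
lemma mem_verts_or_range (χ : S ⟶ T) {c : T.Edge} {s : S.Edge} (hc : ¬ T.Leaf c)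
    (h : T.Above c (emap χ S.root)) (hs : T.Above (emap χ s) c) (hne : emap χ s ≠ c) :
    c ∈ verts χ := by
  refine mem_verts.2 ⟨hc, h, fun l hl hcl => ?_⟩
  rcases comparable_of_map (hs.trans' hcl) with h1 | h1
  · obtain rfl := h1.eq_of_leaf hl
    exact hne (hs.antisymm hcl)
  · exact hne (hs.antisymm (hcl.trans' (above_map χ h1)))

/-- An arrow out of a grafted tree. -/
def graftHom (c : Fin n → T.Edge) (e : T.Edge)
    (h : Function.Injective c ∧ T.IsOp (Set.range c) e) (ψ : ∀ i, R i ⟶ T)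
    (hψ : ∀ i, emap (ψ i) (R i).root = c i) : graft n R ⟶ T :=
  homOfVertices (S := graft n R) (fun x => x.elim e fun p => emap (ψ p.1) p.2) (by
    rintro (_ | ⟨i, d⟩) hd
    · have hr : {x | (graft n R).In x none} = Set.range fun i => gr i (R i).root := by
        ext x
        rw [Set.mem_ofPred_eq, graft_in_root]
        exact ⟨fun ⟨i, h⟩ => ⟨i, h.symm⟩, fun ⟨i, h⟩ => ⟨i, h.symm⟩⟩
      rw [hr]
      constructor
      · rintro _ ⟨i, rfl⟩ _ ⟨j, rfl⟩ hij
        have : c i = c j := by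
          rw [← hψ i, ← hψ j]
          exact hij
        rw [h.1 this]
      · rw [← Set.range_comp]
        have hc : c = fun i => emap (ψ i) (R i).root := funext fun i => (hψ i).symm
        have := h.2
        rw [hc] at this
        exact this
    · have hr : {x | (graft n R).In x (gr i d)} = gr i '' {a | (R i).In a d} := by
        ext x
        rw [Set.mem_ofPred_eq, graft_in_gr]
        exact ⟨fun ⟨a, h, h'⟩ => ⟨a, h, h'.symm⟩, fun ⟨a, h, h'⟩ => ⟨a, h, h'.symm⟩⟩
      obtain ⟨h1, h2⟩ := hom_vertex (ψ i) (fun h => hd (graft_leaf_gr.2 h))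
      change Set.InjOn _ {x | (graft n R).In x (gr i d)} ∧
        T.IsOp (_ '' {x | (graft n R).In x (gr i d)}) _
      rw [hr]
      constructor
      · rintro _ ⟨a, ha, rfl⟩ _ ⟨b, hb, rfl⟩ hab
        rw [h1 ha hb hab]
      · rw [← Set.image_comp]
        exact h2)

lemma grBot_graftHom (c : Fin n → T.Edge) (e : T.Edge) (h) (ψ : ∀ i, R i ⟶ T) (hψ) :
    grBot R ≫ graftHom c e h ψ hψ = opMap T c e h := by
  ext (_ | i)
  · rfl
  · exact hψ i

end Tree

/-- The corolla and the grafted trees are amalgamated with the grafting edges marked. An arrow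
outside their union contains the root vertex together with a vertex whose output is a grafting edge,
and this is a property of its set of vertices alone. -/
theorem exists_graft (hX : IsInnerKan X) {n : ℕ} {R : Fin n → Tree} (f : Cor X n)
    (y : ∀ i, X.obj (op (R i))) (hf : ∀ i, f.input i = X.pull ((R i).edgeMap (R i).root) (y i)) :
    ∃ x : X.obj (op (graft n R)), X.pull (grBot R) x = f ∧ ∀ i, X.pull (grIncl R i) x = y i := by
  -- The corolla and the `i`-th tree meet only in the grafting edge, so an arrow into both is
  -- constant and `hf` suffices.
  have hov : ∀ (S : Tree) (ψ : S ⟶ corolla n) (i : Fin n) (ψ' : S ⟶ R i),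
      ψ ≫ grBot R = ψ' ≫ grIncl R i → X.pull ψ f = X.pull ψ' (y i) := by
    intro S ψ i ψ' h
    have h1 : ∀ s, emap ψ s = some i ∧ emap ψ' s = (R i).root := by
      intro s
      have h2 := congrArg (fun χ => emap χ s) h
      simp only [emap_comp, emap_grIncl] at h2
      rcases hs : emap ψ s with _ | j
      · rw [hs, emap_grBot_none] at h2
        cases h2
      · rw [hs, emap_grBot_some] at h2
        obtain rfl : j = i := congrArg Sigma.fst (Option.some.inj h2)
        exact ⟨rfl, (gr_injective _ h2).symm⟩
    obtain ⟨π, rfl⟩ := factors_edge (fun s => (h1 s).1) (Option.some_ne_none i)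
    obtain rfl : ψ' = π ≫ (R i).edgeMap (R i).root := by
      ext s
      exact (h1 s).2
    rw [pull_comp, pull_comp, ← hf i]
    rfl
  obtain ⟨x, hx⟩ := exists_amalgam hX (T := graft n R) (J := Option (Fin n))
    (D := fun j => j.elim (corolla n) R)
    (fun j => match j with
      | none => grBot R
      | some i => grIncl R i)
    (fun j => match j with
      | none => f
      | some i => y i) (by
    rintro (_ | i) (_ | j) S ψ ψ' h
    · rw [mono_of_injective emap_grBot_injective h]
    · exact hov S ψ j ψ' h
    · exact (hov S ψ' i ψ h.symm).symm
    · have h2 := congrArg (fun χ => emap χ S.root) h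
      obtain rfl : i = j := congrArg Sigma.fst (Option.some.inj h2)
      rw [mono_of_injective (emap_grIncl_injective i) h])
    (fun a => ∃ i, a = gr i (R i).root) (by
    intro S χ hχ
    have hroot : emap χ S.root = none := by
      rcases hr : emap χ S.root with _ | ⟨i, a⟩
      · rfl
      · exact (hχ (some i) (factors_grIncl hr)).elim
    have hab : ∀ a, (graft n R).Above a (emap χ S.root) := by
      intro a
      rw [hroot]
      exact above_root a
    have hbot := fun hE hV => hχ none (factors emap_grBot_injective hE hV)
    rw [verts_grBot] at hbot
    -- Without a vertex at a grafting edge, the subtree could not extend above the corolla.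
    have hexists : ∃ a ∈ verts χ, ∃ i, a = gr i (R i).root := by
      by_contra hcon
      push Not at hcon
      refine hbot ?_ ?_
      · rintro _ ⟨s, rfl⟩
        rcases hs : emap χ s with _ | ⟨i, a⟩
        · exact ⟨none, rfl⟩
        · by_cases ha : a = (R i).root
          · subst ha
            exact ⟨some i, rfl⟩
          · refine (hcon (gr i (R i).root) ?_ i rfl).elim
            refine mem_verts_or_range χ ?_ (hab _) (s := s) ?_ ?_
            · intro h
              exact ha ((above_root a).eq_of_leaf (graft_leaf_gr.1 h))
            · rw [hs]
              exact gr_above_root i a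
            · rw [hs]
              exact fun h => ha (gr_injective i h)
      · intro w hw
        obtain ⟨h1, h2, h3⟩ := mem_verts.1 hw
        rcases w with _ | ⟨i, a⟩
        · rfl
        · refine (hcon (gr i (R i).root) (mem_verts.2 ⟨fun h => ?_, hab _, fun l hl h => ?_⟩) i
            rfl).elim
          · have h4 := (above_root a).eq_of_leaf (graft_leaf_gr.1 h)
            exact h1 (by rw [h4]; exact h)
          · exact h3 l hl ((gr_above_root i a).trans' h)
    refine ⟨hexists, ?_⟩
    rintro _ ha ⟨i, rfl⟩
    refine ⟨by rw [hroot]; exact Option.some_ne_none _, ?_⟩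
    have hnone : none ∈ verts χ := by
      refine mem_verts.2 ⟨graft_not_leaf_root, hab _, fun l hl h => ?_⟩
      exact (mem_verts.1 ha).2.2 l hl ((above_root (T := graft n R) _).trans' h)
    rintro S' χ' hV - (_ | j) ⟨ψ, rfl⟩
    · have := verts_comp_subset ψ (grBot R) (hV ▸ ha : _ ∈ verts (ψ ≫ grBot R))
      have := (Set.ext_iff.1 verts_grBot _).1 this
      cases this
    · have := verts_comp_subset ψ (grIncl R j) (hV ▸ hnone : _ ∈ verts (ψ ≫ grIncl R j))
      obtain ⟨a, -, h⟩ := (Set.ext_iff.1 (verts_grIncl j) _).1 this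
      cases h)
  exact ⟨x, hx none, fun i => hx (some i)⟩

end Dendroidal

/-! ### Two-level trees and the filler for a homotopy of the bottom vertex -/

namespace Dendroidal

open Dendroidal.Tree

variable {X : DendroidalSet.{u}}

lemma pull_edgeMap {S T : Tree} (χ : S ⟶ T) (x : X.obj (op T)) (e : S.Edge) :
    X.pull (S.edgeMap e) (X.pull χ x) = X.pull (T.edgeMap (emap χ e)) x :=
  (pull_comp _ _ _).symm

lemma output_pull {T : Tree} {n : ℕ} (χ : corolla n ⟶ T) (x : X.obj (op T)) :
    Cor.output (X.pull χ x) = X.pull (T.edgeMap (emap χ none)) x :=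
  pull_edgeMap χ x none

lemma input_pull {T : Tree} {n : ℕ} (χ : corolla n ⟶ T) (x : X.obj (op T)) (i : Fin n) :
    Cor.input (X.pull χ x) i = X.pull (T.edgeMap (emap χ (some i))) x :=
  pull_edgeMap χ x (some i)

lemma idCor_pull {T : Tree} (x : X.obj (op T)) (e : T.Edge) (χ : corolla 1 ⟶ T)
    (h : ∀ s, emap χ s = e) : X.pull χ x = idCor (X.pull (T.edgeMap e) x) := by
  rw [idCor, ← pull_comp]
  congr 1
  ext s
  exact h s

namespace Tree

variable {n : ℕ} {k : Fin n → ℕ}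

/-- The tree with two levels of vertices: corollas grafted onto a corolla. -/
abbrev twoLevel (n : ℕ) (k : Fin n → ℕ) : Tree := graft n fun i => corolla (k i)

/-- The tree `twoLevel n k` grafted onto a unary vertex. -/
abbrev stem (n : ℕ) (k : Fin n → ℕ) : Tree := graft 1 fun _ => twoLevel n k

abbrev stemEdge (a : (twoLevel n k).Edge) : (stem n k).Edge :=
  gr (R := fun _ : Fin 1 => twoLevel n k) 0 a

abbrev midEdge (i : Fin n) : (twoLevel n k).Edge := gr (R := fun i => corolla (k i)) i none

lemma stemEdge_injective : Function.Injective (stemEdge (k := k)) :=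
  gr_injective (R := fun _ : Fin 1 => twoLevel n k) 0

lemma stem_isOp : (stem n k).IsOp (Set.range fun i => stemEdge (k := k) (midEdge i)) none := by
  have h := IsOp.two (T := stem n k) (d := none) graft_not_leaf_root (by
    intro x hx
    obtain ⟨i, rfl⟩ := graft_in_root.1 hx
    exact fun h => graft_not_leaf_root (graft_leaf_gr.1 h))
  convert h using 1
  ext y
  constructor
  · rintro ⟨i, rfl⟩
    exact ⟨stemEdge none, graft_in_root.2 ⟨0, rfl⟩, graft_in_gr.2 ⟨_, graft_in_root.2 ⟨i, rfl⟩, rfl⟩⟩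
  · rintro ⟨x, hx, hy⟩
    obtain ⟨j, rfl⟩ := graft_in_root.1 hx
    obtain rfl := Subsingleton.elim j 0
    obtain ⟨a, ha, rfl⟩ := graft_in_gr.1 hy
    obtain ⟨i, rfl⟩ := graft_in_root.1 ha
    exact ⟨i, rfl⟩

lemma stemEdge_midEdge_injective :
    Function.Injective fun i => stemEdge (k := k) (midEdge i) := fun _ _ h =>
  gr_root_injective (R := fun i => corolla (k i)) (stemEdge_injective h)

/-- The inner face of `stem n k` which contracts the output edge of the vertex in the middle. -/
def stemContract (n : ℕ) (k : Fin n → ℕ) : twoLevel n k ⟶ stem n k :=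
  graftHom (fun i => stemEdge (midEdge i)) none ⟨stemEdge_midEdge_injective, stem_isOp⟩
    (fun i => grIncl (fun i => corolla (k i)) i ≫ grIncl (fun _ : Fin 1 => twoLevel n k) 0)
    fun _ => rfl

@[simp] lemma emap_stemContract_none : emap (stemContract n k) none = none := rfl

@[simp] lemma emap_stemContract_gr (i : Fin n) (a : (corolla (k i)).Edge) :
    emap (stemContract n k) (some ⟨i, a⟩) =
      stemEdge (gr (R := fun i => corolla (k i)) i a) := rfl

/-- The inclusion of the two lower vertices into `stem n k`. -/
def stemLower (n : ℕ) (k : Fin n → ℕ) : extRoot n ⟶ stem n k :=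
  homOfIn (fun x => match x with
    | none => none
    | some none => stemEdge none
    | some (some i) => stemEdge (midEdge i)) (by
    rintro (_ | _ | i) (_ | _ | j) h
    · rfl
    · cases h
    · cases h
    · cases h
    · rfl
    · cases stemEdge_injective h
    · cases h
    · cases stemEdge_injective h
    · rw [stemEdge_midEdge_injective h]) (by
    rintro (_ | _ | i) hd
    · refine ⟨graft_not_leaf_root, fun y => ?_⟩
      refine graft_in_root.trans ?_
      constructor
      · rintro ⟨j, rfl⟩
        obtain rfl := Subsingleton.elim j 0
        exact ⟨some none, Or.inr ⟨rfl, rfl⟩, rfl⟩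
      · rintro ⟨x, (⟨-, h⟩ | ⟨rfl, -⟩), rfl⟩
        · cases h
        · exact ⟨0, rfl⟩
    · refine ⟨fun h => graft_not_leaf_root (graft_leaf_gr.1 h), fun y => ?_⟩
      refine graft_in_gr.trans ?_
      constructor
      · rintro ⟨a, ha, rfl⟩
        obtain ⟨i, rfl⟩ := graft_in_root.1 ha
        exact ⟨some (some i), Or.inl ⟨⟨i, rfl⟩, rfl⟩, rfl⟩
      · rintro ⟨x, (⟨⟨i, rfl⟩, -⟩ | ⟨-, h⟩), rfl⟩
        · exact ⟨_, graft_in_root.2 ⟨i, rfl⟩, rfl⟩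
        · cases h
    · exact (hd ⟨i, rfl⟩).elim)

abbrev stemUpper (n : ℕ) (k : Fin n → ℕ) : twoLevel n k ⟶ stem n k :=
  grIncl (fun _ : Fin 1 => twoLevel n k) 0

lemma stemContract_injective : Function.Injective (emap (stemContract n k)) := by
  rintro (_ | ⟨i, a⟩) (_ | ⟨j, b⟩) h
  · rfl
  · rw [emap_stemContract_none, emap_stemContract_gr] at h
    cases h
  · rw [emap_stemContract_none, emap_stemContract_gr] at h
    cases h
  · rw [emap_stemContract_gr, emap_stemContract_gr] at h
    exact stemEdge_injective h

lemma emap_stemContract_ne (a : (twoLevel n k).Edge) :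
    emap (stemContract n k) a ≠ stemEdge none := by
  rcases a with _ | ⟨i, a⟩ <;> intro h
  · rw [emap_stemContract_none] at h
    cases h
  · rw [emap_stemContract_gr] at h
    cases stemEdge_injective h

@[simp] lemma emap_stemLower_none : emap (stemLower n k) none = none := rfl

@[simp] lemma emap_stemLower_some_none : emap (stemLower n k) (some none) = stemEdge none := rfl

@[simp] lemma emap_stemLower_some_some (i : Fin n) :
    emap (stemLower n k) (some (some i)) = stemEdge (midEdge i) := rfl

lemma stemLower_injective : Function.Injective (emap (stemLower n k)) := by
  rintro (_ | _ | i) (_ | _ | j) h <;>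
    simp only [emap_stemLower_none, emap_stemLower_some_none, emap_stemLower_some_some] at h
  · rfl
  · cases h
  · cases h
  · cases h
  · rfl
  · cases stemEdge_injective h
  · cases h
  · cases stemEdge_injective h
  · rw [stemEdge_midEdge_injective h]

abbrev extRootTop (n : ℕ) : corolla n ⟶ extRoot n :=
  opMap (extRoot n) (fun k => some (some k)) (some none) ⟨someSome_injective n, extRoot_top n⟩

abbrev extRootInner (n : ℕ) : corolla n ⟶ extRoot n :=
  opMap (extRoot n) (fun k => some (some k)) none ⟨someSome_injective n, extRoot_inner n⟩

abbrev extRootBottom (n : ℕ) : corolla 1 ⟶ extRoot n :=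
  opMap (extRoot n) (fun _ : Fin 1 => some none) none
    ⟨Function.injective_of_subsingleton _, extRoot_bottom n⟩

lemma factors_extRootTop {S : Tree} (ψ : S ⟶ extRoot n) (h : ∀ s, emap ψ s ≠ none) :
    ∃ ω, ω ≫ extRootTop n = ψ := by
  refine factors (opMap_injective _ (by rintro ⟨i, h⟩; cases h)) ?_ ?_
  · rw [range_opMap]
    rintro _ ⟨s, rfl⟩
    rcases hs : emap ψ s with _ | _ | i
    · exact (h s hs).elim
    · exact Or.inl rfl
    · exact Or.inr ⟨i, rfl⟩
  · rintro w hw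
    obtain ⟨h1, h2, -⟩ := mem_verts.1 hw
    rw [verts_opMap]
    rcases w with _ | _ | i
    · exact (h _ (eq_root_of_above (T := extRoot n) h2)).elim
    · refine ⟨h1, Above.refl _, ?_⟩
      rintro _ ⟨i, rfl⟩
      exact not_above_leaf h1 ⟨i, rfl⟩
    · exact (h1 ⟨i, rfl⟩).elim

lemma factors_extRootInner {S : Tree} (ψ : S ⟶ extRoot n) (h : ∀ s, emap ψ s ≠ some none) :
    ∃ ω, ω ≫ extRootInner n = ψ := by
  refine factors (opMap_injective _ (by rintro ⟨i, h⟩; cases h)) ?_ ?_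
  · rw [range_opMap]
    rintro _ ⟨s, rfl⟩
    rcases hs : emap ψ s with _ | _ | i
    · exact Or.inl rfl
    · exact (h s hs).elim
    · exact Or.inr ⟨i, rfl⟩
  · rintro w hw
    obtain ⟨h1, -, -⟩ := mem_verts.1 hw
    rw [verts_opMap]
    refine ⟨h1, above_root (T := extRoot n) w, ?_⟩
    rintro _ ⟨i, rfl⟩
    exact not_above_leaf h1 ⟨i, rfl⟩

end Tree

/-- Two dendrices of shape `twoLevel n k` with the same top vertices and homotopic bottom
vertices are the two inner faces of a dendrex of shape `stem n k`. -/
lemma exists_stem (hX : IsInnerKan X) {n : ℕ} {k : Fin n → ℕ} (x y : X.obj (op (twoLevel n k)))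
    (H : X.obj (op (extRoot n)))
    (htop : ∀ i, X.pull (grIncl (fun i => corolla (k i)) i) x =
      X.pull (grIncl (fun i => corolla (k i)) i) y)
    (hx : X.pull (extRootTop n) H = X.pull (grBot _) x)
    (hy : X.pull (extRootInner n) H = X.pull (grBot _) y) :
    ∃ z : X.obj (op (stem n k)), X.pull (stemUpper n k) z = x ∧ X.pull (stemContract n k) z = y ∧
      X.pull (stemLower n k) z = H := by
  -- The upper and lower faces meet in the middle vertex, the contraction and the lower face in the
  -- composite of the two lower vertices, and the upper face and the contraction in the top
  -- corollas. The hypotheses `hx`, `hy` and `htop` are agreement on these three intersections.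
  have ov13 : ∀ (S : Tree) (ψ : S ⟶ twoLevel n k) (ψ' : S ⟶ extRoot n),
      ψ ≫ stemUpper n k = ψ' ≫ stemLower n k → X.pull ψ x = X.pull ψ' H := by
    intro S ψ ψ' h
    obtain ⟨ω, rfl⟩ := factors_extRootTop ψ' (by
      intro s hs
      have := congrArg (fun χ => emap χ s) h
      simp only [emap_comp, hs] at this
      cases this)
    have h1 : extRootTop n ≫ stemLower n k = grBot _ ≫ stemUpper n k := by
      ext (_ | i) <;> rfl
    rw [Category.assoc, h1, ← Category.assoc] at h
    rw [mono_of_injective (emap_grIncl_injective _) h, pull_comp, pull_comp, hx]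
  have ov23 : ∀ (S : Tree) (ψ : S ⟶ twoLevel n k) (ψ' : S ⟶ extRoot n),
      ψ ≫ stemContract n k = ψ' ≫ stemLower n k → X.pull ψ y = X.pull ψ' H := by
    intro S ψ ψ' h
    obtain ⟨ω, rfl⟩ := factors_extRootInner ψ' (by
      intro s hs
      have := congrArg (fun χ => emap χ s) h
      simp only [emap_comp, hs] at this
      exact emap_stemContract_ne _ this)
    have h1 : extRootInner n ≫ stemLower n k = grBot _ ≫ stemContract n k := by
      ext (_ | i) <;> rfl
    rw [Category.assoc, h1, ← Category.assoc] at h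
    rw [mono_of_injective stemContract_injective h, pull_comp, pull_comp, hy]
  have ov12 : ∀ (S : Tree) (ψ : S ⟶ twoLevel n k) (ψ' : S ⟶ twoLevel n k),
      ψ ≫ stemUpper n k = ψ' ≫ stemContract n k → X.pull ψ x = X.pull ψ' y := by
    intro S ψ ψ' h
    rcases hr : emap ψ S.root with _ | ⟨i, a⟩
    · have := congrArg (fun χ => emap χ S.root) h
      simp only [emap_comp, hr] at this
      exact (emap_stemContract_ne _ this.symm).elim
    · obtain ⟨ω, rfl⟩ := factors_grIncl hr
      have h2 : ω ≫ grIncl (fun i => corolla (k i)) i = ψ' :=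
        mono_of_injective stemContract_injective h
      rw [← h2, pull_comp, pull_comp, htop]
  obtain ⟨z, hz⟩ := exists_amalgam hX (T := stem n k) (J := Option Bool)
    (D := fun j => j.elim (extRoot n) fun _ => twoLevel n k)
    (fun j => match j with
      | none => stemLower n k
      | some true => stemUpper n k
      | some false => stemContract n k)
    (fun j => match j with
      | none => H
      | some true => x
      | some false => y) (by
    rintro (_ | _ | _) (_ | _ | _) S ψ ψ' h
    · rw [mono_of_injective stemLower_injective h]
    · exact (ov23 S ψ' ψ h.symm).symm
    · exact (ov13 S ψ' ψ h.symm).symm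
    · exact ov23 S ψ ψ' h
    · rw [mono_of_injective stemContract_injective h]
    · exact (ov12 S ψ' ψ h.symm).symm
    · exact ov13 S ψ ψ' h
    · exact ov12 S ψ ψ' h
    · rw [mono_of_injective (emap_grIncl_injective _) h])
    (fun a => ∃ i, a = stemEdge (midEdge i)) (by
    intro S χ hχ
    have hleaf : ∀ {T : Tree} {φ : T ⟶ stem n k} {w : (stem n k).Edge} {l : T.Edge}, T.Leaf l →
        (stem n k).Above w (emap φ l) → w ∉ verts φ := fun hl h hw => (mem_verts.1 hw).2.2 _ hl h
    have hroot : emap χ S.root = none := by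
      rcases hr : emap χ S.root with _ | ⟨i, a⟩
      · rfl
      · obtain rfl := Subsingleton.elim i 0
        exact (hχ (some true) (factors_grIncl hr)).elim
    have hab : ∀ a, (stem n k).Above a (emap χ S.root) := by
      intro a
      rw [hroot]
      exact above_root a
    -- An arrow that avoids this edge factors through the contraction.
    have hmid : stemEdge none ∈ Set.range (emap χ) := by
      by_contra hcon
      refine hχ (some false) (factors stemContract_injective ?_ ?_)
      · rintro _ ⟨s, rfl⟩
        rcases hs : emap χ s with _ | ⟨i, _ | ⟨j, b⟩⟩
        · exact ⟨none, rfl⟩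
        · obtain rfl := Subsingleton.elim i 0
          exact (hcon ⟨s, hs⟩).elim
        · obtain rfl := Subsingleton.elim i 0
          exact ⟨some ⟨j, b⟩, rfl⟩
      · intro w hw
        refine mem_verts.2 ⟨(mem_verts.1 hw).1, above_root w, ?_⟩
        rintro (_ | ⟨i, a⟩) hl
        · exact (graft_not_leaf_root hl).elim
        · exact not_above_leaf (mem_verts.1 hw).1
            (graft_leaf_gr.2 (graft_leaf_gr.2 (graft_leaf_gr.1 hl)))
    have hnone : none ∈ verts χ := by
      obtain ⟨s, hs⟩ := hmid
      refine mem_verts.2 ⟨graft_not_leaf_root, hab _, fun l hl h => ?_⟩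
      have h1 := eq_root_of_above (T := stem n k) h
      have h2 : (stem n k).Above (emap χ s) (emap χ l) := by
        rw [h1]
        exact above_root (T := stem n k) _
      rcases comparable_of_map h2 with h3 | h3
      · obtain rfl := h3.eq_of_leaf hl
        rw [hs] at h1
        cases h1
      · have := above_map χ h3
        rw [h1, hs] at this
        exact not_above_gr_none this
    -- The marked edges are the outputs of the top vertices: if no such vertex is used, the subtree
    -- is contained in the lower face.
    refine ⟨?_, ?_⟩
    · by_contra hcon
      push Not at hcon
      refine hχ none (factors stemLower_injective ?_ ?_)
      · rintro _ ⟨s, rfl⟩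
        rcases hs : emap χ s with _ | ⟨i, _ | ⟨j, _ | b⟩⟩
        · exact ⟨none, rfl⟩
        · obtain rfl := Subsingleton.elim i 0
          exact ⟨some none, rfl⟩
        · obtain rfl := Subsingleton.elim i 0
          exact ⟨some (some j), rfl⟩
        · obtain rfl := Subsingleton.elim i 0
          refine (hcon (stemEdge (midEdge j)) ?_ j rfl).elim
          refine mem_verts_or_range χ ?_ (hab _) (s := s) ?_ ?_
          · exact fun h => graft_leaf_gr.1 (graft_leaf_gr.1 h) rfl
          · rw [hs]
            exact above_map (stemUpper n k) (gr_above_root (R := fun i => corolla (k i)) j (some b))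
          · rw [hs]
            intro h
            cases gr_injective j (stemEdge_injective h)
      · intro w hw
        have hwl := (mem_verts.1 hw).1
        refine mem_verts.2 ⟨hwl, above_root w, ?_⟩
        rintro (_ | _ | l) hl h
        · obtain ⟨l, hl⟩ := hl
          cases hl
        · obtain ⟨l, hl⟩ := hl
          cases hl
        · change (stem n k).Above w (stemEdge (midEdge l)) at h
          obtain ⟨a, ha, rfl⟩ := above_gr h
          obtain ⟨b, hb, rfl⟩ := above_gr ha
          rcases b with _ | b
          · exact hcon _ hw l rfl
          · exact hwl (graft_leaf_gr.2 (graft_leaf_gr.2 (Option.some_ne_none b)))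
    -- Let `χ'` have the same vertices. The vertex `midEdge i` excludes the lower face and the root
    -- vertex excludes the upper one. The edge `stemEdge none` differs from the marked edge, so `hE`
    -- keeps it in the image and excludes the contraction.
    · rintro _ ha ⟨i, rfl⟩
      refine ⟨by rw [hroot]; exact Option.some_ne_none _, ?_⟩
      rintro S' χ' hV hE (_ | _ | _) hf
      · obtain ⟨ψ, rfl⟩ : ∃ ψ : S' ⟶ extRoot n, ψ ≫ stemLower n k = χ' := hf
        have := verts_comp_subset ψ (stemLower n k) (hV ▸ ha : _ ∈ verts (ψ ≫ stemLower n k))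
        exact hleaf (φ := stemLower n k) (l := some (some i)) ⟨i, rfl⟩ (Above.refl _) this
      · obtain ⟨ψ, rfl⟩ : ∃ ψ : S' ⟶ twoLevel n k, ψ ≫ stemContract n k = χ' := hf
        rcases hE hmid with h | ⟨s, hs⟩
        · cases stemEdge_injective h
        · exact emap_stemContract_ne _ hs
      · obtain ⟨ψ, rfl⟩ : ∃ ψ : S' ⟶ twoLevel n k, ψ ≫ stemUpper n k = χ' := hf
        have := verts_comp_subset ψ (stemUpper n k) (hV ▸ hnone : _ ∈ verts (ψ ≫ stemUpper n k))
        obtain ⟨a, -, h⟩ := (Set.ext_iff.1 (verts_grIncl _) _).1 this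
        cases h)
  exact ⟨z, hz (some true), hz (some false), hz none⟩

end Dendroidal

/-! ### Homotopy along the root: equivalence relation and compatibility with composition -/

namespace Dendroidal

open Dendroidal.Tree

variable {X : DendroidalSet.{u}}

namespace Tree

variable {T : Tree} {n : ℕ} {k : Fin n → ℕ}

/-- An arrow out of a corolla grafted onto a unary vertex. -/
def extRootHom (c : Fin n → T.Edge) (e e' : T.Edge)
    (h : Function.Injective c ∧ T.IsOp (Set.range c) e) (h' : T.IsOp {e} e') : extRoot n ⟶ T :=
  homOfVertices (S := extRoot n) (fun x => match x with
    | none => e'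
    | some none => e
    | some (some i) => c i) (by
    rintro (_ | _ | i) hd
    · have hr : {x | (extRoot n).In x none} = {some none} := by
        ext x
        simp
      rw [hr]
      exact ⟨Set.injOn_singleton _ _, by simpa using h'⟩
    · have hr : {x | (extRoot n).In x (some none)} = Set.range fun i => some (some i) := by
        ext x
        simp [eq_comm]
      rw [hr, ← Set.range_comp]
      refine ⟨?_, h.2⟩
      rintro _ ⟨i, rfl⟩ _ ⟨j, rfl⟩ hij
      rw [h.1 hij]
    · exact (hd ⟨i, rfl⟩).elim)

@[simp] lemma emap_extRootHom_some_some (c : Fin n → T.Edge) (e e' : T.Edge) (h) (h') (i : Fin n) :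
    emap (extRootHom c e e' h h') (some (some i)) = c i := rfl

lemma extRootTop_extRootHom (c : Fin n → T.Edge) (e e' : T.Edge) (h) (h') :
    extRootTop n ≫ extRootHom c e e' h h' = opMap T c e h := by
  ext (_ | i) <;> rfl

lemma opMap_some_none : opMap (corolla n) some none (corollaOp n).down = 𝟙 _ := by
  ext (_ | i) <;> rfl

/-- The root vertex of `twoLevel n k`. -/
def twoBot (n : ℕ) (k : Fin n → ℕ) : corolla n ⟶ twoLevel n k := grBot fun i => corolla (k i)

/-- The `i`-th top vertex of `twoLevel n k`. -/
def twoTop (n : ℕ) (k : Fin n → ℕ) (i : Fin n) : corolla (k i) ⟶ twoLevel n k :=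
  grIncl (fun i => corolla (k i)) i

/-- The arrow out of `twoLevel n k` given by a list of composable operations. -/
def twoLevelHom {c : Fin n → T.Edge} {e : T.Edge}
    (h : Function.Injective c ∧ T.IsOp (Set.range c) e) {b : ∀ i, Fin (k i) → T.Edge}
    (hb : ∀ i, Function.Injective (b i) ∧ T.IsOp (Set.range (b i)) (c i)) : twoLevel n k ⟶ T :=
  graftHom c e h (fun i => opMap T (b i) (c i) (hb i)) fun _ => rfl

variable {c : Fin n → T.Edge} {e : T.Edge}
    (h : Function.Injective c ∧ T.IsOp (Set.range c) e) {b : ∀ i, Fin (k i) → T.Edge}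
    (hb : ∀ i, Function.Injective (b i) ∧ T.IsOp (Set.range (b i)) (c i))

lemma twoBot_twoLevelHom : twoBot n k ≫ twoLevelHom h hb = opMap T c e h :=
  grBot_graftHom _ _ _ _ _

lemma twoTop_twoLevelHom (i : Fin n) :
    twoTop n k i ≫ twoLevelHom h hb = opMap T (b i) (c i) (hb i) := rfl

lemma twoLevel_isOp {N : ℕ} {c : Fin N → (twoLevel n k).Edge}
    (hc : ∀ y, y ∈ Set.range c ↔ ∃ i j, y = gr (R := fun i => corolla (k i)) i (some j)) :
    (twoLevel n k).IsOp (Set.range c) none := by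
  have h := leaves_isOp (T := twoLevel n k)
  convert h using 1
  ext y
  rw [hc]
  constructor
  · rintro ⟨i, j, rfl⟩
    exact graft_leaf_gr.2 (Option.some_ne_none j)
  · rintro ⟨i, _ | j, h, rfl⟩
    · exact (h rfl).elim
    · exact ⟨i, j, rfl⟩

/-- The list of leaves of `twoLevel n k`. -/
def leafInputs (n : ℕ) (k : Fin n → ℕ) (a : Fin (∑ i, k i)) : (twoLevel n k).Edge :=
  gr (R := fun i => corolla (k i)) (finSigmaFinEquiv.symm a).1 (some (finSigmaFinEquiv.symm a).2)

lemma leafInputs_op :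
    Function.Injective (leafInputs n k) ∧ (twoLevel n k).IsOp (Set.range (leafInputs n k)) none := by
  constructor
  · intro a b h
    have h1 := Option.some.inj h
    have h2 : finSigmaFinEquiv.symm a = finSigmaFinEquiv.symm b := by
      generalize finSigmaFinEquiv.symm a = p at h1
      generalize finSigmaFinEquiv.symm b = q at h1
      obtain ⟨i, x⟩ := p
      obtain ⟨j, y⟩ := q
      cases h1
      rfl
    exact finSigmaFinEquiv.symm.injective h2
  · refine twoLevel_isOp fun y => ?_
    constructor
    · rintro ⟨a, rfl⟩
      exact ⟨_, _, rfl⟩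
    · rintro ⟨i, j, rfl⟩
      refine ⟨finSigmaFinEquiv ⟨i, j⟩, ?_⟩
      rw [leafInputs, Equiv.symm_apply_apply]

/-- The operation of `twoLevel n k` whose inputs are all the leaves. -/
abbrev leafMap (n : ℕ) (k : Fin n → ℕ) : corolla (∑ i, k i) ⟶ twoLevel n k :=
  opMap (twoLevel n k) (leafInputs n k) none leafInputs_op

lemma leafInputs_one :
    (Function.Injective fun j : Fin n => gr (R := fun _ : Fin n => corolla 1) j (some 0)) ∧
      (twoLevel n fun _ => 1).IsOp
        (Set.range fun j : Fin n => gr (R := fun _ : Fin n => corolla 1) j (some 0)) none := by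
  constructor
  · intro i j h
    cases h
    rfl
  · refine twoLevel_isOp fun y => ?_
    constructor
    · rintro ⟨a, rfl⟩
      exact ⟨_, _, rfl⟩
    · rintro ⟨i, j, rfl⟩
      obtain rfl := Subsingleton.elim j 0
      exact ⟨i, rfl⟩

/-- The operation of `twoLevel n 1` whose inputs are all the leaves. -/
abbrev unaryMap (n : ℕ) : corolla n ⟶ twoLevel n fun _ => 1 :=
  opMap (twoLevel n fun _ => 1) (fun j => gr (R := fun _ : Fin n => corolla 1) j (some 0)) none
    leafInputs_one

/-- The degeneracy which forgets the unary vertices. -/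
abbrev unaryDegen (n : ℕ) : twoLevel n (fun _ => 1) ⟶ corolla n :=
  twoLevelHom (T := corolla n) (c := some) (e := none) (b := fun j _ => some j) (corollaOp n).down
    fun j => ⟨Function.injective_of_subsingleton _, by rw [Set.range_const]; exact IsOp.unit _⟩

end Tree

lemma HomotopicRoot.refl {n : ℕ} (f : Cor X n) : HomotopicRoot f f := by
  refine ⟨X.pull (extRootHom (T := corolla n) some none none (corollaOp n).down (IsOp.unit _)) f,
    ?_, ?_, ?_⟩
  · rw [← pull_comp, extRootTop_extRootHom, opMap_some_none, pull_id]
  · rw [← pull_comp]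
    refine Eq.trans ?_ (pull_id f)
    congr 1
    ext (_ | i) <;> rfl
  · rw [← pull_comp]
    exact idCor_pull f none _ (by rintro (_ | i) <;> rfl)

lemma idCor_output (x : Vert X) : (idCor x).output = x := by
  refine (pull_comp _ _ _).symm.trans (Eq.trans ?_ (pull_id x))
  congr 1

lemma idCor_input (x : Vert X) (i : Fin 1) : (idCor x).input i = x := by
  refine (pull_comp _ _ _).symm.trans (Eq.trans ?_ (pull_id x))
  congr 1

lemma HomotopicRoot.output_eq {n : ℕ} {f g : Cor X n} (h : HomotopicRoot f g) :
    f.output = g.output := by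
  obtain ⟨H, rfl, rfl, h⟩ := h
  have := congrArg (fun a => Cor.output a) h
  rw [output_pull] at this
  refine Eq.trans ?_ (this.symm.trans (output_pull (extRootInner n) H).symm)
  rw [idCor_output]

/-- Homotopic bottom vertices have homotopic composites. -/
lemma homotopicRoot_of_bot (hX : IsInnerKan X) {n : ℕ} {k : Fin n → ℕ}
    {x y : X.obj (op (twoLevel n k))}
    (htop : ∀ i, X.pull (twoTop n k i) x =
      X.pull (twoTop n k i) y)
    (hbot : HomotopicRoot (X.pull (twoBot n k) x) (X.pull (twoBot n k) y)) {N : ℕ}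
    {c : Fin N → (twoLevel n k).Edge}
    (h : Function.Injective c ∧ (twoLevel n k).IsOp (Set.range c) none) (hc : ∀ a, c a ≠ none) :
    HomotopicRoot (X.pull (opMap (twoLevel n k) c none h) x)
      (X.pull (opMap (twoLevel n k) c none h) y) := by
  obtain ⟨H, h1, h2, h3⟩ := hbot
  obtain ⟨z, rfl, rfl, rfl⟩ := exists_stem hX x y H htop h1 h2
  have hunit : (stem n k).IsOp {stemEdge none} none := by
    have := (hom_op (stemLower n k) ⟨Function.injective_of_subsingleton _, extRoot_bottom n⟩).2
    rw [Set.range_const] at this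
    exact this
  have hcop : (Function.Injective fun a => stemEdge (c a)) ∧
      (stem n k).IsOp (Set.range fun a => stemEdge (c a)) (stemEdge none) :=
    hom_op (stemUpper n k) h
  -- In the stem, the upper vertices compose to an operation with output `stemEdge none`; together
  -- with the unary root vertex, which is an identity, it forms a root homotopy between the two
  -- composites.
  refine ⟨X.pull (extRootHom (fun a => stemEdge (c a)) (stemEdge none) none hcop hunit) z,
    ?_, ?_, ?_⟩
  · rw [← pull_comp, ← pull_comp]
    congr 1
    ext (_ | i) <;> rfl
  · rw [← pull_comp, ← pull_comp]
    congr 1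
    ext (_ | i) : 1
    · rfl
    · rw [emap_comp, emap_comp, emap_opMap_some, emap_opMap_some, emap_extRootHom_some_some]
      rcases hi : c i with _ | ⟨j, b⟩
      · exact (hc i hi).elim
      · rfl
  · rw [output_pull, pull_edgeMap]
    rw [output_pull, pull_edgeMap] at h3
    refine Eq.trans ?_ h3
    rw [← pull_comp, ← pull_comp]
    congr 1
    ext (_ | i) <;> rfl

/-- Composing `f` with identities gives `f` up to homotopy, whatever composite is chosen: compare
`x` with the degenerate dendrex on `f`, which has the same vertices and composite `f`. -/
lemma pull_unaryMap_homotopic (hX : IsInnerKan X) {n : ℕ} {f : Cor X n}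
    {x : X.obj (op (twoLevel n fun _ => 1))} (hbot : X.pull (twoBot n fun _ => 1) x = f)
    (htop : ∀ i, X.pull (twoTop n (fun _ => 1) i) x = idCor (f.input i)) :
    HomotopicRoot (X.pull (unaryMap n) x) f ∧ HomotopicRoot f (X.pull (unaryMap n) x) := by
  have h1 : X.pull (unaryMap n) (X.pull (unaryDegen n) f) = f := by
    rw [← pull_comp]
    refine Eq.trans ?_ (pull_id f)
    congr 1
    ext (_ | i) <;> rfl
  have h2 : X.pull (twoBot n fun _ => 1) (X.pull (unaryDegen n) f) = f := by
    rw [← pull_comp, twoBot_twoLevelHom, opMap_some_none, pull_id]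
  have h3 : ∀ i, X.pull (twoTop n (fun _ => 1) i) (X.pull (unaryDegen n) f) =
      idCor (f.input i) := by
    intro i
    rw [← pull_comp, twoTop_twoLevelHom]
    exact idCor_pull f (some i) _ (by rintro (_ | i) <;> rfl)
  constructor
  · have := homotopicRoot_of_bot hX (x := x) (y := X.pull (unaryDegen n) f)
      (fun i => (htop i).trans (h3 i).symm) (by rw [hbot, h2]; exact .refl f) leafInputs_one
      (fun _ => Option.some_ne_none _)
    rwa [h1] at this
  · have := homotopicRoot_of_bot hX (y := x) (x := X.pull (unaryDegen n) f)
      (fun i => (h3 i).trans (htop i).symm) (by rw [hbot, h2]; exact .refl f) leafInputs_one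
      (fun _ => Option.some_ne_none _)
    rwa [h1] at this

/-- Insert identities at the inputs other than `i`. The leaf homotopy becomes a composite of `f`
with identities on all inputs whose value is `g`. -/
lemma HomotopicLeaf.homotopicRoot (hX : IsInnerKan X) {n : ℕ} {i : Fin n} {f g : Cor X n}
    (h : HomotopicLeaf i f g) : HomotopicRoot f g := by
  obtain ⟨H, h1, h2, h3⟩ := h
  have hop : ∀ j, (extLeaf n i).IsOp (Set.range fun _ : Fin 1 => extLeafInputs n i j)
      (some (some j)) := by
    intro j
    by_cases hj : j = i
    · subst hj
      have := extLeaf_top n j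
      simpa [extLeafInputs] using this
    · simpa [extLeafInputs, hj] using IsOp.unit (T := extLeaf n i) (some (some j))
  let A : twoLevel n (fun _ => 1) ⟶ extLeaf n i :=
    twoLevelHom (T := extLeaf n i) (c := fun j => some (some j)) (e := some none)
      (b := fun j _ => extLeafInputs n i j) ⟨someSome_injective n, extLeaf_bottom n i⟩
      fun j => ⟨Function.injective_of_subsingleton _, hop j⟩
  have := (pull_unaryMap_homotopic hX (f := f) (x := X.pull A H) (by
    rw [← pull_comp, twoBot_twoLevelHom, h1]) (by
    intro j
    rw [← pull_comp, twoTop_twoLevelHom]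
    by_cases hj : j = i
    · subst hj
      rw [← h3]
      congr 1
      ext (_ | a)
      · rfl
      · simp [extLeafInputs]
    · rw [← h1, input_pull]
      refine idCor_pull H _ _ ?_
      rintro (_ | a)
      · rfl
      · simp [extLeafInputs, hj])).2
  convert this using 1
  rw [← h2, ← pull_comp]
  congr 1
  ext (_ | i) <;> rfl

/-- Each homotopy exhibits its end as a composite of an identity with `f`. The two composites have
the same vertices, hence are homotopic. With reflexivity, this yields symmetry and transitivity. -/
lemma HomotopicRoot.euclidean (hX : IsInnerKan X) {n : ℕ} {f g h : Cor X n}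
    (hg : HomotopicRoot f g) (hh : HomotopicRoot f h) : HomotopicRoot g h := by
  obtain ⟨H, h1, h2, h3⟩ := hg
  obtain ⟨K, k1, k2, k3⟩ := hh
  let A : twoLevel 1 (fun _ => n) ⟶ extRoot n :=
    twoLevelHom (T := extRoot n) (c := fun _ => some none) (e := none)
      (b := fun _ j => some (some j))
      ⟨Function.injective_of_subsingleton _, extRoot_bottom n⟩
      fun _ => ⟨someSome_injective n, extRoot_top n⟩
  have hop : (Function.Injective fun j : Fin n => gr (R := fun _ : Fin 1 => corolla n) 0 (some j)) ∧
      (twoLevel 1 fun _ => n).IsOp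
        (Set.range fun j : Fin n => gr (R := fun _ : Fin 1 => corolla n) 0 (some j)) none := by
    constructor
    · intro i j h
      exact Option.some.inj (gr_injective _ h)
    · refine twoLevel_isOp fun y => ?_
      constructor
      · rintro ⟨a, rfl⟩
        exact ⟨_, _, rfl⟩
      · rintro ⟨i, j, rfl⟩
        obtain rfl := Subsingleton.elim i 0
        exact ⟨j, rfl⟩
  have hA : opMap (twoLevel 1 fun _ => n) _ none hop ≫ A = extRootInner n := by
    ext (_ | i) <;> rfl
  have := homotopicRoot_of_bot hX (x := X.pull A H) (y := X.pull A K) (by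
    intro i
    rw [← pull_comp, ← pull_comp, twoTop_twoLevelHom, h1, k1]) (by
    rw [← pull_comp, ← pull_comp, twoBot_twoLevelHom, h3, k3]
    exact .refl _) hop (fun _ => Option.some_ne_none _)
  rw [← pull_comp, ← pull_comp, hA, h2, k2] at this
  exact this

lemma HomotopicRoot.symm (hX : IsInnerKan X) {n : ℕ} {f g : Cor X n}
    (h : HomotopicRoot f g) : HomotopicRoot g f :=
  h.euclidean hX (.refl f)

lemma HomotopicRoot.trans (hX : IsInnerKan X) {n : ℕ} {f g h : Cor X n}
    (hg : HomotopicRoot f g) (hh : HomotopicRoot g h) : HomotopicRoot f h :=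
  (hg.symm hX).euclidean hX hh

lemma Homotopic.homotopicRoot (hX : IsInnerKan X) {n : ℕ} {f g : Cor X n}
    (h : Homotopic f g) : HomotopicRoot f g := by
  rcases h with h | ⟨i, h⟩
  · exact h
  · exact h.homotopicRoot hX

lemma HomotopicRoot.pull {n m : ℕ} {f g : Cor X n} (h : HomotopicRoot f g) {c : Fin m → Fin n}
    (hc : Function.Injective c) (hs : Function.Surjective c) (χ : corolla m ⟶ corolla n)
    (h0 : emap χ none = none) (h1 : ∀ i, emap χ (some i) = some (c i)) :
    HomotopicRoot (X.pull χ f) (X.pull χ g) := by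
  obtain ⟨H, rfl, rfl, h3⟩ := h
  have hr : (Set.range fun i => (some (some (c i)) : (extRoot n).Edge)) =
      Set.range fun k => some (some k) :=
    hs.range_comp (fun k => (some (some k) : Option (Option (Fin n))))
  refine ⟨X.pull (extRootHom (T := extRoot n) (fun i => some (some (c i))) (some none) none
    ⟨(someSome_injective n).comp hc, ?_⟩ ?_) H, ?_, ?_, ?_⟩
  · rw [hr]
    exact extRoot_top n
  · have := extRoot_bottom n
    rwa [Set.range_const] at this
  · rw [← pull_comp, ← pull_comp]
    congr 1
    ext (_ | i) : 1
    · rw [emap_comp, emap_comp, h0]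
      rfl
    · rw [emap_comp, emap_comp, h1]
      rfl
  · rw [← pull_comp, ← pull_comp]
    congr 1
    ext (_ | i) : 1
    · rw [emap_comp, emap_comp, h0]
      rfl
    · rw [emap_comp, emap_comp, h1]
      rfl
  · rw [output_pull, h0]
    refine Eq.trans ?_ h3
    rw [← pull_comp]
    congr 1
    ext (_ | i) <;> rfl

/-- Composites of homotopic operations are homotopic. -/
lemma homotopicRoot_leafMap (hX : IsInnerKan X) {n : ℕ} {k : Fin n → ℕ}
    {x y : X.obj (op (twoLevel n k))}
    (hbot : HomotopicRoot (X.pull (twoBot n k) x) (X.pull (twoBot n k) y))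
    (htop : ∀ i, HomotopicRoot (X.pull (twoTop n k i) x)
      (X.pull (twoTop n k i) y)) :
    HomotopicRoot (X.pull (leafMap n k) x) (X.pull (leafMap n k) y) := by
  choose H h1 h2 h3 using htop
  -- The homotopies between the top vertices, grafted onto the bottom vertex of `y`.
  obtain ⟨W, hW1, hW2⟩ := exists_graft hX (R := fun i => extRoot (k i)) (X.pull (twoBot n k) y) H (by
    intro i
    rw [input_pull]
    have := congrArg (fun a => Cor.output a) (h2 i)
    rw [output_pull, output_pull] at this
    exact this.symm)
  have hop : (Function.Injective fun i => gr (R := fun i => extRoot (k i)) i (some none)) ∧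
      (graft n fun i => extRoot (k i)).IsOp
        (Set.range fun i => gr (R := fun i => extRoot (k i)) i (some none)) none := by
    constructor
    · intro i j h
      cases h
      rfl
    · convert IsOp.two (T := graft n fun i => extRoot (k i)) (d := none) graft_not_leaf_root (by
        intro x hx
        obtain ⟨i, rfl⟩ := graft_in_root.1 hx
        intro h
        obtain ⟨j, hj⟩ := graft_leaf_gr.1 h
        cases hj) using 1
      ext z
      constructor
      · rintro ⟨i, rfl⟩
        exact ⟨_, graft_in_root.2 ⟨i, rfl⟩, graft_in_gr.2 ⟨some none, Or.inr ⟨rfl, rfl⟩, rfl⟩⟩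
      · rintro ⟨x, hx, hz⟩
        obtain ⟨i, rfl⟩ := graft_in_root.1 hx
        obtain ⟨a, (⟨-, ha⟩ | ⟨rfl, -⟩), rfl⟩ := graft_in_gr.1 hz
        · cases ha
        · exact ⟨i, rfl⟩
  let G : Tree := graft n fun i => extRoot (k i)
  have hbotOp : (Function.Injective fun i => gr (R := fun i => extRoot (k i)) i none) ∧
      G.IsOp (Set.range fun i => gr (R := fun i => extRoot (k i)) i none) none :=
    ⟨gr_root_injective, graft_bot_isOp⟩
  have hinner := fun i => hom_op (grIncl (fun i => extRoot (k i)) i)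
    ⟨someSome_injective (k i), extRoot_inner (k i)⟩
  have htop' := fun i => hom_op (grIncl (fun i => extRoot (k i)) i)
    ⟨someSome_injective (k i), extRoot_top (k i)⟩
  have hunary := fun i => hom_op (grIncl (fun i => extRoot (k i)) i)
    ⟨Function.injective_of_subsingleton _, extRoot_bottom (k i)⟩
  -- `C1` contracts each homotopy and so has the bottom and top vertices of `y`. `C2` contracts the
  -- identities into the bottom vertex and so has the top vertices of `x`. Both have the same total
  -- composite, and `C3` shows that the bottom vertex of `C2` is homotopic to that of `y`.
  let C1 : twoLevel n k ⟶ G := twoLevelHom hbotOp hinner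
  let C2 : twoLevel n k ⟶ G := twoLevelHom hop htop'
  let C3 : (twoLevel n fun _ => 1) ⟶ G := twoLevelHom hbotOp hunary
  have e1 : leafMap n k ≫ C1 = leafMap n k ≫ C2 := by
    ext (_ | i) <;> rfl
  have e2 : unaryMap n ≫ C3 = twoBot n k ≫ C2 := by
    ext (_ | i) <;> rfl
  have b1 : twoBot n k ≫ C1 = grBot _ := twoBot_twoLevelHom _ _
  have b3 : (twoBot n fun _ => 1) ≫ C3 = grBot _ := twoBot_twoLevelHom _ _
  have t1 : ∀ i, twoTop n k i ≫ C1 = extRootInner (k i) ≫ grIncl (fun i => extRoot (k i)) i := by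
    intro i
    ext (_ | j) <;> rfl
  have t2 : ∀ i, twoTop n k i ≫ C2 = extRootTop (k i) ≫ grIncl (fun i => extRoot (k i)) i := by
    intro i
    ext (_ | j) <;> rfl
  have t3 : ∀ i, twoTop n (fun _ => 1) i ≫ C3 = extRootBottom (k i) ≫ grIncl (fun i => extRoot (k i)) i := by
    intro i
    ext (_ | j) <;> rfl
  have hbot' : HomotopicRoot (X.pull (twoBot n k) (X.pull C2 W)) (X.pull (twoBot n k) y) := by
    rw [← pull_comp, ← e2, pull_comp]
    refine (pull_unaryMap_homotopic hX ?_ fun i => ?_).1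
    · rw [← pull_comp, b3]
      exact hW1
    · rw [← pull_comp, t3, pull_comp, hW2, h3, output_pull, input_pull]
      have := (HomotopicRoot.output_eq ⟨H i, h1 i, h2 i, h3 i⟩)
      rw [output_pull, output_pull] at this
      exact congrArg idCor this
  have hx : HomotopicRoot (X.pull (leafMap n k) x) (X.pull (leafMap n k) (X.pull C2 W)) := by
    refine homotopicRoot_of_bot hX (fun i => ?_) (hbot.trans hX (hbot'.symm hX)) leafInputs_op
      (fun _ => Option.some_ne_none _)
    rw [← pull_comp (twoTop n k i) C2, t2, pull_comp, hW2, h1]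
  have hy : HomotopicRoot (X.pull (leafMap n k) (X.pull C1 W)) (X.pull (leafMap n k) y) := by
    refine homotopicRoot_of_bot hX (fun i => ?_) ?_ leafInputs_op
      (fun _ => Option.some_ne_none _)
    · rw [← pull_comp, t1, pull_comp, hW2, h2]
    · rw [← pull_comp, b1, hW1]
      exact .refl _
  rw [← pull_comp, e1, pull_comp] at hy
  exact hx.trans hX hy

end Dendroidal

namespace Dendroidal

open Dendroidal.Tree

variable {X : DendroidalSet.{u}}

/-! ## The operad structure on `Ho(X)` -/

/-- The class in `Ho(X)` of a dendrex with the given inputs and output. -/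
def hoMk {n : ℕ} {c : Fin n → Vert X} {d : Vert X} (f : Cor X n) (hc : ∀ i, f.input i = c i)
    (hd : f.output = d) : HoOp X n c d := Quot.mk _ ⟨f, hc, hd⟩

lemma exists_hoMk {n : ℕ} {c : Fin n → Vert X} {d : Vert X} (F : HoOp X n c d) :
    ∃ (f : Cor X n) (hc : ∀ i, f.input i = c i) (hd : f.output = d), F = hoMk f hc hd := by
  induction F using Quot.ind with
  | mk f => exact ⟨f.1, f.2.1, f.2.2, rfl⟩

/-- The underlying homotopy class, without its inputs and output. -/
def HoOp.forget (hX : IsInnerKan X) {n : ℕ} {c : Fin n → Vert X} {d : Vert X} (F : HoOp X n c d) :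
    Quot (HomotopicRoot (X := X) (n := n)) :=
  Quot.lift (fun f => Quot.mk _ f.1) (fun _ _ h => Quot.sound (h.homotopicRoot hX)) F

lemma homotopicRoot_of_quot (hX : IsInnerKan X) {n : ℕ} {f g : Cor X n}
    (h : Quot.mk (HomotopicRoot (X := X)) f = Quot.mk _ g) : HomotopicRoot f g := by
  have h' := Quot.eqvGen_exact h
  clear h
  induction h' with
  | rel _ _ h => exact h
  | refl _ => exact .refl _
  | symm _ _ _ ih => exact ih.symm hX
  | trans _ _ _ _ _ ih1 ih2 => exact ih1.trans hX ih2

/-- Leaf homotopies are root homotopies and these form an equivalence relation, so the quotient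
identifies nothing else. -/
lemma hoMk_eq_iff (hX : IsInnerKan X) {n : ℕ} {c : Fin n → Vert X} {d : Vert X} {f g : Cor X n}
    {hc : ∀ i, f.input i = c i} {hd : f.output = d} {hc' : ∀ i, g.input i = c i}
    {hd' : g.output = d} : hoMk f hc hd = hoMk g hc' hd' ↔ HomotopicRoot f g :=
  ⟨fun h => homotopicRoot_of_quot hX (congrArg (HoOp.forget hX) h),
    fun h => Quot.sound (Or.inl h)⟩

lemma hoMk_congr {n : ℕ} {c : Fin n → Vert X} {d : Vert X} {f g : Cor X n}
    {hc : ∀ i, f.input i = c i} {hd : f.output = d} {hc' : ∀ i, g.input i = c i}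
    {hd' : g.output = d} (h : f = g) : hoMk f hc hd = hoMk g hc' hd' := by
  subst h
  rfl

section Class

variable {T : Tree}

/-- The class in `Ho(X)` of the image of an operation of a tree `T` under a dendrex of
shape `T`. -/
def cls (x : X.obj (op T)) {n : ℕ} {c : Fin n → T.Edge} {e : T.Edge} (o : T.operad.Op n c e)
    {c' : Fin n → Vert X} {d' : Vert X} (hc : ∀ i, X.pull (T.edgeMap (c i)) x = c' i)
    (hd : X.pull (T.edgeMap e) x = d') : HoOp X n c' d' :=
  hoMk (X.pull (opMap T c e o.down) x) (fun i => (input_pull _ _ i).trans (hc i))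
    ((output_pull _ _).trans hd)

end Class

namespace HoOp

variable {n : ℕ} {c : Fin n → Vert X} {d : Vert X}

/-- A representative of a homotopy class. -/
noncomputable def rep (F : HoOp X n c d) : Cor X n := (exists_hoMk F).choose

lemma rep_input (F : HoOp X n c d) (i : Fin n) : F.rep.input i = c i :=
  (exists_hoMk F).choose_spec.choose i

lemma rep_output (F : HoOp X n c d) : F.rep.output = d :=
  (exists_hoMk F).choose_spec.choose_spec.choose

lemma hoMk_rep (F : HoOp X n c d) : hoMk F.rep F.rep_input F.rep_output = F :=
  (exists_hoMk F).choose_spec.choose_spec.choose_spec.symm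

end HoOp

/-- The automorphism of a corolla given by a permutation of the inputs. -/
def permMap {m n : ℕ} (σ : Fin m ≃ Fin n) : corolla m ⟶ corolla n :=
  opMap (corolla n) (fun i => some (σ i)) none
    ⟨(Option.some_injective _).comp σ.injective, by
      have := (corollaOp n).down.2
      rwa [← σ.surjective.range_comp] at this⟩

lemma exists_composable (hX : IsInnerKan X) {n : ℕ} {k : Fin n → ℕ} (f : Cor X n)
    (g : ∀ i, Cor X (k i)) (h : ∀ i, f.input i = (g i).output) :
    ∃ x : X.obj (op (twoLevel n k)), X.pull (twoBot n k) x = f ∧ ∀ i, X.pull (twoTop n k i) x = g i :=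
  exists_graft hX (R := fun i => corolla (k i)) f g h

/-- A dendrex which represents a composable list of homotopy classes. -/
noncomputable def filler (hX : IsInnerKan X) {n : ℕ} {k : Fin n → ℕ} {c : Fin n → Vert X}
    {d : Vert X} {b : ∀ i, Fin (k i) → Vert X} (F : HoOp X n c d)
    (G : ∀ i, HoOp X (k i) (b i) (c i)) : X.obj (op (twoLevel n k)) :=
  (exists_composable hX F.rep (fun i => (G i).rep)
    fun i => (F.rep_input i).trans (G i).rep_output.symm).choose

lemma filler_bot (hX : IsInnerKan X) {n : ℕ} {k : Fin n → ℕ} {c : Fin n → Vert X}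
    {d : Vert X} {b : ∀ i, Fin (k i) → Vert X} (F : HoOp X n c d)
    (G : ∀ i, HoOp X (k i) (b i) (c i)) : X.pull (twoBot n k) (filler hX F G) = F.rep :=
  (exists_composable hX F.rep (fun i => (G i).rep)
    fun i => (F.rep_input i).trans (G i).rep_output.symm).choose_spec.1

lemma filler_top (hX : IsInnerKan X) {n : ℕ} {k : Fin n → ℕ} {c : Fin n → Vert X}
    {d : Vert X} {b : ∀ i, Fin (k i) → Vert X} (F : HoOp X n c d)
    (G : ∀ i, HoOp X (k i) (b i) (c i)) (i : Fin n) :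
    X.pull (twoTop n k i) (filler hX F G) = (G i).rep :=
  (exists_composable hX F.rep (fun i => (G i).rep)
    fun i => (F.rep_input i).trans (G i).rep_output.symm).choose_spec.2 i

lemma input_leafMap {n : ℕ} {k : Fin n → ℕ} (x : X.obj (op (twoLevel n k)))
    (a : Fin (∑ i, k i)) : Cor.input (X.pull (leafMap n k) x) a =
      Cor.input (X.pull (twoTop n k (finSigmaFinEquiv.symm a).1) x) (finSigmaFinEquiv.symm a).2 :=
  (input_pull _ _ _).trans (input_pull (twoTop n k _) x _).symm

lemma output_leafMap {n : ℕ} {k : Fin n → ℕ} (x : X.obj (op (twoLevel n k))) :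
    Cor.output (X.pull (leafMap n k) x) = Cor.output (X.pull (twoBot n k) x) :=
  (output_pull _ _).trans (output_pull (twoBot n k) x).symm

/-- The symmetries of `Ho(X)`. -/
noncomputable def hoAct {m n : ℕ} (σ : Fin m ≃ Fin n) {c : Fin n → Vert X} {c' : Fin m → Vert X}
    {d : Vert X} (h : ∀ i, c' i = c (σ i)) (F : HoOp X n c d) : HoOp X m c' d :=
  hoMk (X.pull (permMap σ) F.rep)
    (fun i => (input_pull _ _ i).trans ((F.rep_input (σ i)).trans (h i).symm))
    ((output_pull _ _).trans F.rep_output)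

/-- The composition of `Ho(X)`. -/
noncomputable def hoComp (hX : IsInnerKan X) {n : ℕ} {k : Fin n → ℕ} {c : Fin n → Vert X}
    {d : Vert X} {b : ∀ i, Fin (k i) → Vert X} (F : HoOp X n c d)
    (G : ∀ i, HoOp X (k i) (b i) (c i)) : HoOp X (∑ i, k i) (concat b) d :=
  hoMk (X.pull (leafMap n k) (filler hX F G))
    (fun a => by rw [input_leafMap, filler_top, HoOp.rep_input])
    (by rw [output_leafMap, filler_bot, HoOp.rep_output])

section Class

variable {T : Tree}

/-- Permuting the inputs respects homotopy, so the chosen representative may be replaced by the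
dendrex coming from `x`. -/
lemma hoAct_cls (hX : IsInnerKan X) (x : X.obj (op T)) {m n : ℕ} (σ : Fin m ≃ Fin n)
    {c : Fin n → T.Edge} {e : T.Edge} {c₂ : Fin m → T.Edge} (h₂ : ∀ i, c₂ i = c (σ i))
    (o : T.operad.Op n c e) {c' : Fin n → Vert X} {c₂' : Fin m → Vert X} {d' : Vert X}
    (h : ∀ i, c₂' i = c' (σ i)) (hc : ∀ i, X.pull (T.edgeMap (c i)) x = c' i)
    (hd : X.pull (T.edgeMap e) x = d') :
    hoAct σ h (cls x o hc hd) =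
      cls x (T.operad.str.act σ h₂ o) (fun i => by rw [h₂, hc, h]) hd := by
  refine (hoMk_eq_iff hX).2 ?_
  have h1 : HomotopicRoot (cls x o hc hd).rep (X.pull (opMap T c e o.down) x) :=
    (hoMk_eq_iff hX).1 (HoOp.hoMk_rep (cls x o hc hd))
  have h3 := h1.pull σ.injective σ.surjective (permMap σ) rfl fun _ => rfl
  have h4 : X.pull (permMap σ) (X.pull (opMap T c e o.down) x) =
      X.pull (opMap T c₂ e (T.operad.str.act σ h₂ o).down) x := by
    rw [← pull_comp]
    congr 1
    ext (_ | i)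
    · rfl
    · exact (h₂ i).symm
  rwa [h4] at h3

/-- Composition in `Ho(X)` can be computed in any dendrex containing the operations: it provides a
filler of its own, and by `homotopicRoot_leafMap` the choice of filler and representatives is
immaterial. -/
lemma hoComp_cls (hX : IsInnerKan X) (x : X.obj (op T)) {n : ℕ} {k : Fin n → ℕ}
    {c : Fin n → T.Edge} {e : T.Edge} {b : ∀ i, Fin (k i) → T.Edge}
    (o : T.operad.Op n c e) (o' : ∀ i, T.operad.Op (k i) (b i) (c i))
    {c' : Fin n → Vert X} {d' : Vert X} {b' : ∀ i, Fin (k i) → Vert X}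
    (hc : ∀ i, X.pull (T.edgeMap (c i)) x = c' i) (hd : X.pull (T.edgeMap e) x = d')
    (hb : ∀ i j, X.pull (T.edgeMap (b i j)) x = b' i j) :
    hoComp hX (cls x o hc hd) (fun i => cls x (o' i) (hb i) (hc i)) =
      cls x (T.operad.str.comp o o') (fun _ => hb _ _) hd := by
  refine (hoMk_eq_iff hX).2 ?_
  have e0 := twoBot_twoLevelHom o.down fun i => (o' i).down
  have e1 := twoTop_twoLevelHom o.down fun i => (o' i).down
  have e2 : leafMap n k ≫ twoLevelHom o.down (fun i => (o' i).down) =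
      opMap T (concat b) e (T.operad.str.comp o o').down := by
    ext (_ | a) <;> rfl
  rw [← e2, pull_comp]
  refine homotopicRoot_leafMap hX ?_ fun i => ?_
  · rw [filler_bot, ← pull_comp, e0]
    exact (hoMk_eq_iff hX).1 (HoOp.hoMk_rep (cls x o hc hd))
  · rw [filler_top, ← pull_comp, e1]
    exact (hoMk_eq_iff hX).1 (HoOp.hoMk_rep (cls x (o' i) (hb i) (hc i)))

lemma one_eq_cls (x : X.obj (op T)) (e : T.Edge) {d' : Vert X} (hd : X.pull (T.edgeMap e) x = d') :
    hoMk (idCor d') (idCor_input d') (idCor_output d') =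
      cls x (T.operad.str.one e) (fun _ => hd) hd := by
  subst hd
  exact hoMk_congr (idCor_pull x e _ (by rintro (_ | i) <;> rfl)).symm

lemma cls_corolla {n : ℕ} {c : Fin n → Vert X} {d : Vert X} (f : Cor X n)
    (hc : ∀ i, f.input i = c i) (hd : f.output = d) :
    hoMk f hc hd = cls f (corollaOp n) hc hd := by
  refine hoMk_congr ?_
  rw [opMap_some_none, pull_id]

end Class

/-- Realises a composable family of classes inside one dendrex, so that identities in `Ho(X)` reduce
to identities in `Ω(T)`. -/
lemma exists_cls_twoLevel (hX : IsInnerKan X) {n : ℕ} {k : Fin n → ℕ} {c : Fin n → Vert X}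
    {d : Vert X} {b : ∀ i, Fin (k i) → Vert X} (F : HoOp X n c d)
    (G : ∀ i, HoOp X (k i) (b i) (c i)) :
    ∃ (T : Tree) (x : X.obj (op T)) (c₁ : Fin n → T.Edge) (e : T.Edge)
      (b₁ : ∀ i, Fin (k i) → T.Edge) (o : T.operad.Op n c₁ e)
      (o' : ∀ i, T.operad.Op (k i) (b₁ i) (c₁ i)) 
      (hc : ∀ i, X.pull (T.edgeMap (c₁ i)) x = c i) (hd : X.pull (T.edgeMap e) x = d)
      (hb : ∀ i j, X.pull (T.edgeMap (b₁ i j)) x = b i j),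
      F = cls x o hc hd ∧ G = fun i => cls x (o' i) (hb i) (hc i) := by
  have h1 := filler_bot hX F G
  have h2 := filler_top hX F G
  refine ⟨twoLevel n k, filler hX F G, midEdge, none,
    fun i j => gr (R := fun i => corolla (k i)) i (some j), ⟨gr_root_injective, graft_bot_isOp⟩,
    fun i => ⟨hom_op (twoTop n k i) (corollaOp (k i)).down⟩, ?_, ?_, ?_, ?_, ?_⟩
  · intro i
    have := F.rep_input i
    rw [← h1, input_pull] at this
    exact this
  · have := F.rep_output
    rw [← h1, output_pull] at this
    exact this
  · intro i j
    have := (G i).rep_input j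
    rw [← h2, input_pull] at this
    exact this
  · conv_lhs => rw [← F.hoMk_rep]
    exact hoMk_congr h1.symm
  · funext i
    conv_lhs => rw [← (G i).hoMk_rep]
    refine hoMk_congr ((h2 i).symm.trans ?_)
    congr 1
    ext (_ | j) <;> rfl

/-- The analogue for associativity: the fillers for the upper two levels are grafted onto a
representative of `F`. -/
lemma exists_cls_threeLevel (hX : IsInnerKan X) {n : ℕ} {k : Fin n → ℕ} {c : Fin n → Vert X}
    {d : Vert X} {b : ∀ i, Fin (k i) → Vert X} {l : ∀ i, Fin (k i) → ℕ}
    {a : ∀ i j, Fin (l i j) → Vert X} (F : HoOp X n c d)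
    (G : ∀ i, HoOp X (k i) (b i) (c i)) (H : ∀ i j, HoOp X (l i j) (a i j) (b i j)) :
    ∃ (T : Tree) (x : X.obj (op T)) (c₁ : Fin n → T.Edge) (e : T.Edge)
      (b₁ : ∀ i, Fin (k i) → T.Edge) (a₁ : ∀ i j, Fin (l i j) → T.Edge) (o : T.operad.Op n c₁ e)
      (o' : ∀ i, T.operad.Op (k i) (b₁ i) (c₁ i))
      (o'' : ∀ i j, T.operad.Op (l i j) (a₁ i j) (b₁ i j)) 
      (hc : ∀ i, X.pull (T.edgeMap (c₁ i)) x = c i) (hd : X.pull (T.edgeMap e) x = d)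
      (hb : ∀ i j, X.pull (T.edgeMap (b₁ i j)) x = b i j)
      (ha : ∀ i j m, X.pull (T.edgeMap (a₁ i j m)) x = a i j m),
      F = cls x o hc hd ∧ (G = fun i => cls x (o' i) (hb i) (hc i)) ∧
        H = fun i j => cls x (o'' i j) (ha i j) (hb i j) := by
  have h1 := fun i => filler_bot hX (G i) (H i)
  have h2 := fun i => filler_top hX (G i) (H i)
  obtain ⟨x, hx1, hx2⟩ := exists_graft hX (R := fun i => twoLevel (k i) (l i)) F.rep
    (fun i => filler hX (G i) (H i)) (by
      intro i
      have := (G i).rep_output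
      rw [← h1, output_pull] at this
      exact (F.rep_input i).trans this.symm)
  have e1 : ∀ i, X.pull (twoBot (k i) (l i) ≫ grIncl (fun i => twoLevel (k i) (l i)) i) x =
      (G i).rep := by
    intro i
    rw [pull_comp, hx2, h1]
  have e2 : ∀ i j, X.pull (twoTop (k i) (l i) j ≫ grIncl (fun i => twoLevel (k i) (l i)) i) x =
      (H i j).rep := by
    intro i j
    rw [pull_comp, hx2, h2]
  refine ⟨graft n fun i => twoLevel (k i) (l i), x,
    fun i => gr (R := fun i => twoLevel (k i) (l i)) i none, none,
    fun i j => gr (R := fun i => twoLevel (k i) (l i)) i (midEdge j),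
    fun i j m => gr (R := fun i => twoLevel (k i) (l i)) i (gr (R := fun j => corolla (l i j)) j
      (some m)), ⟨gr_root_injective, graft_bot_isOp⟩,
    fun i => ⟨hom_op (twoBot (k i) (l i) ≫ grIncl (fun i => twoLevel (k i) (l i)) i)
      (corollaOp (k i)).down⟩,
    fun i j => ⟨hom_op (twoTop (k i) (l i) j ≫ grIncl (fun i => twoLevel (k i) (l i)) i)
      (corollaOp (l i j)).down⟩, ?_, ?_, ?_, ?_, ?_, ?_, ?_⟩
  · intro i
    have := F.rep_input i
    rw [← hx1, input_pull] at this
    exact this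
  · have := F.rep_output
    rw [← hx1, output_pull] at this
    exact this
  · intro i j
    have := (G i).rep_input j
    rw [← e1, input_pull] at this
    exact this
  · intro i j m
    have := (H i j).rep_input m
    rw [← e2, input_pull] at this
    exact this
  · conv_lhs => rw [← F.hoMk_rep]
    exact hoMk_congr hx1.symm
  · funext i
    conv_lhs => rw [← (G i).hoMk_rep]
    refine hoMk_congr ((e1 i).symm.trans ?_)
    congr 1
    ext (_ | j) <;> rfl
  · funext i j
    conv_lhs => rw [← (H i j).hoMk_rep]
    refine hoMk_congr ((e2 i j).symm.trans ?_)
    congr 1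
    ext (_ | m) <;> rfl

/-- The operad structure on `Ho(X)`. -/
noncomputable def hoStr (hX : IsInnerKan X) : OperadStr (Vert X) (HoOp X) where
  one d := hoMk (idCor d) (idCor_input d) (idCor_output d)
  act := hoAct
  comp := hoComp hX
  act_refl := by
    intro n c d F
    obtain ⟨f, hc, hd, rfl⟩ := exists_hoMk F
    rw [cls_corolla f hc hd]
    exact hoAct_cls hX f (Equiv.refl _) (fun _ => rfl) (corollaOp n) _ hc hd
  act_trans := by
    intro l m n τ σ c c' c'' d h' h F
    obtain ⟨f, hc, hd, rfl⟩ := exists_hoMk F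
    rw [cls_corolla f hc hd]
    refine (congrArg (hoAct τ h')
      (hoAct_cls hX f σ (fun _ => rfl) (corollaOp n) h hc hd)).trans ?_
    refine (hoAct_cls hX f τ (fun _ => rfl) _ h' _ hd).trans ?_
    exact (hoAct_cls hX f (τ.trans σ) (fun _ => rfl) (corollaOp n) _ hc hd).symm
  one_comp := by
    intro n c d F
    obtain ⟨f, hc, hd, rfl⟩ := exists_hoMk F
    rw [cls_corolla f hc hd, one_eq_cls (T := corolla n) f none hd]
    refine (hoComp_cls hX f _ (fun _ => corollaOp n) (fun _ => hd) hd fun _ => hc).trans ?_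
    exact (hoAct_cls hX f (oneCompEquiv n) (fun _ => rfl) (corollaOp n) _ hc hd).symm
  comp_one := by
    intro n c d F
    obtain ⟨f, hc, hd, rfl⟩ := exists_hoMk F
    rw [cls_corolla f hc hd]
    refine (congrArg (hoComp hX (cls f (corollaOp n) hc hd))
      (funext fun i => one_eq_cls f (some i) (hc i))).trans ?_
    refine (hoComp_cls hX f (corollaOp n) (fun i => (corolla n).operad.str.one (some i))
      hc hd fun i _ => hc i).trans ?_
    exact (hoAct_cls hX f (compOneEquiv n) (fun _ => rfl) (corollaOp n) _ hc hd).symm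
  assoc := by
    intro n c d k b l a F G H
    -- Both bracketings are now classes of operations of one tree, and agree there after the
    -- reindexing of inputs.
    obtain ⟨T, x, c₁, e, b₁, a₁, o, o', o'', hc, hd, hb, ha, rfl, rfl, rfl⟩ :=
      exists_cls_threeLevel hX F G H
    have e1 := hoComp_cls hX x o o' hc hd hb
    have e2 := hoComp_cls hX x (T.operad.str.comp o o')
      (fun y => o'' (finSigmaFinEquiv.symm y).1 (finSigmaFinEquiv.symm y).2)
      (fun _ => hb _ _) hd (fun _ => ha _ _)
    have e3 := fun i => hoComp_cls hX x (o' i) (o'' i) (hb i) (hc i) (ha i)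
    have e4 := hoComp_cls hX x o (fun i => T.operad.str.comp (o' i) (o'' i)) hc hd
      (fun i _ => ha i _ _)
    have e5 := hoAct_cls hX x (assocEquiv l) (concat_assocEquiv a₁)
      (T.operad.str.comp o fun i => T.operad.str.comp (o' i) (o'' i)) (concat_assocEquiv a)
      (fun _ => ha _ _ _) hd
    rw [e1]
    refine e2.trans ?_
    rw [funext e3, e4]
    exact e5.symm
  act_comp := by
    intro m n σ c d k b F G
    obtain ⟨T, x, c₁, e, b₁, o, o', hc, hd, hb, rfl, rfl⟩ := exists_cls_twoLevel hX F G
    rw [hoComp_cls hX x o o' hc hd hb, hoAct_cls hX x σ (fun _ => rfl) o _ hc hd]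
    refine (hoComp_cls hX x _ (fun i => o' (σ i)) (fun i => hc (σ i)) hd fun i => hb (σ i)).trans ?_
    exact (hoAct_cls hX x (blockEquiv σ k) (concat_blockEquiv σ b₁) _ _ _ hd).symm
  comp_act := by
    intro n c d k l b b' τ hb' F G
    obtain ⟨T, x, c₁, e, b₁, o, o', hc, hd, hb, rfl, rfl⟩ := exists_cls_twoLevel hX F G
    rw [hoComp_cls hX x o o' hc hd hb,
      funext fun i => hoAct_cls hX x (τ i) (fun _ => rfl) (o' i) (hb' i) (hb i) (hc i)]
    refine (hoComp_cls hX x o _ hc hd _).trans ?_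
    exact (hoAct_cls hX x (sumEquiv τ) (concat_sumEquiv τ fun _ _ => rfl) _ _ _ hd).symm

end Dendroidal

namespace Dendroidal

open Dendroidal.Tree

variable {X : DendroidalSet.{u}}

/-! ## The map to the nerve of `Ho(X)` -/

/-- The type of `op` depends on `col`; comparing operations together with their inputs and output
avoids transport along `hcol`. -/
lemma OperadHom.eq_mk_of_sigma {P : Operad.{u, v}} {Q : Operad.{u', v'}} (φ : OperadHom P Q)
    (col : P.Colour → Q.Colour)
    (op : ∀ {n : ℕ} {c : Fin n → P.Colour} {d : P.Colour},
      P.Op n c d → Q.Op n (fun i => col (c i)) (col d))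
    (hcol : φ.col = col)
    (hop : ∀ {n : ℕ} {c : Fin n → P.Colour} {d : P.Colour} (o : P.Op n c d),
      (⟨_, _, φ.op o⟩ : Σ (c : Fin n → Q.Colour) (d : Q.Colour), Q.Op n c d) = ⟨_, _, op o⟩) :
    ∃ h1 h2 h3, φ = ⟨col, op, h1, h2, h3⟩ := by
  obtain ⟨col', op', h1, h2, h3⟩ := φ
  dsimp only at hcol
  subst hcol
  have : @op' = @op := by
    funext n c d o
    have h4 := hop o
    simp only [Sigma.mk.injEq, heq_eq_eq, true_and] at h4
    exact h4
  subst this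
  exact ⟨h1, h2, h3, rfl⟩

lemma OperadHom.ext_of_sigma {P : Operad.{u, v}} {Q : Operad.{u', v'}} {φ ψ : OperadHom P Q}
    (hcol : φ.col = ψ.col)
    (hop : ∀ {n : ℕ} {c : Fin n → P.Colour} {d : P.Colour} (o : P.Op n c d),
      (⟨_, _, φ.op o⟩ : Σ (c : Fin n → Q.Colour) (d : Q.Colour), Q.Op n c d) = ⟨_, _, ψ.op o⟩) :
    φ = ψ := by
  obtain ⟨h1, h2, h3, h⟩ := φ.eq_mk_of_sigma ψ.col ψ.op hcol hop
  exact h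

lemma sigma_hoMk {n : ℕ} {f : Cor X n} {c : Fin n → Vert X} {d : Vert X}
    (hc : ∀ i, f.input i = c i) (hd : f.output = d) :
    (⟨f.input, f.output, hoClass f⟩ : Σ (c : Fin n → Vert X) (d : Vert X), HoOp X n c d) =
      ⟨c, d, hoMk f hc hd⟩ := by
  obtain rfl : f.input = c := funext hc
  subst hd
  rfl

lemma sigma_cls {T : Tree} (x : X.obj (op T)) {n : ℕ} {c : Fin n → T.Edge} {e : T.Edge}
    (o : T.operad.Op n c e) :
    (⟨Cor.input (X.pull (opMap T c e o.down) x), Cor.output (X.pull (opMap T c e o.down) x),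
      hoClass (X.pull (opMap T c e o.down) x)⟩ :
        Σ (c : Fin n → Vert X) (d : Vert X), HoOp X n c d) =
      ⟨fun i => X.pull (T.edgeMap (c i)) x, X.pull (T.edgeMap e) x,
        cls x o (fun _ => rfl) rfl⟩ :=
  sigma_hoMk _ _

/-- The operad map `Ω(T) → Ho(X)` induced by a dendrex of shape `T`. -/
noncomputable def structMap (hX : IsInnerKan X) {T : Tree} (x : X.obj (op T)) :
    OperadHom T.operad (HoOperad X (hoStr hX)) where
  col e := X.pull (T.edgeMap e) x
  op o := cls x o (fun _ => rfl) rfl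
  op_one d := (one_eq_cls x d rfl).symm
  op_act σ _ _ _ h f := (hoAct_cls hX x σ h f (fun i => by rw [h]) (fun _ => rfl) rfl).symm
  op_comp f g := (hoComp_cls hX x f g (fun _ => rfl) rfl fun _ _ => rfl).symm

lemma structMap_pull (hX : IsInnerKan X) {S T : Tree} (χ : S ⟶ T) (x : X.obj (op T)) :
    structMap hX (X.pull χ x) = OperadHom.comp χ (structMap hX x) := by
  refine OperadHom.ext_of_sigma ?_ ?_
  · funext e
    exact pull_edgeMap χ x e
  · intro n c d o
    refine (sigma_cls (X.pull χ x) o).symm.trans (Eq.trans ?_ (sigma_cls x (OperadHom.op χ o)))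
    have : X.pull (opMap S c d o.down) (X.pull χ x) =
        X.pull (opMap T _ _ (OperadHom.op χ o).down) x := by
      rw [← pull_comp]
      congr 1
      ext (_ | i) <;> rfl
    rw [this]

/-- The map of dendroidal sets `X ⟶ N_d(Ho(X))`. -/
noncomputable def toNerve (hX : IsInnerKan X) : X ⟶ nerve (HoOperad X (hoStr hX)) where
  app T := TypeCat.ofHom fun x => structMap hX (T := T.unop) x
  naturality S T χ := by
    ext x
    exact structMap_pull hX χ.unop x

lemma toNerve_extendsQuotient (hX : IsInnerKan X) : ExtendsQuotient (toNerve hX) := by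
  constructor
  · intro x
    exact (congrArg (fun χ => X.pull χ x) (by ext1; rfl : edgeMap eta () = 𝟙 eta)).trans (pull_id x)
  · intro n f
    refine (sigma_cls (T := corolla n) f (corollaOp n)).symm.trans ?_
    rw [opMap_some_none, pull_id]

/-! ### Uniqueness of the operad structure and of `q` -/

section Extends

variable {S : OperadStr (Vert X) (HoOp X)} {q : X ⟶ nerve (HoOperad X S)}

lemma app_pull {P : Operad.{u, u}} (q : X ⟶ nerve P) {T T' : Tree} (χ : T' ⟶ T)
    (x : X.obj (op T)) :
    (q.app (op T') (X.pull χ x) : OperadHom T'.operad P) = OperadHom.comp χ (q.app (op T) x) :=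
  NatTrans.naturality_apply q χ.op x

/-- A map which extends the quotient map is given by the classes of the images of the
operations. -/
lemma ExtendsQuotient.app_eq (hq : ExtendsQuotient q) {T : Tree} (x : X.obj (op T)) :
    ∃ h1 h2 h3, (q.app (op T) x : OperadHom T.operad (HoOperad X S)) =
      ⟨fun e => X.pull (T.edgeMap e) x, fun o => cls x o (fun _ => rfl) rfl, h1, h2, h3⟩ := by
  -- Naturality along edges and along arrows from corollas reduces the claim to the definition of
  -- `ExtendsQuotient`. The proofs `h1`, `h2`, `h3` thereby obtained say that classes of operations
  -- of `T` respect the units, symmetries and composition of `S`.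
  refine OperadHom.eq_mk_of_sigma (P := T.operad) (Q := HoOperad X S) (q.app (op T) x)
    (fun e => X.pull (T.edgeMap e) x) (fun o => cls x o (fun _ => rfl) rfl) ?_ ?_
  · funext e
    have h1 := hq.1 (X.pull (T.edgeMap e) x)
    rw [nerveColour, app_pull] at h1
    exact h1
  · intro n c d o
    have h1 := hq.2 n (X.pull (opMap T c d o.down) x)
    rw [nerveOp, app_pull] at h1
    exact h1.trans (sigma_cls x o)

lemma ExtendsQuotient.one_cls (hq : ExtendsQuotient q) {T : Tree} (x : X.obj (op T)) (e : T.Edge)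
    {d' : Vert X} (hd : X.pull (T.edgeMap e) x = d') :
    S.one d' = cls x (T.operad.str.one e) (fun _ => hd) hd := by
  obtain ⟨h1, -, -, -⟩ := hq.app_eq x
  subst hd
  exact (h1 e).symm

lemma ExtendsQuotient.act_cls (hq : ExtendsQuotient q) {T : Tree} (x : X.obj (op T)) {m n : ℕ}
    (σ : Fin m ≃ Fin n) {c : Fin n → T.Edge} {e : T.Edge} {c₂ : Fin m → T.Edge}
    (h₂ : ∀ i, c₂ i = c (σ i)) (o : T.operad.Op n c e) {c' : Fin n → Vert X}
    {c₂' : Fin m → Vert X} {d' : Vert X} (h : ∀ i, c₂' i = c' (σ i))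
    (hc : ∀ i, X.pull (T.edgeMap (c i)) x = c' i) (hd : X.pull (T.edgeMap e) x = d') :
    S.act σ h (cls x o hc hd) =
      cls x (T.operad.str.act σ h₂ o) (fun i => by rw [h₂, hc, h]) hd := by
  obtain ⟨-, h2, -, -⟩ := hq.app_eq x
  obtain rfl : (fun i => X.pull (T.edgeMap (c i)) x) = c' := funext hc
  obtain rfl : (fun i => X.pull (T.edgeMap (c₂ i)) x) = c₂' := by
    funext i
    rw [h i, h₂ i]
  subst hd
  exact (h2 σ h₂ o).symm

lemma ExtendsQuotient.comp_cls (hq : ExtendsQuotient q) {T : Tree} (x : X.obj (op T)) {n : ℕ}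
    {k : Fin n → ℕ} {c : Fin n → T.Edge} {e : T.Edge} {b : ∀ i, Fin (k i) → T.Edge}
    (o : T.operad.Op n c e) (o' : ∀ i, T.operad.Op (k i) (b i) (c i))
    {c' : Fin n → Vert X} {d' : Vert X} {b' : ∀ i, Fin (k i) → Vert X}
    (hc : ∀ i, X.pull (T.edgeMap (c i)) x = c' i) (hd : X.pull (T.edgeMap e) x = d')
    (hb : ∀ i j, X.pull (T.edgeMap (b i j)) x = b' i j) :
    S.comp (cls x o hc hd) (fun i => cls x (o' i) (hb i) (hc i)) =
      cls x (T.operad.str.comp o o') (fun _ => hb _ _) hd := by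
  obtain ⟨-, -, h3, -⟩ := hq.app_eq x
  obtain rfl : (fun i => X.pull (T.edgeMap (c i)) x) = c' := funext hc
  obtain rfl : (fun i j => X.pull (T.edgeMap (b i j)) x) = b' := by
    funext i j
    exact hb i j
  subst hd
  exact (h3 o o').symm

/-- Both structures obey the same formulas on classes coming from a dendrex, and every unit, class
or composable family of classes has this form. -/
lemma ExtendsQuotient.str_eq (hX : IsInnerKan X) (hq : ExtendsQuotient q) : S = hoStr hX := by
  have hone : S.one = (hoStr hX).one := by
    funext d
    have hd : X.pull (eta.edgeMap ()) d = d :=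
      (congrArg (fun χ => X.pull χ d) (by ext1; rfl : edgeMap eta () = 𝟙 eta)).trans (pull_id d)
    exact (hq.one_cls (T := eta) d () hd).trans (one_eq_cls (T := eta) d () hd).symm
  have hact : @S.act = @(hoStr hX).act := by
    funext m n σ c c' d h F
    obtain ⟨f, hc, hd, rfl⟩ := exists_hoMk F
    rw [cls_corolla f hc hd]
    exact (hq.act_cls f σ (fun _ => rfl) (corollaOp n) h hc hd).trans
      (hoAct_cls hX f σ (fun _ => rfl) (corollaOp n) h hc hd).symm
  have hcomp : @S.comp = @(hoStr hX).comp := by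
    funext n c d k b F G
    obtain ⟨T, x, c₁, e, b₁, o, o', hc, hd, hb, rfl, rfl⟩ := exists_cls_twoLevel hX F G
    exact (hq.comp_cls x o o' hc hd hb).trans (hoComp_cls hX x o o' hc hd hb).symm
  exact OperadStr.ext hone hact hcomp

lemma ExtendsQuotient.app_eq_structMap (hX : IsInnerKan X)
    {q : X ⟶ nerve (HoOperad X (hoStr hX))} (hq : ExtendsQuotient q) {T : Tree}
    (x : X.obj (op T)) :
    (q.app (op T) x : OperadHom T.operad (HoOperad X (hoStr hX))) = structMap hX x := by
  obtain ⟨h1, h2, h3, h⟩ := hq.app_eq x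
  exact h

end Extends

end Dendroidal

namespace Dendroidal

open Dendroidal.Tree

variable {X : DendroidalSet.{u}}

/-! ## Strict inner Kan complexes -/

namespace Tree

variable {S T : Tree}

lemma exists_face_factor (χ : S ⟶ T) {e : T.Edge} (he : T.Inner e)
    (h : ∃ w, ¬ T.Leaf w ∧ w ∉ verts χ) :
    ∃ F : T.Face, F ≠ Face.inner e he ∧ ∃ ψ : S ⟶ F.dom, ψ ≫ F.map = χ := by
  obtain ⟨w, hw, hwχ⟩ := h
  rcases exists_outer_factor χ he hw hwχ with ⟨v, hv, ψ, hψ⟩ | ⟨d, hd, ψ, hψ⟩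
  · exact ⟨.top v hv, nofun, ψ, hψ⟩
  · exact ⟨.bottom d hd, nofun, ψ, hψ⟩

lemma edgeMap_factor {e : T.Edge} (he : T.Inner e) (x : T.Edge) :
    ∃ F : T.Face, F ≠ Face.inner e he ∧ ∃ ψ : eta ⟶ F.dom, ψ ≫ F.map = T.edgeMap x := by
  refine exists_face_factor _ he ⟨e, he.2, fun h => ?_⟩
  obtain ⟨-, h2, h3⟩ := mem_verts.1 h
  exact h3 () trivial h2

lemma opMap_factor {e : T.Edge} (he : T.Inner e) {n : ℕ} (c : Fin n → T.Edge) {d : T.Edge}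
    (hd : ¬ T.Leaf d) (hc : Set.range c = {x | T.In x d}) (h) :
    ∃ F : T.Face, F ≠ Face.inner e he ∧ ∃ ψ : corolla n ⟶ F.dom, ψ ≫ F.map = T.opMap c d h := by
  have hv : verts (T.opMap c d h) = {d} := by
    rw [verts_opMap, hc, used_vertex d hd]
  refine exists_face_factor _ he ?_
  rw [hv]
  -- The inner edge gives a second vertex, which the corolla at `d` misses: `e` itself, or the root
  -- vertex if `d = e`.
  by_cases hed : e = d
  · refine ⟨T.root, fun hl => he.1 ((above_root e).eq_of_leaf hl), fun hr => ?_⟩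
    exact he.1 (hed.trans hr.symm)
  · exact ⟨e, he.2, hed⟩

lemma exists_enum_vertex (d : T.Edge) (hd : ¬ T.Leaf d) :
    ∃ (n : ℕ) (c : Fin n → T.Edge), Set.range c = {x | T.In x d} ∧
      (Function.Injective c ∧ T.IsOp (Set.range c) d) := by
  obtain ⟨n, c, hc, hr⟩ := exists_enum {x | T.In x d}
  exact ⟨n, c, hr, hc, hr ▸ IsOp.vertex hd⟩

/-- A tree without inner edges is `η` or a corolla. -/
lemma factors_of_not_inner (hT : ∀ e, ¬ T.Inner e) :
    (∃ (e : T.Edge) (π : T ⟶ eta), π ≫ T.edgeMap e = 𝟙 T) ∨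
      ∃ (n : ℕ) (c : Fin n → T.Edge) (e : T.Edge)
        (h : Function.Injective c ∧ T.IsOp (Set.range c) e) (π : T ⟶ corolla n),
        π ≫ T.opMap c e h = 𝟙 T := by
  by_cases hr : T.Leaf T.root
  · refine Or.inl ⟨T.root, factors_edge (fun s => ?_) hr⟩
    exact (emap_id s).trans ((above_root s).eq_of_leaf hr)
  · obtain ⟨n, c, hc, h⟩ := exists_enum_vertex T.root hr
    have hl : ∀ x, x ≠ T.root → T.Leaf x := fun x hx => by
      by_contra hxl
      exact hT x ⟨hx, hxl⟩
    refine Or.inr ⟨n, c, T.root, h, factors (opMap_injective h ?_) ?_ ?_⟩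
    · rw [hc]
      exact T.not_in_root
    · rw [range_opMap, hc]
      rintro _ ⟨s, rfl⟩
      rw [emap_id]
      by_cases hs : s = T.root
      · exact Or.inl hs
      · obtain ⟨z, hz, hsz⟩ := (above_root s).exists_in hs
        have hzr : z ≠ T.root := by
          rintro rfl
          exact T.not_in_root hz
        obtain rfl := hsz.eq_of_leaf (hl z hzr)
        exact Or.inr hz
    · rw [verts_id, verts_opMap, hc, used_vertex _ hr]
      intro w hw
      by_contra hwr
      exact hw (hl w hwr)

end Tree

/-- Two maps out of `Ω(T)` are equal if they agree on the edges and the vertices of `T`. -/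
lemma OperadHom.ext_of_vertices {T : Tree} {Q : Operad.{u, v}} {φ ψ : OperadHom T.operad Q}
    (hcol : φ.col = ψ.col)
    (hop : ∀ d, ¬ T.Leaf d → ∃ (n : ℕ) (c : Fin n → T.Edge) (_ : Set.range c = {x | T.In x d})
      (o : T.operad.Op n c d),
      (⟨_, _, φ.op o⟩ : Σ (c : Fin n → Q.Colour) (d : Q.Colour), Q.Op n c d) = ⟨_, _, ψ.op o⟩) :
    φ = ψ := by
  obtain ⟨col, op₁, one₁, act₁, comp₁⟩ := φ
  obtain ⟨col', op₂, one₂, act₂, comp₂⟩ := ψ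
  dsimp only at hcol
  subst hcol
  have key : ∀ {R : Set T.Edge} {e : T.Edge}, T.IsOp R e → ∀ (n : ℕ) (c : Fin n → T.Edge)
      (_ : Set.range c = R) (o : T.operad.Op n c e), op₁ o = op₂ o := by
    intro R e hR
    induction hR with
    | unit e =>
      intro n c hc o
      have hce : ∀ i, c i = e := fun i => by
        have : c i ∈ Set.range c := ⟨i, rfl⟩
        rwa [hc] at this
      have hn : n = 1 := by
        have h1 : Subsingleton (Fin n) := ⟨fun i j => o.down.1 ((hce i).trans (hce j).symm)⟩
        have h2 : e ∈ Set.range c := hc ▸ rfl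
        obtain ⟨i, -⟩ := h2
        have h3 := Fin.subsingleton_iff_le_one.1 h1
        have h4 := i.pos
        omega
      subst hn
      obtain rfl : c = fun _ => e := funext hce
      exact (one₁ e).trans (one₂ e).symm
    | graft d hd R h ih =>
      intro n c hc o
      -- Up to a permutation, `o` is the vertex `d` composed with operations on its inputs, to which
      -- the induction hypothesis applies.
      obtain ⟨m, b, hb, o', ho'⟩ := hop d hd
      simp only [Sigma.mk.injEq, heq_eq_eq, true_and] at ho'
      have hbd : ∀ i, T.In (b i) d := fun i => by
        have : b i ∈ Set.range b := ⟨i, rfl⟩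
        rwa [hb] at this
      choose k a ha1 ha2 using fun i => exists_enum (R (b i))
      let o'' : ∀ i, T.operad.Op (k i) (a i) (b i) :=
        fun i => ⟨ha1 i, (ha2 i).symm ▸ h (b i) (hbd i)⟩
      have ho'' : ∀ i, op₁ (o'' i) = op₂ (o'' i) := fun i => ih _ (hbd i) _ _ (ha2 i) _
      have hr : Set.range c = Set.range (concat a) := by
        rw [hc]
        ext y
        constructor
        · rintro ⟨x, hx, hy⟩
          have : x ∈ Set.range b := by rwa [hb]
          obtain ⟨i, rfl⟩ := this
          rw [← ha2 i] at hy
          obtain ⟨j, rfl⟩ := hy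
          exact ⟨finSigmaFinEquiv ⟨i, j⟩, concat_apply _ _⟩
        · rintro ⟨x, rfl⟩
          exact ⟨_, hbd (finSigmaFinEquiv.symm x).1, ha2 (finSigmaFinEquiv.symm x).1 ▸ ⟨_, rfl⟩⟩
      -- The lists `c` and `concat a` enumerate the same set without repetition; `σ` matches them.
      let σ : Fin n ≃ Fin (∑ i, k i) := (Equiv.ofInjective c o.down.1).trans
        ((Equiv.setCongr hr).trans
          (Equiv.ofInjective _ (T.operad.str.comp o' o'').down.1).symm)
      have hσ : ∀ i, c i = concat a (σ i) := fun i =>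
        (congrArg Subtype.val (Equiv.apply_symm_apply
          (Equiv.ofInjective _ (T.operad.str.comp o' o'').down.1)
          (Equiv.setCongr hr (Equiv.ofInjective c o.down.1 i)))).symm
      have e1 := act₁ σ hσ (T.operad.str.comp o' o'')
      have e2 := act₂ σ hσ (T.operad.str.comp o' o'')
      rw [comp₁, ho', funext ho'', ← comp₂] at e1
      exact e1.trans e2.symm
  have : @op₁ = @op₂ := by
    funext n c d o
    exact key o.down.2 n c rfl o
  subst this
  rfl

lemma OperadHom.ext_of_comp {T : Tree} {Q : Operad.{u, v}} {φ ψ : OperadHom T.operad Q}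
    (hcol : ∀ e, OperadHom.comp (T.edgeMap e) φ = OperadHom.comp (T.edgeMap e) ψ)
    (hop : ∀ {n : ℕ} {c : Fin n → T.Edge} {d : T.Edge} (h), ¬ T.Leaf d →
      Set.range c = {x | T.In x d} →
        OperadHom.comp (T.opMap c d h) φ = OperadHom.comp (T.opMap c d h) ψ) : φ = ψ := by
  refine OperadHom.ext_of_vertices (funext fun e => congrArg (fun χ => χ.col ()) (hcol e))
    fun d hd => ?_
  obtain ⟨n, c, hc, h⟩ := exists_enum_vertex d hd
  exact ⟨n, c, hc, ⟨h⟩, congrArg (fun x => nerveOp (P := Q) x) (hop h hd hc)⟩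

/-- A homotopy from `f` to `g` and one from `f` to `f` agree on both vertices of `extRoot n`, hence
on its inner horn. By strictness they are equal, and so are their inner faces `g` and `f`. -/
lemma HomotopicRoot.eq (hX : IsStrictInnerKan X) {n : ℕ} {f g : Cor X n} (h : HomotopicRoot f g) :
    f = g := by
  obtain ⟨D, d1, d2, d3⟩ := HomotopicRoot.refl f
  obtain ⟨H, h1, rfl, h3⟩ := h
  rw [← d2]
  have htop := d1.trans h1.symm
  have hbot := d3.trans h3.symm
  have hinner : (extRoot n).Inner (some none) := ⟨nofun, by rintro ⟨k, hk⟩; cases hk⟩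
  have hinner' : ∀ k, (extRoot n).Inner k → k = some none := by
    rintro (_ | _ | k) hk
    · exact (hk.1 rfl).elim
    · rfl
    · exact (hk.2 ⟨k, rfl⟩).elim
  have hleaf : ¬ (extRoot n).Leaf none := by rintro ⟨k, hk⟩; cases hk
  congr 1
  refine ext_of_horn hX hinner fun F hF => ?_
  cases F with
  | inner k hk =>
    obtain rfl := hinner' k hk
    exact (hF rfl).elim
  | top v hv =>
    obtain rfl := hinner' v hv.1
    have : ∃ ψ, ψ ≫ opMap (extRoot n) (fun _ : Fin 1 => some none) none
        ⟨Function.injective_of_subsingleton _, extRoot_bottom n⟩ = (extRoot n).pruneMap _ hv := by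
      refine factors (opMap_injective _ (by rintro ⟨i, h⟩; cases h)) ?_ ?_
      · rw [range_pruneMap, range_opMap]
        rintro (_ | _ | i) hi
        · exact Or.inl rfl
        · exact Or.inr ⟨0, rfl⟩
        · exact (hi (Or.inl ⟨⟨i, rfl⟩, rfl⟩)).elim
      · rw [verts_pruneMap, verts_opMap]
        rintro (_ | _ | i) ⟨hi, hi'⟩
        · refine ⟨hi, Above.refl _, ?_⟩
          rintro _ ⟨j, rfl⟩ h
          exact hinner.1 (eq_root_of_above (T := extRoot n) h)
        · exact (hi' rfl).elim
        · exact (hi ⟨i, rfl⟩).elim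
    obtain ⟨ψ, hψ⟩ := this
    change X.pull ((extRoot n).pruneMap _ hv) D = X.pull ((extRoot n).pruneMap _ hv) H
    rw [← hψ, pull_comp, pull_comp, hbot]
  | bottom d hd =>
    obtain ⟨⟨k, rfl⟩, -⟩ | ⟨rfl, -⟩ := hd.1
    · exact (hd.2.1 ⟨k, rfl⟩).elim
    obtain ⟨ψ, hψ⟩ := factors_extRootTop ((extRoot n).upperMap (some none)) (by
      rintro ⟨s, hs⟩ rfl
      exact hinner.1 (eq_root_of_above (T := extRoot n) hs))
    change X.pull ((extRoot n).upperMap _) D = X.pull ((extRoot n).upperMap _) H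
    rw [← hψ, pull_comp, pull_comp]
    exact congrArg _ htop
  | edge hT x => cases hT.unique hleaf hinner.2

/-- A dendrex of a strict inner Kan complex is determined by its edges and its operations. -/
lemma ext_of_opMap (hX : IsStrictInnerKan X) {T : Tree} {x y : X.obj (op T)}
    (h1 : ∀ e, X.pull (T.edgeMap e) x = X.pull (T.edgeMap e) y)
    (h2 : ∀ {n : ℕ} (c : Fin n → T.Edge) (e : T.Edge) (h),
      X.pull (T.opMap c e h) x = X.pull (T.opMap c e h) y) : x = y := by
  induction hN : T.nverts using Nat.strong_induction_on generalizing T with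
  | _ N ih =>
  subst hN
  by_cases hT : ∃ e, T.Inner e
  · obtain ⟨e, he⟩ := hT
    -- The faces have fewer vertices, and both hypotheses pass to them because arrows send edges to
    -- edges and operations to operations.
    refine ext_of_horn hX he fun F _ => ih _ (Face.inj_and_lt F he).2 ?_ ?_ rfl
    · intro a
      rw [pull_edgeMap, pull_edgeMap, h1]
    · intro n c a h
      have : opMap F.dom c a h ≫ F.map = T.opMap _ _ (hom_op F.map h) := by
        ext (_ | i) <;> rfl
      rw [← pull_comp, ← pull_comp, this, h2]
  · rw [not_exists] at hT
    rw [← pull_id x, ← pull_id y]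
    rcases factors_of_not_inner hT with ⟨e, π, h⟩ | ⟨n, c, e, h', π, h⟩
    · rw [← h, pull_comp, pull_comp, h1]
    · rw [← h, pull_comp, pull_comp, h2]

lemma structMap_injective (hX : IsInnerKan X) (hX' : IsStrictInnerKan X) (T : Tree) :
    Function.Injective (structMap hX (T := T)) := by
  intro x y hxy
  refine ext_of_opMap hX' (fun e => congrArg (fun φ => φ.col e) hxy) fun c e h => ?_
  have h1 := congrArg (fun φ => nerveOp (P := HoOperad X (hoStr hX))
    (OperadHom.comp (T.opMap c e h) φ)) hxy
  have h2 := (sigma_cls x (c := c) (e := e) ⟨h⟩).trans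
    (Eq.trans h1 (sigma_cls y (c := c) (e := e) ⟨h⟩).symm)
  have h3 := congrArg
    (fun p : Σ (c : Fin _ → Vert X) (d : Vert X), HoOp X _ c d => HoOp.forget hX p.2.2) h2
  exact (homotopicRoot_of_quot hX h3).eq hX'

/-- Induction on the number of vertices: `φ` is lifted on each face in a horn and the lifts are
glued by the horn filler, whose operad map agrees with `φ` on every edge and vertex. -/
lemma structMap_surjective (hX : IsInnerKan X) (hX' : IsStrictInnerKan X) (T : Tree) :
    Function.Surjective (structMap hX (T := T)) := by
  induction hN : T.nverts using Nat.strong_induction_on generalizing T with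
  | _ N ih =>
  subst hN
  intro φ
  by_cases hT : ∃ e, T.Inner e
  · obtain ⟨e, he⟩ := hT
    have key : ∀ (S : Tree) (χ : S ⟶ T), hornSieve T e he χ →
        ∃ t, structMap hX t = OperadHom.comp χ φ := by
      rintro S _ ⟨F, hF, ψ, rfl⟩
      obtain ⟨y, hy⟩ := ih _ (Face.inj_and_lt F he).2 F.dom rfl (OperadHom.comp F.map φ)
      exact ⟨X.pull ψ y, (structMap_pull hX ψ y).trans (congrArg (OperadHom.comp ψ) hy)⟩
    choose z hz using key
    obtain ⟨x, hx⟩ := extendable_hornSieve hX T e he (fun S χ h => z S χ h)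
      ((Presieve.compatible_iff_sieveCompatible _).2 (by
        intro Y Z f g hf
        -- The chosen lifts are compatible because lifts are unique.
        refine structMap_injective hX hX' Z ?_
        refine (hz _ _ ((hornSieve T e he).downward_closed hf g)).trans ?_
        exact ((structMap_pull hX g _).trans (congrArg (OperadHom.comp g) (hz _ _ hf))).symm))
    have hface : ∀ {S : Tree} (χ : S ⟶ T), hornSieve T e he χ →
        OperadHom.comp χ (structMap hX x) = OperadHom.comp χ φ := by
      intro S χ hχ
      rw [← structMap_pull, ← hz S χ hχ]
      exact congrArg _ (hx χ hχ)
    refine ⟨x, OperadHom.ext_of_comp (fun a => hface _ (edgeMap_factor he a)) ?_⟩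
    intro n c d h hd hc
    exact hface _ (opMap_factor he c hd hc h)
  · rw [not_exists] at hT
    -- Without inner edges, `𝟙 T` factors through `η` or a corolla, so it suffices to lift `φ`
    -- there: a colour is its own lift, and an operation lifts to a representative of its class.
    suffices H : ∃ (S : Tree) (ω : S ⟶ T) (π : T ⟶ S) (f : X.obj (op S)), π ≫ ω = 𝟙 T ∧
        structMap hX f = OperadHom.comp ω φ by
      obtain ⟨S, ω, π, f, h1, h2⟩ := H
      refine ⟨X.pull π f, ?_⟩
      rw [structMap_pull, h2]
      exact congrArg (fun χ => OperadHom.comp (Q := T.operad) χ φ) h1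
    rcases factors_of_not_inner hT with ⟨e, π, h⟩ | ⟨n, c, e, h', π, h⟩
    · refine ⟨eta, T.edgeMap e, π, φ.col e, h, ?_⟩
      refine OperadHom.ext_of_vertices ?_ fun d hd => (hd trivial).elim
      funext a
      exact (congrArg (fun χ => X.pull χ _) (by ext1; rfl : edgeMap eta () = 𝟙 eta)).trans
        (pull_id _)
    · obtain ⟨f, hc, hd, hf⟩ := exists_hoMk (φ.op (T.operad.str.act (Equiv.refl _) (fun _ => rfl)
        (⟨h'⟩ : T.operad.Op n c e)))
      refine ⟨corolla n, T.opMap c e h', π, f, h, OperadHom.ext_of_vertices ?_ ?_⟩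
      · funext a
        rcases a with _ | i
        · exact hd
        · exact hc i
      · intro d hd'
        obtain rfl : d = none := not_not.1 hd'
        refine ⟨n, some, (corolla_in n).symm, corollaOp n, ?_⟩
        refine (sigma_cls (T := corolla n) f (corollaOp n)).symm.trans ?_
        rw [opMap_some_none, pull_id, sigma_hoMk hc hd, ← hf]
        rfl

lemma ExtendsQuotient.isIso (hX : IsInnerKan X) (hX' : IsStrictInnerKan X)
    {S : OperadStr (Vert X) (HoOp X)} {q : X ⟶ nerve (HoOperad X S)} (hq : ExtendsQuotient q) :
    IsIso q := by
  obtain rfl := hq.str_eq hX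
  rw [NatTrans.isIso_iff_isIso_app]
  rintro ⟨T⟩
  rw [isIso_iff_bijective]
  have : (q.app (op T) : X.obj (op T) → OperadHom T.operad (HoOperad X (hoStr hX))) =
      structMap hX := funext fun x => hq.app_eq_structMap hX x
  exact this ▸ ⟨structMap_injective hX hX' T, structMap_surjective hX hX' T⟩

end Dendroidal

theorem proposition6p6 (X : Dendroidal.DendroidalSet.{u}) (hX : Dendroidal.IsInnerKan X) :
    (∃! S : Dendroidal.OperadStr (Dendroidal.Vert X) (Dendroidal.HoOp X),
      ∃ q : X ⟶ Dendroidal.nerve (Dendroidal.HoOperad X S), Dendroidal.ExtendsQuotient q) ∧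
    (Dendroidal.IsStrictInnerKan X →
      ∀ (S : Dendroidal.OperadStr (Dendroidal.Vert X) (Dendroidal.HoOp X))
        (q : X ⟶ Dendroidal.nerve (Dendroidal.HoOperad X S)),
        Dendroidal.ExtendsQuotient q → IsIso q) := by
  refine ⟨⟨Dendroidal.hoStr hX, ⟨Dendroidal.toNerve hX, Dendroidal.toNerve_extendsQuotient hX⟩,
    ?_⟩, fun hX' S q hq => hq.isIso hX hX'⟩
  rintro S ⟨q, hq⟩
  exact hq.str_eq hX
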